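/- **Setting.** Let $d\ge 0$ and $n\ge 1$ be integers, $f_1,\dots,f_n:\mathbb R^d\to\mathbb R$ and $f=\frac1n\sum_{i=1}^n f_i$; let $r:\mathbb R^d\to\mathbb R\cup\{+\infty\}$ be proper and lower semicontinuous, and $F=f+r$. Let $u:\mathbb R^d\times\mathbb R^d\to\mathbb R\cup\{+\infty\}$ be a surrogate of $r$, that is, $u(y,y)=r(y)$ and $u(x,y)\ge r(x)$ for all $x,y$. **Assumption 1.** $F$ is bounded from below; every $f_i$ is continuously differentiable; and there is $L>0$ with $\frac1n\sum_{i=1}^n\|\nabla f_i(x)-\nabla f_i(y)\|^2\le L^2\|x-y\|^2$ for all $x,y\in\mathbb R^d$. **Assumption 2.** (a) For every $x$, $u(x,\cdot)$ is continuous (as a map into $\mathbb R\cup\{+\infty\}$). (b) For every $y$, $u(\cdot,y)$ is lower semicontinuous and convex. (c) There is $\bar h:\mathbb R^d\times\mathbb R^d\to\mathbb R\cup\{+\infty\}$ such that for every $y$: $\bar h(y,y)=0$, $\bar h(\cdot,y)$ is finite near $y$ and continuously differentiable at $y$ with $\nabla\bar h(\cdot,y)(y)=0$, and $u(x,y)\le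 r(x)+\bar h(x,y)$ for all $x$. **Algorithms.** Let $b,m\ge 1$ be integers, $\mu>L/2$ and $x^0\in\mathbb R^d$; for MM-SAGA let also $b\le n$. For $k=0,1,2,\dots$ let $I_k=(i_1,\dots,i_b)$ be a list of $b$ indices (repetitions allowed) drawn independently and uniformly from $\{1,\dots,n\}$; for MM-SVRG and MM-SARAH let $c_k$ be a coin which shows "success" with probability $1/m$. All draws, over all $k$, are independent. Below, $\sum_{i\in I_k}$ is the sum over the $b$ entries of the list. Each method sets $$x^{k+1}=\operatorname*{argmin}_{x\in\mathbb R^d}\ \tfrac\mu2\|x-x^k\|^2+\langle \widetilde\nabla f(x^k),x\rangle+u(x,x^k),$$ where a minimizer is required to have a finite objective value, and $\widetilde\nabla f(x^k)$ is: * MM-SAGA: $\frac1b\sum_{i\in I_k}\big(\nabla f_i(x^k)-\nabla f_i(x_i^{k-1})\big)+\frac1n\sum_{i=1}^n\nabla f_i(x_i^{k-1})$, where $x_i^{-1}=x^0$, and $x_i^k=x^k$ if $i$ occurs in $I_k$, $x_i^k=x_i^{k-1}$ otherwise. * MM-SVRG: $\frac1b\sum_{i\in I_k}\big(\nabla f_i(x^k)-\nabla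 f_i(\tilde x^k)\big)+\nabla f(\tilde x^k)$, where $\tilde x^{-1}=x^0$, and $\tilde x^k=x^k$ if $c_k$ is a success, $\tilde x^k=\tilde x^{k-1}$ otherwise. * MM-SARAH: $\nabla f(x^k)$ if $c_k$ is a success, and $\frac1b\sum_{i\in I_k}\big(\nabla f_i(x^k)-\nabla f_i(x^{k-1})\big)+\widetilde\nabla f(x^{k-1})$ otherwise, where $x^{-1}=x^0$ and $\widetilde\nabla f(x^{-1})=\nabla f(x^0)$. **Constants.** MM-SAGA: $\rho=\frac b{2n}$, $V_\Upsilon=\frac{(2n-b)L^2}{b^2}$, $V=0$. MM-SVRG: $\rho=\frac1{2m}$, $V_\Upsilon=\frac{(2m-1)L^2}{b}$, $V=0$. MM-SARAH: $\rho=\frac1m$, $V_\Upsilon=\frac{(m-1)L^2}{mb}$, $V=\frac{L^2}{b}$. **Theorem (almost surely subsequential convergence).** Let $\{x^k\}$ be generated by one of the three methods, let Assumptions 1 and 2 hold, and suppose that, with the constants of that method, $(2\mu-L)^2-4(V+V_\Upsilon/\rho)>0$. Then: (a) almost surely, $\{F(x^k)\}$ converges (to a finite limit); (b) almost surely, $\sum_{k\ge1}\|x^k-x^{k-1}\|^2<\infty$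 (in particular $\|x^k-x^{k-1}\|^2\to0$); (c) almost surely, every limit point $x^*$ of $\{x^k\}$ is a stationary point of $F$, i.e. $x^*\in\operatorname{dom}F$ and $0\in\partial F(x^*)$. Here the Fréchet subdifferential $\hat\partial F(x)$ at $x\in\operatorname{dom}F$ is the set of $v$ with $\liminf_{y\to x,\,y\ne x}\frac{F(y)-F(x)-\langle v,y-x\rangle}{\|y-x\|}\ge0$ (and $\hat\partial F(x)=\emptyset$ for $x\notin\operatorname{dom}F$), and the limiting subdifferential $\partial F(x)$ is the set of limits of sequences $v^k\in\hat\partial F(z^k)$ with $z^k\to x$ and $F(z^k)\to F(x)$. -/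

import Mathlib

open Filter Topology MeasureTheory ProbabilityTheory

noncomputable section

namespace SVRMM

/-! ### Variational analysis for functions with values in `ℝ ∪ {+∞}`

Such a function is a map into `EReal` that never takes the value `⊥`. -/

section Variational

variable {E : Type*} [NormedAddCommGroup E] [InnerProductSpace ℝ E]

/-- The Fréchet subdifferential of `g` at `x`; it is empty where `g x = +∞`. -/
def frechetSubdiff (g : E → EReal) (x : E) : Set E :=
  {v | g x ≠ ⊤ ∧
    0 ≤ liminf (fun y : E =>
      ((‖y - x‖⁻¹ : ℝ) : EReal) * (g y - g x - ((inner ℝ v (y - x) : ℝ) : EReal))) (𝓝[≠] x)}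

/-- The limiting subdifferential of `g` at `x`; it is empty where `g x = +∞`. -/
def limitingSubdiff (g : E → EReal) (x : E) : Set E :=
  {v | g x ≠ ⊤ ∧ ∃ (z w : ℕ → E),
    Tendsto z atTop (𝓝 x) ∧ Tendsto (fun k => g (z k)) atTop (𝓝 (g x)) ∧
    (∀ k, w k ∈ frechetSubdiff g (z k)) ∧ Tendsto w atTop (𝓝 v)}

/-- `x ∈ dom g` and `0 ∈ ∂g(x)`. -/
def IsStationary (g : E → EReal) (x : E) : Prop :=
  g x ≠ ⊤ ∧ (0 : E) ∈ limitingSubdiff g x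

/-- `x` belongs to `argmin φ`; as usual the function that is `+∞` everywhere has no minimizer. -/
def IsArgmin (φ : E → EReal) (x : E) : Prop :=
  φ x ≠ ⊤ ∧ ∀ z, φ x ≤ φ z

/-- Convexity of a function with values in `ℝ ∪ {+∞}`. -/
def IsConvexFun (φ : E → EReal) : Prop :=
  ∀ (x z : E) (s t : ℝ), 0 < s → 0 < t → s + t = 1 →
    φ (s • x + t • z) ≤ (s : EReal) * φ x + (t : EReal) * φ z

/-- `u(·, ·)` is a surrogate function of `r`. -/
structure IsSurrogate (r : E → EReal) (u : E → E → EReal) : Prop where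
  ne_bot : ∀ x y, u x y ≠ ⊥
  diag : ∀ y, u y y = r y
  le : ∀ x y, r x ≤ u x y

/-- The assumption on the surrogate: continuity in the second variable, lower semicontinuity and
convexity in the first one, and an upper bound `hbar(·, y)` of the approximation error
`u(·, y) - r(·)` that vanishes at `y` and is continuously differentiable at `y` (hence finite
near `y`) with zero gradient there. -/
structure SurrogateAssumption [CompleteSpace E] (r : E → EReal) (u : E → E → EReal) : Prop where
  continuous_right : ∀ x, Continuous (fun y => u x y)
  lsc_left : ∀ y, LowerSemicontinuous (fun x => u x y)
  convex_left : ∀ y, IsConvexFun (fun x => u x y)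
  error_bound : ∃ hbar : E → E → EReal, (∀ x y, hbar x y ≠ ⊥) ∧ ∀ y,
    hbar y y = 0 ∧
    (∀ᶠ x in 𝓝 y, hbar x y ≠ ⊤) ∧
    ContDiffAt ℝ 1 (fun x => (hbar x y).toReal) y ∧
    gradient (fun x => (hbar x y).toReal) y = 0 ∧
    ∀ x, u x y ≤ r x + hbar x y

end Variational

/-! ### The finite-sum problem -/

section Problem

variable {d n : ℕ}

/-- `f = (1/n) ∑ i, f i`. -/
def avg (f : Fin n → EuclideanSpace ℝ (Fin d) → ℝ) (x : EuclideanSpace ℝ (Fin d)) : ℝ :=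
  (1 / (n : ℝ)) * ∑ i, f i x

/-- The gradient of `f = (1/n) ∑ i, f i`. -/
def avgGrad (f : Fin n → EuclideanSpace ℝ (Fin d) → ℝ) (x : EuclideanSpace ℝ (Fin d)) :
    EuclideanSpace ℝ (Fin d) :=
  gradient (avg f) x

/-- `F = f + r`. -/
def objective (f : Fin n → EuclideanSpace ℝ (Fin d) → ℝ) (r : EuclideanSpace ℝ (Fin d) → EReal)
    (x : EuclideanSpace ℝ (Fin d)) : EReal :=
  ((avg f x : ℝ) : EReal) + r x

/-- The standing assumption on the problem: `r` is proper and lower semicontinuous, `F` is bounded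
from below (and proper, since `f` is finite), and the `f i` are continuously differentiable and
`L`-smooth on average. -/
structure BasicAssumption (f : Fin n → EuclideanSpace ℝ (Fin d) → ℝ)
    (r : EuclideanSpace ℝ (Fin d) → EReal) (L : ℝ) : Prop where
  ne_bot : ∀ x, r x ≠ ⊥
  proper : ∃ x, r x ≠ ⊤
  lsc : LowerSemicontinuous r
  bddBelow : ∃ c : ℝ, ∀ x, (c : EReal) ≤ objective f r x
  contDiff : ∀ i, ContDiff ℝ 1 (f i)
  pos : 0 < L
  smooth : ∀ x y, (1 / (n : ℝ)) * ∑ i, ‖gradient (f i) x - gradient (f i) y‖ ^ 2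
    ≤ L ^ 2 * ‖x - y‖ ^ 2

end Problem

/-! ### The three algorithms

In this section everything is deterministic: `x` is a sequence of iterates, `I k` is the list of
`b` (possibly repeated) indices drawn at step `k`, and `c k` tells whether the event of probability
`1/m` occurs at step `k`. -/

section Algorithms

variable {d n b : ℕ}

/-- `x^{k-1}`, with `x^{-1} = x^0`. -/
def prev (x : ℕ → EuclideanSpace ℝ (Fin d)) : ℕ → EuclideanSpace ℝ (Fin d)
  | 0 => x 0
  | k + 1 => x k

/-- `sagaTable x I k i` is `x_i^{k-1}`: `x_i^{-1} = x^0`, while `x_i^k = x^k` if `i ∈ I_k` and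
`x_i^k = x_i^{k-1}` otherwise. -/
def sagaTable (x : ℕ → EuclideanSpace ℝ (Fin d)) (I : ℕ → Fin b → Fin n) :
    ℕ → Fin n → EuclideanSpace ℝ (Fin d)
  | 0 => fun _ => x 0
  | k + 1 => fun i => if ∃ j, I k j = i then x k else sagaTable x I k i

/-- `svrgAnchor x c k` is `x̃^{k-1}`: `x̃^{-1} = x^0`, while `x̃^k = x^k` if `c k` and
`x̃^k = x̃^{k-1}` otherwise. -/
def svrgAnchor (x : ℕ → EuclideanSpace ℝ (Fin d)) (c : ℕ → Bool) :
    ℕ → EuclideanSpace ℝ (Fin d)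
  | 0 => x 0
  | k + 1 => if c k = true then x k else svrgAnchor x c k

/-- The SAGA gradient estimate at step `k`. -/
def sagaGrad (f : Fin n → EuclideanSpace ℝ (Fin d) → ℝ) (x : ℕ → EuclideanSpace ℝ (Fin d))
    (I : ℕ → Fin b → Fin n) (k : ℕ) : EuclideanSpace ℝ (Fin d) :=
  (1 / (b : ℝ)) • ∑ j, (gradient (f (I k j)) (x k)
      - gradient (f (I k j)) (sagaTable x I k (I k j)))
    + (1 / (n : ℝ)) • ∑ i, gradient (f i) (sagaTable x I k i)

/-- The (loop-less) SVRG gradient estimate at step `k`. -/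
def svrgGrad (f : Fin n → EuclideanSpace ℝ (Fin d) → ℝ) (x : ℕ → EuclideanSpace ℝ (Fin d))
    (I : ℕ → Fin b → Fin n) (c : ℕ → Bool) (k : ℕ) : EuclideanSpace ℝ (Fin d) :=
  (1 / (b : ℝ)) • ∑ j, (gradient (f (I k j)) (x k)
      - gradient (f (I k j)) (svrgAnchor x c (k + 1)))
    + avgGrad f (svrgAnchor x c (k + 1))

/-- `sarahGradPrev f x I c k` is the (loop-less) SARAH gradient estimate at step `k - 1`; the one at
step `-1` is `∇f(x^0)`. -/
def sarahGradPrev (f : Fin n → EuclideanSpace ℝ (Fin d) → ℝ) (x : ℕ → EuclideanSpace ℝ (Fin d))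
    (I : ℕ → Fin b → Fin n) (c : ℕ → Bool) : ℕ → EuclideanSpace ℝ (Fin d)
  | 0 => avgGrad f (x 0)
  | k + 1 =>
    if c k = true then avgGrad f (x k)
    else (1 / (b : ℝ)) • ∑ j, (gradient (f (I k j)) (x k) - gradient (f (I k j)) (prev x k))
      + sarahGradPrev f x I c k

/-- The three methods MM-SAGA, MM-SVRG and MM-SARAH. -/
inductive Method where
  | saga
  | svrg
  | sarah

/-- The gradient estimate of each method at step `k`. -/
def gradEst (M : Method) (f : Fin n → EuclideanSpace ℝ (Fin d) → ℝ)
    (x : ℕ → EuclideanSpace ℝ (Fin d)) (I : ℕ → Fin b → Fin n) (c : ℕ → Bool) (k : ℕ) :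
    EuclideanSpace ℝ (Fin d) :=
  match M with
  | .saga => sagaGrad f x I k
  | .svrg => svrgGrad f x I c k
  | .sarah => sarahGradPrev f x I c (k + 1)

/-- `x` is generated by the method `M` from `x0` with the draws `I` and `c`: for every `k`,
`x^{k+1} = argmin_z (μ/2) ‖z - x^k‖² + ⟨gradient estimate at step k, z⟩ + u(z, x^k)`. -/
def IsRun (M : Method) (f : Fin n → EuclideanSpace ℝ (Fin d) → ℝ)
    (u : EuclideanSpace ℝ (Fin d) → EuclideanSpace ℝ (Fin d) → EReal) (μ : ℝ)
    (x0 : EuclideanSpace ℝ (Fin d)) (I : ℕ → Fin b → Fin n) (c : ℕ → Bool)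
    (x : ℕ → EuclideanSpace ℝ (Fin d)) : Prop :=
  x 0 = x0 ∧ ∀ k, IsArgmin (fun z =>
    ((μ / 2 * ‖z - x k‖ ^ 2 + inner ℝ (gradEst M f x I c k) z : ℝ) : EReal) + u z (x k)) (x (k + 1))

/-- The constant `ρ` of each method. -/
def rho (M : Method) (n b m : ℕ) : ℝ :=
  match M with
  | .saga => (b : ℝ) / (2 * n)
  | .svrg => 1 / (2 * (m : ℝ))
  | .sarah => 1 / (m : ℝ)

/-- The constant `V_Υ` of each method. -/
def VUpsilon (M : Method) (n b m : ℕ) (L : ℝ) : ℝ :=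
  match M with
  | .saga => (2 * (n : ℝ) - b) * L ^ 2 / (b : ℝ) ^ 2
  | .svrg => (2 * (m : ℝ) - 1) * L ^ 2 / b
  | .sarah => ((m : ℝ) - 1) * L ^ 2 / (m * b)

/-- The constant `V` of each method. -/
def VConst (M : Method) (b : ℕ) (L : ℝ) : ℝ :=
  match M with
  | .saga => 0
  | .svrg => 0
  | .sarah => L ^ 2 / b

end Algorithms

/-! ### The random draws -/

section Sampling

variable {Ω : Type*} [MeasurableSpace Ω] {n b : ℕ}

/-- The batches `I_0, I_1, …` are independent, and each is uniformly distributed on the lists of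
length `b` in `[n]`, i.e. its `b` entries are independent and uniform on `[n]`. -/
structure IsBatchSampling (P : Measure Ω) (I : ℕ → Ω → Fin b → Fin n) : Prop where
  measurable : ∀ k, Measurable (I k)
  indep : iIndepFun I P
  law : ∀ k (a : Fin b → Fin n), P.real {ω | I k ω = a} = (1 / (n : ℝ)) ^ b

/-- As before, together with coins `c_0, c_1, …` which show `true` with probability `1/m`, where the
pairs `(I_k, c_k)` are independent and `c_k` is independent of `I_k`. -/
structure IsBatchCoinSampling (P : Measure Ω) (m : ℕ) (I : ℕ → Ω → Fin b → Fin n)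
    (c : ℕ → Ω → Bool) : Prop where
  measurable_batch : ∀ k, Measurable (I k)
  measurable_coin : ∀ k, Measurable (c k)
  indep : iIndepFun (fun k ω => (I k ω, c k ω)) P
  law : ∀ k (a : Fin b → Fin n) (t : Bool), P.real {ω | I k ω = a ∧ c k ω = t}
    = (1 / (n : ℝ)) ^ b * (if t = true then 1 / (m : ℝ) else 1 - 1 / (m : ℝ))

/-- The draws used by each method; MM-SAGA tosses no coins. -/
def IsSampling (M : Method) (P : Measure Ω) (m : ℕ) (I : ℕ → Ω → Fin b → Fin n)
    (c : ℕ → Ω → Bool) : Prop :=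
  match M with
  | .saga => IsBatchSampling P I
  | .svrg => IsBatchCoinSampling P m I c
  | .sarah => IsBatchCoinSampling P m I c

end Sampling

end SVRMM

end

/-! Put s = μ - L/2. Strong convexity of the subproblem (`IsArgmin.quadratic_growth`) gives the
decrease of `r` with the full coefficient μ, and the descent lemma costs L/2. Hence F(x^{k+1}) +
s‖x^{k+1} - x^k‖² is at most F(x^k) plus an inner product of the gradient error with the step.
Everything else serves to make the expected squared steps and the expected squared errors summable.
Then almost surely both series converge, and a deterministic argument finishes: F(x^k) decreases up
to a summable error, and along a convergent subsequence the optimality condition of the subproblem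
passes to the limit (`limit_optimality`). Since u(·, x*) exceeds `r` by at most o(‖x - x*‖), even
the Fréchet subdifferential of F contains 0 at x* (`zero_mem_frechetSubdiff`).

For SVRG and SARAH, Young's inequality turns the inner product into half of the quadratic term plus
error²/(2s). The expected error is controlled by a memory term that contracts with rate ρ up to
multiples of the squared steps, and `summable_of_variance_reduction` finds a Lyapunov function
exactly when V + V_Υ/ρ < s², which is the hypothesis divided by 4.

SAGA needs more. Its constants match a survival probability 1 - b/n of a table entry, but a batch
with repetitions misses an index with probability (1 - 1/n)^b, which is larger as soon as b, n ≥ 2.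
The loss is recovered from two sources. The noise has mean zero and the proximal map is monotone, so
the expected inner product costs only spread/(bμ) (`batch_neg_inner_le`, by symmetrization).
Moreover the descent lemma improves when the individual gradients move in different directions
(`BasicAssumption.descent_spread`). The Lyapunov function therefore weighs the spread and the mean
of the table's deviation separately (`sagaLyapunov_step`). Admissible weights are found for every
batch size in `hasLyapunov_saga`; its one exception n = b = 3 is treated by
`hasLyapunov_three_three`.

Only finitely many values occur for the first k draws, so conditional expectations are finite sums
(`integral_le_of_step`). -/

set_option linter.unusedSectionVars false

noncomputable section

namespace SVRMM

/-! ### Means and spreads of finite families, and averages over uniform batches with repetitions. -/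

section FiniteFamilies

variable {V : Type*} [NormedAddCommGroup V] [InnerProductSpace ℝ V] {n b : ℕ}

/-- The mean of a finite family. -/
def mean (v : Fin n → V) : V := (1 / (n : ℝ)) • ∑ i, v i

/-- The mean square of a finite family. -/
def msq (v : Fin n → V) : ℝ := (1 / (n : ℝ)) * ∑ i, ‖v i‖ ^ 2

/-- The variance of a finite family. -/
def spread (v : Fin n → V) : ℝ := msq (fun i => v i - mean v)

/-- The mean over a batch. -/
def batchMean (v : Fin n → V) (a : Fin b → Fin n) : V := (1 / (b : ℝ)) • ∑ j, v (a j)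

/-- The family `v` with the entries in the batch set to zero. -/
def unseen (v : Fin n → V) (a : Fin b → Fin n) (i : Fin n) : V := if ∃ j, a j = i then 0 else v i

lemma msq_nonneg (v : Fin n → V) : 0 ≤ msq v := by unfold msq; positivity

lemma spread_nonneg (v : Fin n → V) : 0 ≤ spread v := msq_nonneg _

lemma mean_add (v w : Fin n → V) : mean (v + w) = mean v + mean w := by
  simp [mean, Finset.sum_add_distrib]

lemma mean_sub (v w : Fin n → V) : mean (v - w) = mean v - mean w := by
  simp [mean, Finset.sum_sub_distrib, smul_sub]

lemma sum_eq_smul_mean (hn : 0 < n) (v : Fin n → V) : ∑ i, v i = (n : ℝ) • mean v := by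
  have : (n : ℝ) ≠ 0 := by positivity
  simp [mean, smul_smul, mul_inv_cancel₀ this]

lemma sum_norm_sq_eq (hn : 0 < n) (v : Fin n → V) : ∑ i, ‖v i‖ ^ 2 = n * msq v := by
  have : (n : ℝ) ≠ 0 := by positivity
  simp only [msq]; field_simp

lemma msq_eq_spread_add (hn : 0 < n) (v : Fin n → V) : msq v = spread v + ‖mean v‖ ^ 2 := by
  have hn' : (n : ℝ) ≠ 0 := by positivity
  have h : ∑ i, ‖v i - mean v‖ ^ 2 = ∑ i, ‖v i‖ ^ 2 - n * ‖mean v‖ ^ 2 := by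
    simp only [norm_sub_sq_real, Finset.sum_add_distrib, Finset.sum_sub_distrib, ← Finset.mul_sum,
      ← sum_inner, sum_eq_smul_mean hn v, inner_smul_left]
    simp; ring
  simp only [spread, msq, h]; field_simp; ring

lemma norm_mean_sq_le (hn : 0 < n) (v : Fin n → V) : ‖mean v‖ ^ 2 ≤ msq v := by
  rw [msq_eq_spread_add hn]; linarith [spread_nonneg v]

lemma spread_le_msq (hn : 0 < n) (v : Fin n → V) : spread v ≤ msq v := by
  rw [msq_eq_spread_add hn]; nlinarith [norm_nonneg (mean v)]

/-- A weighted form of `‖x + y‖² ≤ (1 + s) ‖x‖² + (1 + 1/s) ‖y‖²`. -/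
lemma mul_norm_add_sq_le {k al a : ℝ} (hk : 0 < k) (hka : k < a) (hal : k * a ≤ al * (a - k))
    (x y : V) : k * ‖x + y‖ ^ 2 ≤ al * ‖x‖ ^ 2 + a * ‖y‖ ^ 2 := by
  have h1 : ‖x + y‖ ≤ ‖x‖ + ‖y‖ := norm_add_le x y
  have h2 : ‖x + y‖ ^ 2 ≤ (‖x‖ + ‖y‖) ^ 2 := by gcongr
  have h3 : 0 < a - k := by linarith
  have h4 : 0 ≤ (a - k) * (al * ‖x‖ ^ 2 + a * ‖y‖ ^ 2 - k * (‖x‖ + ‖y‖) ^ 2) := by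
    have : (a - k) * (al * ‖x‖ ^ 2 + a * ‖y‖ ^ 2 - k * (‖x‖ + ‖y‖) ^ 2)
      = (al * (a - k) - k * a) * ‖x‖ ^ 2 + ((a - k) * ‖y‖ - k * ‖x‖) ^ 2 := by ring
    rw [this]; have := mul_nonneg (sub_nonneg.2 hal) (sq_nonneg ‖x‖); positivity
  have h5 := nonneg_of_mul_nonneg_right h4 h3
  nlinarith

lemma mul_msq_add_le {k al a : ℝ} (hk : 0 < k) (hka : k < a) (hal : k * a ≤ al * (a - k))
    (v w : Fin n → V) : k * msq (v + w) ≤ al * msq v + a * msq w := by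
  have h : ∑ i, k * ‖v i + w i‖ ^ 2 ≤ ∑ i, (al * ‖v i‖ ^ 2 + a * ‖w i‖ ^ 2) :=
    Finset.sum_le_sum fun i _ => mul_norm_add_sq_le hk hka hal _ _
  rw [← Finset.mul_sum, Finset.sum_add_distrib, ← Finset.mul_sum, ← Finset.mul_sum] at h
  have h' := mul_le_mul_of_nonneg_left h (by positivity : 0 ≤ 1 / (n : ℝ))
  simp only [msq, Pi.add_apply]; linarith

lemma mul_spread_add_le {k al a : ℝ} (hk : 0 < k) (hka : k < a) (hal : k * a ≤ al * (a - k))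
    (v w : Fin n → V) : k * spread (v + w) ≤ al * spread v + a * spread w := by
  have h := mul_msq_add_le hk hka hal (fun i => v i - mean v) (fun i => w i - mean w)
  have e : (fun i => (v + w) i - mean (v + w))
      = (fun i => v i - mean v) + (fun i => w i - mean w) := by
    funext i; simp only [mean_add, Pi.add_apply]; abel
  simp only [spread]; rw [e]; exact h

lemma msq_sum_le (N : ℕ) (v : ℕ → Fin n → V) :
    msq (∑ j ∈ Finset.range N, v j) ≤ N * ∑ j ∈ Finset.range N, msq (v j) := by
  have h : ∀ i, ‖∑ j ∈ Finset.range N, v j i‖ ^ 2 ≤ N * ∑ j ∈ Finset.range N, ‖v j i‖ ^ 2 :=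
    fun i => by
    calc ‖∑ j ∈ Finset.range N, v j i‖ ^ 2 ≤ (∑ j ∈ Finset.range N, ‖v j i‖) ^ 2 := by
          gcongr; exact norm_sum_le _ _
      _ ≤ (Finset.range N).card * ∑ j ∈ Finset.range N, ‖v j i‖ ^ 2 := sq_sum_le_card_mul_sum_sq
      _ = _ := by simp
  have h2 : ∑ i, ‖∑ j ∈ Finset.range N, v j i‖ ^ 2
      ≤ ∑ i, N * ∑ j ∈ Finset.range N, ‖v j i‖ ^ 2 := Finset.sum_le_sum fun i _ => h i
  rw [← Finset.mul_sum, Finset.sum_comm] at h2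
  have h' := mul_le_mul_of_nonneg_left h2 (by positivity : 0 ≤ 1 / (n : ℝ))
  simp only [msq, Finset.sum_apply, ← Finset.mul_sum]; linarith

lemma spread_sum_le (N : ℕ) (v : ℕ → Fin n → V) :
    spread (∑ j ∈ Finset.range N, v j) ≤ N * ∑ j ∈ Finset.range N, spread (v j) := by
  have h := msq_sum_le N (fun j i => v j i - mean (v j))
  have e : (fun i => (∑ j ∈ Finset.range N, v j) i - mean (∑ j ∈ Finset.range N, v j))
      = ∑ j ∈ Finset.range N, (fun i => v j i - mean (v j)) := by
    funext i
    have : mean (∑ j ∈ Finset.range N, v j) = ∑ j ∈ Finset.range N, mean (v j) := by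
      simp only [mean, Finset.sum_apply, ← Finset.smul_sum]; rw [Finset.sum_comm]
    rw [this]; simp [Finset.sum_apply, Finset.sum_sub_distrib]
  simp only [spread]; rw [e]; exact h

/-! #### Uniform batches -/

lemma batch_weights_sum (hn : 0 < n) : ∑ _a : Fin b → Fin n, (1 / (n : ℝ)) ^ b = 1 := by
  have : (n : ℝ) ≠ 0 := by positivity
  simp [this]

/-- Independence of the entries: splitting off one entry, the cross terms vanish because the family
sums to zero. The factor `n` on the left avoids the exponent b - 1. -/
lemma sum_norm_sq_sum_batch (v : Fin n → V) (hv : ∑ i, v i = 0) (b : ℕ) :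
    (n : ℝ) * ∑ a : Fin b → Fin n, ‖∑ j, v (a j)‖ ^ 2 = b * (n : ℝ) ^ b * ∑ i, ‖v i‖ ^ 2 := by
  induction b with
  | zero => simp
  | succ b ih =>
    rw [← (Fin.consEquiv (fun _ : Fin (b + 1) => Fin n)).sum_comp, Fintype.sum_prod_type]
    simp only [Fin.consEquiv_apply, Fin.sum_univ_succ, Fin.cons_zero, Fin.cons_succ,
      norm_add_sq_real, Finset.sum_add_distrib, Finset.sum_const, Finset.card_univ,
      Fintype.card_pi, Fintype.card_fin, Finset.prod_const, ← Finset.mul_sum, nsmul_eq_mul]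
    rw [Finset.sum_comm]
    simp only [← sum_inner, hv, inner_zero_left, Finset.sum_const_zero, mul_zero, add_zero, ih]
    push_cast; ring

lemma batch_variance (hn : 0 < n) (hb : 0 < b) (v : Fin n → V) :
    ∑ a : Fin b → Fin n, (1 / (n : ℝ)) ^ b * ‖batchMean v a - mean v‖ ^ 2
      = (1 / (b : ℝ)) * spread v := by
  have hn' : (n : ℝ) ≠ 0 := by positivity
  have hb' : (b : ℝ) ≠ 0 := by positivity
  have h0 : ∑ i, (v i - mean v) = 0 := by
    rw [Finset.sum_sub_distrib, sum_eq_smul_mean hn v]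
    simp [← Nat.cast_smul_eq_nsmul ℝ]
  have h := sum_norm_sq_sum_batch _ h0 b
  have e : ∀ a : Fin b → Fin n, ‖batchMean v a - mean v‖ ^ 2
      = (1 / (b : ℝ)) ^ 2 * ‖∑ j, (v (a j) - mean v)‖ ^ 2 := fun a => by
    have : batchMean v a - mean v = (1 / (b : ℝ)) • ∑ j, (v (a j) - mean v) := by
      rw [Finset.sum_sub_distrib, smul_sub]
      simp [batchMean, ← Nat.cast_smul_eq_nsmul ℝ, smul_smul, hb']
    rw [this, norm_smul, mul_pow]; simp
  simp only [e, ← Finset.mul_sum, spread, msq]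
  have h2 : ∑ a : Fin b → Fin n, ‖∑ j, (v (a j) - mean v)‖ ^ 2
      = b * (n : ℝ) ^ b * (∑ i, ‖v i - mean v‖ ^ 2) / n := by
    rw [eq_div_iff hn']; linarith
  rw [h2]; field_simp
  rw [← mul_pow, one_div_mul_cancel hn', one_pow, one_mul]

/-- The indicator is a product over the entries of the batch, so the sum factorizes. -/
lemma card_avoid (s : Finset (Fin n)) (b : ℕ) :
    (∑ a : Fin b → Fin n, if ∀ j, a j ∉ s then (1 : ℝ) else 0) = ((n : ℝ) - s.card) ^ b := by
  have : ∀ a : Fin b → Fin n, (if ∀ j, a j ∉ s then (1 : ℝ) else 0)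
      = ∏ j, (if a j ∉ s then (1 : ℝ) else 0) := fun a => by
    rw [Finset.prod_ite_zero]; simp
  simp only [this]
  rw [← Fintype.piFinset_univ, Finset.sum_prod_piFinset (Finset.univ : Finset (Fin n))
    (fun (_ : Fin b) i => if i ∉ s then (1 : ℝ) else 0)]
  have h : ∑ i : Fin n, (if i ∉ s then (1 : ℝ) else 0) = (n : ℝ) - s.card := by
    rw [Finset.sum_ite, Finset.sum_const_zero, add_zero, Finset.sum_const, nsmul_eq_mul, mul_one]
    have : Finset.univ.filter (fun i => i ∉ s) = sᶜ := by ext; simp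
    rw [this, Finset.card_compl, Fintype.card_fin, Nat.cast_sub]
    simpa using Finset.card_le_univ s
  rw [h, Finset.prod_const, Finset.card_univ, Fintype.card_fin]

lemma prob_avoid (hn : 0 < n) (s : Finset (Fin n)) (b : ℕ) :
    (∑ a : Fin b → Fin n, (1 / (n : ℝ)) ^ b * if ∀ j, a j ∉ s then (1 : ℝ) else 0)
      = (1 - s.card / (n : ℝ)) ^ b := by
  have hn' : (n : ℝ) ≠ 0 := by positivity
  rw [← Finset.mul_sum, card_avoid, ← mul_pow]; congr 1; field_simp

lemma norm_sq_unseen (v : Fin n → V) (a : Fin b → Fin n) (i : Fin n) :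
    ‖unseen v a i‖ ^ 2 = (if ∀ j, a j ∉ ({i} : Finset (Fin n)) then (1 : ℝ) else 0)
      * ‖v i‖ ^ 2 := by
  by_cases h : ∃ j, a j = i
  · have h' : ¬ ∀ j, a j ∉ ({i} : Finset (Fin n)) := by simpa using h
    simp only [unseen, if_pos h, if_neg h']; simp
  · have h' : ∀ j, a j ∉ ({i} : Finset (Fin n)) := by simpa using h
    simp only [unseen, if_neg h, if_pos h']; simp

lemma batch_msq_unseen (hn : 0 < n) (v : Fin n → V) :
    ∑ a : Fin b → Fin n, (1 / (n : ℝ)) ^ b * msq (unseen v a) = (1 - 1 / (n : ℝ)) ^ b * msq v := by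
  simp only [msq, norm_sq_unseen, Finset.mul_sum]
  rw [Finset.sum_comm]
  refine Finset.sum_congr rfl fun i _ => ?_
  have h := prob_avoid hn {i} b
  rw [Finset.card_singleton, Nat.cast_one] at h
  rw [← h, Finset.sum_mul]
  exact Finset.sum_congr rfl fun a _ => by ring

lemma inner_unseen (v : Fin n → V) (a : Fin b → Fin n) (i k : Fin n) :
    inner ℝ (unseen v a i) (unseen v a k)
      = (if ∀ j, a j ∉ ({i, k} : Finset (Fin n)) then (1 : ℝ) else 0) * inner ℝ (v i) (v k) := by
  by_cases h : ∃ j, a j = i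
  · have h' : ¬ ∀ j, a j ∉ ({i, k} : Finset (Fin n)) := by
      obtain ⟨j, hj⟩ := h; push Not; exact ⟨j, by simp [hj]⟩
    rw [if_neg h']; simp [unseen, if_pos h]
  by_cases hk : ∃ j, a j = k
  · have h' : ¬ ∀ j, a j ∉ ({i, k} : Finset (Fin n)) := by
      obtain ⟨j, hj⟩ := hk; push Not; exact ⟨j, by simp [hj]⟩
    rw [if_neg h']; simp [unseen, if_pos hk]
  have h' : ∀ j, a j ∉ ({i, k} : Finset (Fin n)) := by
    push Not at h hk; intro j; simp [h j, hk j]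
  rw [if_pos h', unseen, if_neg h, unseen, if_neg hk, one_mul]

/-- Expand the square over pairs of indices. A pair survives when the batch avoids both of its
members, which has probability (1 - 2/n)^b off the diagonal and (1 - 1/n)^b on it. -/
lemma batch_norm_mean_unseen_sq (hn : 0 < n) (v : Fin n → V) :
    ∑ a : Fin b → Fin n, (1 / (n : ℝ)) ^ b * ‖mean (unseen v a)‖ ^ 2
      = ((1 - 1 / (n : ℝ)) ^ b - (1 - 2 / (n : ℝ)) ^ b) / n * msq v
        + (1 - 2 / (n : ℝ)) ^ b * ‖mean v‖ ^ 2 := by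
  have hn' : (n : ℝ) ≠ 0 := by positivity
  have key : ∀ w : Fin n → V, ‖mean w‖ ^ 2
      = (1 / (n : ℝ)) ^ 2 * ∑ i, ∑ k, inner ℝ (w i) (w k) := fun w => by
    rw [mean, norm_smul, mul_pow, ← real_inner_self_eq_norm_sq (∑ i, w i), sum_inner]
    simp [inner_sum]
  have hP : ∀ i k : Fin n, (∑ a : Fin b → Fin n, (1 / (n : ℝ)) ^ b *
      inner ℝ (unseen v a i) (unseen v a k)) = (1 - 2 / (n : ℝ)) ^ b * inner ℝ (v i) (v k)
        + if i = k then ((1 - 1 / (n : ℝ)) ^ b - (1 - 2 / (n : ℝ)) ^ b) * ‖v i‖ ^ 2 else 0 := by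
    intro i k
    simp only [inner_unseen, ← mul_assoc, ← Finset.sum_mul]
    rw [prob_avoid hn]
    by_cases hik : i = k
    · subst hik; simp; ring
    · rw [Finset.card_pair hik, if_neg hik]; simp
  calc _ = (1 / (n : ℝ)) ^ 2 * ∑ i, ∑ k, ∑ a : Fin b → Fin n, (1 / (n : ℝ)) ^ b *
      inner ℝ (unseen v a i) (unseen v a k) := by
        simp only [key, Finset.mul_sum]
        rw [Finset.sum_comm]
        refine Finset.sum_congr rfl fun i _ => ?_
        rw [Finset.sum_comm]
        refine Finset.sum_congr rfl fun k _ => Finset.sum_congr rfl fun a _ => by ring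
    _ = _ := by
        simp only [hP, Finset.sum_add_distrib, Finset.sum_ite_eq, Finset.mem_univ, if_true,
          ← Finset.mul_sum]
        rw [sum_norm_sq_eq hn, key v]; field_simp; ring

end FiniteFamilies

/-! ### Descent lemmas for functions that are smooth on average. -/

section Smoothness

variable {d n : ℕ} {f : Fin n → EuclideanSpace ℝ (Fin d) → ℝ}
  {r : EuclideanSpace ℝ (Fin d) → EReal} {L : ℝ}

/-- The family of the gradients at `x`. -/
def grads (f : Fin n → EuclideanSpace ℝ (Fin d) → ℝ) (x : EuclideanSpace ℝ (Fin d)) :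
    Fin n → EuclideanSpace ℝ (Fin d) := fun i => gradient (f i) x

lemma BasicAssumption.hasGradientAt (h : BasicAssumption f r L) (i : Fin n)
    (x : EuclideanSpace ℝ (Fin d)) : HasGradientAt (f i) (gradient (f i) x) x :=
  (((h.contDiff i).differentiable (by norm_num)) x).hasGradientAt

lemma BasicAssumption.hasGradientAt_avg (h : BasicAssumption f r L)
    (x : EuclideanSpace ℝ (Fin d)) : HasGradientAt (avg f) (mean (grads f x)) x := by
  have h1 : HasFDerivAt (fun y => ∑ i, f i y) (∑ i, InnerProductSpace.toDual ℝ _ (gradient (f i) x))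
      x := HasFDerivAt.fun_sum fun i _ => (h.hasGradientAt i x).hasFDerivAt
  have h2 := h1.const_mul (1 / (n : ℝ))
  rw [hasGradientAt_iff_hasFDerivAt]
  have e : InnerProductSpace.toDual ℝ (EuclideanSpace ℝ (Fin d)) (mean (grads f x))
      = (1 / (n : ℝ)) • ∑ i, InnerProductSpace.toDual ℝ _ (gradient (f i) x) := by
    simp only [mean, grads, map_smulₛₗ, map_sum]; rfl
  rw [e]; exact h2

lemma BasicAssumption.avgGrad_eq (h : BasicAssumption f r L) (x : EuclideanSpace ℝ (Fin d)) :
    avgGrad f x = mean (grads f x) := (h.hasGradientAt_avg x).gradient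

lemma BasicAssumption.msq_grads_sub_le (h : BasicAssumption f r L)
    (x y : EuclideanSpace ℝ (Fin d)) :
    msq (grads f x - grads f y) ≤ L ^ 2 * ‖x - y‖ ^ 2 := h.smooth x y

lemma BasicAssumption.norm_avgGrad_sub_le (hn : 0 < n) (h : BasicAssumption f r L)
    (x y : EuclideanSpace ℝ (Fin d)) : ‖avgGrad f x - avgGrad f y‖ ≤ L * ‖x - y‖ := by
  have h1 : ‖avgGrad f x - avgGrad f y‖ ^ 2 ≤ (L * ‖x - y‖) ^ 2 := by
    rw [h.avgGrad_eq, h.avgGrad_eq, ← mean_sub, mul_pow]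
    exact (norm_mean_sq_le hn _).trans (h.msq_grads_sub_le x y)
  exact (sq_le_sq₀ (norm_nonneg _) (mul_nonneg h.pos.le (norm_nonneg _))).1 h1

lemma BasicAssumption.continuous_avgGrad (hn : 0 < n) (h : BasicAssumption f r L) :
    Continuous (avgGrad f) := by
  have : LipschitzWith (Real.toNNReal L) (avgGrad f) := by
    refine LipschitzWith.of_dist_le_mul fun x y => ?_
    rw [dist_eq_norm, dist_eq_norm, Real.coe_toNNReal _ h.pos.le]
    exact h.norm_avgGrad_sub_le hn x y
  exact this.continuous

lemma BasicAssumption.continuous_avg (h : BasicAssumption f r L) : Continuous (avg f) :=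
  continuous_iff_continuousAt.2 fun x => (h.hasGradientAt_avg x).differentiableAt.continuousAt

/-- The descent lemma. -/
lemma BasicAssumption.descent (hn : 0 < n) (h : BasicAssumption f r L)
    (x v : EuclideanSpace ℝ (Fin d)) :
    avg f (x + v) ≤ avg f x + inner ℝ (avgGrad f x) v + L / 2 * ‖v‖ ^ 2 := by
  set g : ℝ → ℝ := fun t => avg f (x + t • v) - t * inner ℝ (avgGrad f x) v
    - L / 2 * t ^ 2 * ‖v‖ ^ 2 with hg
  have hd : ∀ t, HasDerivAt g (inner ℝ (avgGrad f (x + t • v)) v - inner ℝ (avgGrad f x) v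
      - L * t * ‖v‖ ^ 2) t := fun t => by
    have h1 : HasDerivAt (fun t : ℝ => x + t • v) v t := by
      simpa using ((hasDerivAt_id t).smul_const v).const_add x
    have h2 : HasDerivAt (fun t : ℝ => avg f (x + t • v)) (inner ℝ (avgGrad f (x + t • v)) v)
        t := by
      have := (h.hasGradientAt_avg (x + t • v)).hasFDerivAt.comp_hasDerivAt t h1
      rw [h.avgGrad_eq]
      simp only [InnerProductSpace.toDual_apply_apply] at this
      exact this
    have h3 : HasDerivAt (fun t : ℝ => t * inner ℝ (avgGrad f x) v) (inner ℝ (avgGrad f x) v)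
        t := by
      simpa using (hasDerivAt_id t).mul_const (inner ℝ (avgGrad f x) v)
    have h4 : HasDerivAt (fun t : ℝ => L / 2 * t ^ 2 * ‖v‖ ^ 2) (L * t * ‖v‖ ^ 2) t := by
      have := ((hasDerivAt_pow 2 t).const_mul (L / 2)).mul_const (‖v‖ ^ 2)
      have e : L / 2 * ((2 : ℕ) * t ^ (2 - 1)) * ‖v‖ ^ 2 = L * t * ‖v‖ ^ 2 := by
        push_cast; ring
      rw [e] at this; exact this
    exact (h2.sub h3).sub h4
  have hanti : AntitoneOn g (Set.Icc 0 1) := by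
    refine antitoneOn_of_deriv_nonpos (convex_Icc 0 1)
      (fun t _ => (hd t).continuousAt.continuousWithinAt)
      (fun t _ => (hd t).differentiableAt.differentiableWithinAt) fun t ht => ?_
    rw [interior_Icc] at ht
    rw [(hd t).deriv, ← inner_sub_left]
    have h1 := real_inner_le_norm (avgGrad f (x + t • v) - avgGrad f x) v
    have h2 := h.norm_avgGrad_sub_le hn (x + t • v) x
    rw [add_sub_cancel_left, norm_smul, Real.norm_of_nonneg ht.1.le] at h2
    nlinarith [norm_nonneg v]
  have h01 := hanti (Set.left_mem_Icc.2 zero_le_one) (Set.right_mem_Icc.2 zero_le_one) zero_le_one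
  simp only [hg, one_smul, zero_smul, add_zero] at h01
  nlinarith

lemma sum_range_sum_range (q : ℕ → ℝ) (N : ℕ) :
    ∑ j ∈ Finset.range N, ∑ i ∈ Finset.range j, q i
      = ∑ i ∈ Finset.range N, ((N : ℝ) - 1 - i) * q i := by
  induction N with
  | zero => simp
  | succ N ih =>
    rw [Finset.sum_range_succ, ih, Finset.sum_range_succ, ← Finset.sum_add_distrib]
    push_cast
    simp only [add_sub_cancel_right, sub_self, zero_mul, add_zero]
    exact Finset.sum_congr rfl fun i _ => by ring

lemma sum_range_sq_le (N : ℕ) :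
    ∑ i ∈ Finset.range N, ((N : ℝ) - 1 - i) ^ 2 ≤ (N : ℝ) ^ 3 / 3 := by
  rw [← Finset.sum_range_reflect]
  have : ∀ i ∈ Finset.range N, ((N : ℝ) - 1 - ((N - 1 - i : ℕ) : ℝ)) ^ 2 = (i : ℝ) ^ 2 := by
    intro i hi
    have h1 := Finset.mem_range.1 hi
    rw [Nat.cast_sub (by omega), Nat.cast_sub (by omega)]
    push_cast; ring
  rw [Finset.sum_congr rfl this]
  clear this
  induction N with
  | zero => simp
  | succ N ih =>
    rw [Finset.sum_range_succ]; push_cast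
    have : (0 : ℝ) ≤ N := by positivity
    nlinarith

/-- A descent lemma which takes into account how much the individual gradients spread. -/
lemma BasicAssumption.descent_spread (hn : 0 < n) (h : BasicAssumption f r L) {c : ℝ} (hc : 0 < c)
    (x v : EuclideanSpace ℝ (Fin d)) :
    avg f (x + v) ≤ avg f x + inner ℝ (avgGrad f x) v + L * (c / 6) * ‖v‖ ^ 2
      + (L ^ 2 * ‖v‖ ^ 2 - spread (grads f (x + v) - grads f x)) / (2 * c * L) := by
  have hL := h.pos
  -- Cut the segment into N equal pieces and apply the plain descent lemma on each; its total error
  -- L/2 ‖v‖²/N vanishes as N → ∞. The gain comes from ‖mean D‖² = msq D - spread D for the gradient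
  -- increments D of the pieces.
  have key : ∀ N : ℕ, avg f (x + v) ≤ avg f x + inner ℝ (avgGrad f x) v + L * (c / 6) * ‖v‖ ^ 2
      + (L ^ 2 * ‖v‖ ^ 2 - spread (grads f (x + v) - grads f x)) / (2 * c * L)
      + (L / 2 * ‖v‖ ^ 2) * (1 / ((N : ℝ) + 1)) := by
    intro N'
    set N := N' + 1 with hN
    have hN0 : (0 : ℝ) < N := by positivity
    have hcast : (N' : ℝ) + 1 = N := by rw [hN]; push_cast; rfl
    rw [hcast]
    set y : ℕ → EuclideanSpace ℝ (Fin d) := fun j => x + ((j : ℝ) / N) • v with hy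
    have hstep : ∀ j, y (j + 1) = y j + (1 / (N : ℝ)) • v := fun j => by
      simp only [hy, add_assoc, ← add_smul]; congr 2; push_cast; field_simp
    have hy0 : y 0 = x := by simp [hy]
    have hyN : y N = x + v := by simp [hy]
    set D : ℕ → Fin n → EuclideanSpace ℝ (Fin d) := fun j => grads f (y (j + 1)) - grads f (y j)
    have hDsum : ∀ j, ∑ i ∈ Finset.range j, D i = grads f (y j) - grads f x := fun j => by
      rw [← hy0]; exact Finset.sum_range_sub (fun j => grads f (y j)) j
    have hnv : ‖(1 / (N : ℝ)) • v‖ ^ 2 = ‖v‖ ^ 2 / N ^ 2 := by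
      rw [norm_smul, mul_pow, Real.norm_of_nonneg (by positivity)]; field_simp
    have hDmsq : ∀ j, msq (D j) ≤ L ^ 2 * (‖v‖ ^ 2 / N ^ 2) := fun j => by
      have := h.msq_grads_sub_le (y (j + 1)) (y j)
      rwa [hstep j, add_sub_cancel_left, hnv, ← hstep j] at this
    set q : ℕ → ℝ := fun i => inner ℝ (mean (D i)) v
    have hgrad : ∀ j, inner ℝ (avgGrad f (y j)) v
        = inner ℝ (avgGrad f x) v + ∑ i ∈ Finset.range j, q i := fun j => by
      have : ∑ i ∈ Finset.range j, mean (D i) = avgGrad f (y j) - avgGrad f x := by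
        rw [h.avgGrad_eq, h.avgGrad_eq, ← mean_sub, ← hDsum j]
        simp only [mean, Finset.sum_apply, ← Finset.smul_sum]; rw [Finset.sum_comm]
      simp only [q]; rw [← sum_inner, this, inner_sub_left]; ring
    have hdesc : ∀ j, avg f (y (j + 1)) - avg f (y j) ≤ (1 / (N : ℝ)) *
        (inner ℝ (avgGrad f x) v + ∑ i ∈ Finset.range j, q i) + L / 2 * (‖v‖ ^ 2 / N ^ 2) :=
      fun j => by
      have := h.descent hn (y j) ((1 / (N : ℝ)) • v)
      rw [← hstep j, hnv, inner_smul_right, hgrad] at this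
      linarith
    have htot : avg f (x + v) - avg f x ≤ inner ℝ (avgGrad f x) v
        + (1 / (N : ℝ)) * ∑ i ∈ Finset.range N, ((N : ℝ) - 1 - i) * q i
        + L / 2 * ‖v‖ ^ 2 * (1 / N) := by
      have h1 : ∑ j ∈ Finset.range N, (avg f (y (j + 1)) - avg f (y j))
          = avg f (x + v) - avg f x := by
        rw [Finset.sum_range_sub (fun j => avg f (y j)), hy0, hyN]
      rw [← h1]
      refine (Finset.sum_le_sum fun j _ => hdesc j).trans (le_of_eq ?_)
      rw [Finset.sum_add_distrib, ← Finset.mul_sum, Finset.sum_add_distrib, sum_range_sum_range]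
      simp only [Finset.sum_const, Finset.card_range, nsmul_eq_mul]
      field_simp
    -- Young's inequality with weight c. The squares (N - 1 - i)² add up to at most N³/3, which
    -- produces the coefficient c/6, and `spread_sum_le` reassembles the spreads of the pieces.
    have hq : ∀ i, (1 / (N : ℝ)) * (((N : ℝ) - 1 - i) * q i)
        ≤ c * L * ‖v‖ ^ 2 / (2 * N ^ 3) * ((N : ℝ) - 1 - i) ^ 2
          + N / (2 * c * L) * (L ^ 2 * (‖v‖ ^ 2 / N ^ 2) - spread (D i)) := fun i => by
      have h1 : |q i| ≤ ‖mean (D i)‖ * ‖v‖ := abs_real_inner_le_norm _ _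
      have h2 : ‖mean (D i)‖ ^ 2 ≤ L ^ 2 * (‖v‖ ^ 2 / N ^ 2) - spread (D i) := by
        have := msq_eq_spread_add hn (D i); linarith [hDmsq i]
      have h3 : (1 / (N : ℝ)) * (((N : ℝ) - 1 - i) * q i)
          ≤ (|(N : ℝ) - 1 - i| / N * ‖v‖) * ‖mean (D i)‖ := by
        calc _ ≤ |(1 / (N : ℝ)) * (((N : ℝ) - 1 - i) * q i)| := le_abs_self _
          _ = |(N : ℝ) - 1 - i| / N * |q i| := by
            rw [abs_mul, abs_mul, abs_of_pos (by positivity : 0 < 1 / (N : ℝ))]; ring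
          _ ≤ |(N : ℝ) - 1 - i| / N * (‖mean (D i)‖ * ‖v‖) := by gcongr
          _ = _ := by ring
      refine h3.trans (le_trans ?_ (add_le_add_right
        (mul_le_mul_of_nonneg_left h2 (by positivity : 0 ≤ N / (2 * c * L))) _))
      rw [← sq_abs ((N : ℝ) - 1 - i)]
      set z := |(N : ℝ) - 1 - i|
      have h5 : c * L * ‖v‖ ^ 2 / (2 * N ^ 3) * z ^ 2 + N / (2 * c * L) * ‖mean (D i)‖ ^ 2
          - z / N * ‖v‖ * ‖mean (D i)‖
          = N / (2 * c * L) * (c * L * ‖v‖ * z / N ^ 2 - ‖mean (D i)‖) ^ 2 := by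
        field_simp; ring
      have h6 : 0 ≤ N / (2 * c * L) * (c * L * ‖v‖ * z / N ^ 2 - ‖mean (D i)‖) ^ 2 := by positivity
      linarith
    have hqs : (1 / (N : ℝ)) * ∑ i ∈ Finset.range N, ((N : ℝ) - 1 - i) * q i
        ≤ L * (c / 6) * ‖v‖ ^ 2
          + (L ^ 2 * ‖v‖ ^ 2 - spread (grads f (x + v) - grads f x)) / (2 * c * L) := by
      rw [Finset.mul_sum]
      refine (Finset.sum_le_sum fun i _ => hq i).trans ?_
      rw [Finset.sum_add_distrib, ← Finset.mul_sum, ← Finset.mul_sum, Finset.sum_sub_distrib,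
        Finset.sum_const, Finset.card_range, nsmul_eq_mul]
      have h1 := spread_sum_le N D
      rw [hDsum N, hyN] at h1
      have h2 : c * L * ‖v‖ ^ 2 / (2 * N ^ 3) * ∑ i ∈ Finset.range N, ((N : ℝ) - 1 - i) ^ 2
          ≤ c * L * ‖v‖ ^ 2 / (2 * N ^ 3) * ((N : ℝ) ^ 3 / 3) :=
        mul_le_mul_of_nonneg_left (sum_range_sq_le N) (by positivity)
      have h3 : c * L * ‖v‖ ^ 2 / (2 * N ^ 3) * ((N : ℝ) ^ 3 / 3) = L * (c / 6) * ‖v‖ ^ 2 := by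
        field_simp; ring
      have h4 : N / (2 * c * L) * (N * (L ^ 2 * (‖v‖ ^ 2 / N ^ 2))
          - ∑ i ∈ Finset.range N, spread (D i))
          = (L ^ 2 * ‖v‖ ^ 2 - N * ∑ i ∈ Finset.range N, spread (D i)) / (2 * c * L) := by
        field_simp
      rw [h4]
      have h5 : (L ^ 2 * ‖v‖ ^ 2 - N * ∑ i ∈ Finset.range N, spread (D i)) / (2 * c * L)
          ≤ (L ^ 2 * ‖v‖ ^ 2 - spread (grads f (x + v) - grads f x)) / (2 * c * L) := by
        gcongr
      linarith
    linarith
  have hlim : Tendsto (fun N : ℕ => avg f x + inner ℝ (avgGrad f x) v + L * (c / 6) * ‖v‖ ^ 2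
      + (L ^ 2 * ‖v‖ ^ 2 - spread (grads f (x + v) - grads f x)) / (2 * c * L)
      + (L / 2 * ‖v‖ ^ 2) * (1 / ((N : ℝ) + 1))) atTop
      (𝓝 (avg f x + inner ℝ (avgGrad f x) v + L * (c / 6) * ‖v‖ ^ 2
      + (L ^ 2 * ‖v‖ ^ 2 - spread (grads f (x + v) - grads f x)) / (2 * c * L)
      + (L / 2 * ‖v‖ ^ 2) * 0)) :=
    (tendsto_one_div_add_atTop_nhds_zero_nat.const_mul _).const_add _
  rw [mul_zero, add_zero] at hlim
  exact ge_of_tendsto' hlim key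

end Smoothness

/-! ### Strong convexity and monotonicity of the proximal subproblem. -/

section Argmin

variable {V : Type*} [NormedAddCommGroup V] [InnerProductSpace ℝ V]

/-- The objective of the subproblem solved in each step. -/
def proxObj (μ : ℝ) (x g : V) (φ : V → EReal) (z : V) : EReal :=
  ((μ / 2 * ‖z - x‖ ^ 2 + inner ℝ g z : ℝ) : EReal) + φ z

lemma IsArgmin.ne_top {μ : ℝ} {x g p : V} {φ : V → EReal} (hp : IsArgmin (proxObj μ x g φ) p) :
    φ p ≠ ⊤ := fun h => hp.1 (by rw [proxObj, h]; exact EReal.coe_add_top _)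

lemma proxObj_eq_coe {μ : ℝ} {x g z : V} {φ : V → EReal} (hb : φ z ≠ ⊥) (ht : φ z ≠ ⊤) :
    proxObj μ x g φ z
      = ((μ / 2 * ‖z - x‖ ^ 2 + inner ℝ g z + (φ z).toReal : ℝ) : EReal) := by
  rw [proxObj, EReal.coe_add _ (φ z).toReal, EReal.coe_toReal ht hb]

lemma norm_sq_segment (p z x : V) (t : ℝ) :
    ‖(1 - t) • p + t • z - x‖ ^ 2
      = (1 - t) * ‖p - x‖ ^ 2 + t * ‖z - x‖ ^ 2 - t * (1 - t) * ‖z - p‖ ^ 2 := by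
  have e1 : (1 - t) • p + t • z - x = (p - x) + t • (z - p) := by
    rw [sub_smul, smul_sub, one_smul]; abel
  have e2 : z - x = (p - x) + (z - p) := by abel
  rw [e1, e2, norm_add_sq_real, norm_add_sq_real, norm_smul, inner_smul_right, mul_pow,
    Real.norm_eq_abs, sq_abs]
  ring

/-- The quadratic growth of a strongly convex function at its minimizer. -/
lemma IsArgmin.quadratic_growth {μ : ℝ} {x g p : V} {φ : V → EReal} (hμ : 0 ≤ μ)
    (hφ : IsConvexFun φ) (hbot : ∀ z, φ z ≠ ⊥) (hp : IsArgmin (proxObj μ x g φ) p)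
    {z : V} (hz : φ z ≠ ⊤) :
    μ / 2 * ‖p - x‖ ^ 2 + inner ℝ g p + (φ p).toReal + μ / 2 * ‖z - p‖ ^ 2
      ≤ μ / 2 * ‖z - x‖ ^ 2 + inner ℝ g z + (φ z).toReal := by
  have hpt := hp.ne_top
  -- Compare `p` with (1 - t)p + tz and divide by t; the curvature of the square leaves the factor 1
  -- - t, which tends to 1 as t → 0.
  have key : ∀ t : ℝ, 0 < t → t < 1 →
      μ / 2 * ‖p - x‖ ^ 2 + inner ℝ g p + (φ p).toReal + μ / 2 * (1 - t) * ‖z - p‖ ^ 2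
      ≤ μ / 2 * ‖z - x‖ ^ 2 + inner ℝ g z + (φ z).toReal := by
    intro t ht0 ht1
    have hc := hφ p z (1 - t) t (by linarith) ht0 (by ring)
    rw [← EReal.coe_toReal hpt (hbot p), ← EReal.coe_toReal hz (hbot z), ← EReal.coe_mul,
      ← EReal.coe_mul, ← EReal.coe_add] at hc
    have hct : φ ((1 - t) • p + t • z) ≠ ⊤ := ne_top_of_le_ne_top (EReal.coe_ne_top _) hc
    rw [← EReal.coe_toReal hct (hbot _), EReal.coe_le_coe_iff] at hc
    have hm := hp.2 ((1 - t) • p + t • z)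
    rw [proxObj_eq_coe (hbot _) hpt, proxObj_eq_coe (hbot _) hct, EReal.coe_le_coe_iff,
      norm_sq_segment, inner_add_right, inner_smul_right, inner_smul_right] at hm
    have : 0 ≤ t * ((μ / 2 * ‖z - x‖ ^ 2 + inner ℝ g z + (φ z).toReal) - (μ / 2 * ‖p - x‖ ^ 2
        + inner ℝ g p + (φ p).toReal + μ / 2 * (1 - t) * ‖z - p‖ ^ 2)) := by nlinarith
    linarith [nonneg_of_mul_nonneg_right this ht0]
  refine le_of_forall_pos_le_add fun ε hε => ?_
  set c := μ / 2 * ‖z - p‖ ^ 2 with hc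
  have hc0 : 0 ≤ c := by positivity
  have ht : 0 < min (1 / 2) (ε / (c + 1)) := by positivity
  have h := key _ ht (lt_of_le_of_lt (min_le_left _ _) (by norm_num))
  have h2 : min (1 / 2) (ε / (c + 1)) * c ≤ ε := by
    calc _ ≤ ε / (c + 1) * c := by gcongr; exact min_le_right _ _
      _ = ε * (c / (c + 1)) := by ring
      _ ≤ ε * 1 := by
        gcongr
        rw [div_le_one (by positivity)]; linarith
      _ = ε := mul_one _
  have h3 : μ / 2 * (1 - min (1 / 2) (ε / (c + 1))) * ‖z - p‖ ^ 2
      = c - min (1 / 2) (ε / (c + 1)) * c := by rw [hc]; ring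
  linarith

/-- Add the quadratic growth at `p` tested with `p'` to the one at `p'` tested with `p`; the values
of φ cancel. -/
lemma IsArgmin.monotone {μ : ℝ} {x g g' p p' : V} {φ : V → EReal} (hμ : 0 ≤ μ)
    (hφ : IsConvexFun φ) (hbot : ∀ z, φ z ≠ ⊥) (hp : IsArgmin (proxObj μ x g φ) p)
    (hp' : IsArgmin (proxObj μ x g' φ) p') :
    μ * ‖p - p'‖ ^ 2 ≤ - inner ℝ (g - g') (p - p') := by
  have h1 := hp.quadratic_growth hμ hφ hbot hp'.ne_top
  have h2 := hp'.quadratic_growth hμ hφ hbot hp.ne_top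
  rw [norm_sub_rev p' p] at h1
  rw [inner_sub_left, inner_sub_right, inner_sub_right]
  linarith

lemma IsArgmin.unique {μ : ℝ} {x g p p' : V} {φ : V → EReal} (hμ : 0 < μ)
    (hφ : IsConvexFun φ) (hbot : ∀ z, φ z ≠ ⊥) (hp : IsArgmin (proxObj μ x g φ) p)
    (hp' : IsArgmin (proxObj μ x g φ) p') : p = p' := by
  have h := hp.monotone hμ.le hφ hbot hp'
  rw [sub_self, inner_zero_left, neg_zero] at h
  have h2 : ‖p - p'‖ ^ 2 = 0 := le_antisymm (nonpos_of_mul_nonpos_right h hμ) (sq_nonneg _)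
  rw [sq_eq_zero_iff, norm_eq_zero] at h2
  exact sub_eq_zero.1 h2

/-- The noise in the linear term helps the objective only up to the order of its variance. -/
lemma IsArgmin.neg_inner_le {μ : ℝ} {x g g' p p' : V} {φ : V → EReal} (hμ : 0 < μ)
    (hφ : IsConvexFun φ) (hbot : ∀ z, φ z ≠ ⊥) (hp : IsArgmin (proxObj μ x g φ) p)
    (hp' : IsArgmin (proxObj μ x g' φ) p') :
    - inner ℝ (g - g') (p - p') ≤ ‖g - g'‖ ^ 2 / μ := by
  have h := hp.monotone hμ.le hφ hbot hp'
  have h1 : - inner ℝ (g - g') (p - p') ≤ ‖g - g'‖ * ‖p - p'‖ :=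
    (neg_le_abs _).trans (abs_real_inner_le_norm _ _)
  rw [le_div_iff₀ hμ]
  by_contra hcon
  push Not at hcon
  nlinarith [norm_nonneg (g - g'), norm_nonneg (p - p'), sq_nonneg (‖g - g'‖ - μ * ‖p - p'‖)]

end Argmin

/-! ### Decrease of the objective in one step. -/

section Step

variable {d n : ℕ} {f : Fin n → EuclideanSpace ℝ (Fin d) → ℝ}
  {r : EuclideanSpace ℝ (Fin d) → EReal}
  {u : EuclideanSpace ℝ (Fin d) → EuclideanSpace ℝ (Fin d) → EReal} {L μ : ℝ}

/-- The real value of the objective, meaningful on its domain. -/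
def objReal (f : Fin n → EuclideanSpace ℝ (Fin d) → ℝ) (r : EuclideanSpace ℝ (Fin d) → EReal)
    (x : EuclideanSpace ℝ (Fin d)) : ℝ := avg f x + (r x).toReal

lemma IsSurrogate.ne_top (hs : IsSurrogate r u) {μ : ℝ} {x g p : EuclideanSpace ℝ (Fin d)}
    (hp : IsArgmin (proxObj μ x g (fun z => u z x)) p) : r p ≠ ⊤ :=
  ne_top_of_le_ne_top hp.ne_top (hs.le p x)

lemma objective_eq_coe (hb : BasicAssumption f r L) {x : EuclideanSpace ℝ (Fin d)} (hx : r x ≠ ⊤) :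
    objective f r x = (objReal f r x : EReal) := by
  rw [objective, objReal, EReal.coe_add, EReal.coe_toReal hx (hb.ne_bot x)]

lemma BasicAssumption.exists_le_objReal (hb : BasicAssumption f r L) :
    ∃ c : ℝ, ∀ x, r x ≠ ⊤ → c ≤ objReal f r x := by
  obtain ⟨c, hc⟩ := hb.bddBelow
  refine ⟨c, fun x hx => ?_⟩
  have := hc x
  rwa [objective_eq_coe hb hx, EReal.coe_le_coe_iff] at this

/-- One step decreases `r`, up to the linear term. -/
lemma prox_step (hb : BasicAssumption f r L) (hs : IsSurrogate r u)
    (hu : SurrogateAssumption r u) (hμ : 0 ≤ μ) {x g p : EuclideanSpace ℝ (Fin d)} (hx : r x ≠ ⊤)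
    (hp : IsArgmin (proxObj μ x g (fun z => u z x)) p) :
    (r p).toReal + μ * ‖p - x‖ ^ 2 + inner ℝ g (p - x) ≤ (r x).toReal := by
  have h := hp.quadratic_growth hμ (hu.convex_left x) (fun z => hs.ne_bot z x) (z := x)
    (by simpa [hs.diag] using hx)
  have h2 : (r p).toReal ≤ (u p x).toReal :=
    EReal.toReal_le_toReal (hs.le p x) (hb.ne_bot p) hp.ne_top
  rw [hs.diag, sub_self, norm_zero, norm_sub_rev x p] at h
  rw [inner_sub_right]
  linarith

/-- The basic descent inequality. -/
lemma objReal_step (hn : 0 < n) (hb : BasicAssumption f r L) (hs : IsSurrogate r u)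
    (hu : SurrogateAssumption r u) (hμ : 0 ≤ μ) {x g p : EuclideanSpace ℝ (Fin d)} (hx : r x ≠ ⊤)
    (hp : IsArgmin (proxObj μ x g (fun z => u z x)) p) :
    objReal f r p + (μ - L / 2) * ‖p - x‖ ^ 2 + inner ℝ (g - avgGrad f x) (p - x)
      ≤ objReal f r x := by
  have h1 := prox_step hb hs hu hμ hx hp
  have h2 := hb.descent hn x (p - x)
  rw [add_sub_cancel] at h2
  rw [objReal, objReal, inner_sub_left]
  linarith

/-- Young's inequality spends half of the quadratic term, so that the error enters only through its
square. -/
lemma objReal_step_sq (hn : 0 < n) (hb : BasicAssumption f r L) (hs : IsSurrogate r u)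
    (hu : SurrogateAssumption r u) (hμ : L / 2 < μ) {x g p : EuclideanSpace ℝ (Fin d)}
    (hx : r x ≠ ⊤) (hp : IsArgmin (proxObj μ x g (fun z => u z x)) p) :
    objReal f r p + (μ - L / 2) / 2 * ‖p - x‖ ^ 2
      ≤ objReal f r x + ‖g - avgGrad f x‖ ^ 2 / (2 * (μ - L / 2)) := by
  have hL := hb.pos
  have h1 := objReal_step hn hb hs hu (by linarith) hx hp
  have h2 : - inner ℝ (g - avgGrad f x) (p - x) ≤ ‖g - avgGrad f x‖ * ‖p - x‖ :=
    (neg_le_abs _).trans (abs_real_inner_le_norm _ _)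
  set s := μ - L / 2
  have hs0 : 0 < s := by simp only [s]; linarith
  have h3 : ‖g - avgGrad f x‖ ^ 2 / (2 * s) + s / 2 * ‖p - x‖ ^ 2
      - ‖g - avgGrad f x‖ * ‖p - x‖ = (‖g - avgGrad f x‖ - s * ‖p - x‖) ^ 2 / (2 * s) := by
    field_simp; ring
  have h4 : 0 ≤ (‖g - avgGrad f x‖ - s * ‖p - x‖) ^ 2 / (2 * s) := by positivity
  linarith

end Step

/-! ### Processes driven by finitely valued independent draws. -/

section Draws

variable {Ω A : Type*} [MeasurableSpace Ω] {P : Measure Ω} [IsProbabilityMeasure P] [Fintype A]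
  [MeasurableSpace A] [MeasurableSingletonClass A] {wt : A → ℝ} {ξ : ℕ → Ω → A}

/-- The draws `ξ 0, ξ 1, …` are independent with the common law `wt`. -/
structure IsDraws (P : Measure Ω) (wt : A → ℝ) (ξ : ℕ → Ω → A) : Prop where
  measurable : ∀ k, Measurable (ξ k)
  indep : iIndepFun ξ P
  law : ∀ k a, P.real {ω | ξ k ω = a} = wt a

/-- `G` depends only on the first `k` draws. -/
def DependsOnDraws {B : Type*} (ξ : ℕ → Ω → A) (k : ℕ) (G : Ω → B) : Prop :=
  ∀ ω ω', (∀ j < k, ξ j ω = ξ j ω') → G ω = G ω'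

lemma DependsOnDraws.mono {B : Type*} {k l : ℕ} {G : Ω → B} (h : DependsOnDraws ξ k G)
    (hkl : k ≤ l) : DependsOnDraws ξ l G :=
  fun ω ω' hω => h ω ω' fun j hj => hω j (hj.trans_le hkl)

lemma DependsOnDraws.comp {B C : Type*} {k : ℕ} {G : Ω → B} (h : DependsOnDraws ξ k G)
    (φ : B → C) : DependsOnDraws ξ k (fun ω => φ (G ω)) :=
  fun ω ω' hω => congrArg φ (h ω ω' hω)

lemma DependsOnDraws.comp₂ {B C D : Type*} {k : ℕ} {G : Ω → B} {H : Ω → C}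
    (hG : DependsOnDraws ξ k G) (hH : DependsOnDraws ξ k H) (φ : B → C → D) :
    DependsOnDraws ξ k (fun ω => φ (G ω) (H ω)) :=
  fun ω ω' hω => congrArg₂ φ (hG ω ω' hω) (hH ω ω' hω)

/-- The first `k` draws. -/
def hist (ξ : ℕ → Ω → A) (k : ℕ) (ω : Ω) : ↥(Finset.range k) → A := fun j => ξ j ω

lemma hist_eq_iff {k : ℕ} {ω ω' : Ω} :
    hist ξ k ω = hist ξ k ω' ↔ ∀ j < k, ξ j ω = ξ j ω' := by
  constructor
  · intro h j hj
    exact congrFun h ⟨j, Finset.mem_range.2 hj⟩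
  · intro h; funext j; exact h j (Finset.mem_range.1 j.2)

lemma measurable_hist (hξ : IsDraws P wt ξ) (k : ℕ) : Measurable (hist ξ k) :=
  measurable_pi_lambda _ fun j => hξ.measurable j

lemma DependsOnDraws.exists_factor {k : ℕ} {G : Ω → ℝ} (h : DependsOnDraws ξ k G) :
    ∃ φ : (↥(Finset.range k) → A) → ℝ, ∀ ω, G ω = φ (hist ξ k ω) := by
  have : Function.FactorsThrough G (hist ξ k) := fun ω ω' hω => h ω ω' (hist_eq_iff.1 hω)
  obtain ⟨φ, hφ⟩ := (Function.factorsThrough_iff G).1 this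
  exact ⟨φ, fun ω => congrFun hφ ω⟩

/-- A function of finitely many finitely valued draws takes finitely many values; no measurability
of the iterates has to be assumed. -/
lemma DependsOnDraws.integrable (hξ : IsDraws P wt ξ) {k : ℕ} {G : Ω → ℝ}
    (h : DependsOnDraws ξ k G) : Integrable G P := by
  obtain ⟨φ, hφ⟩ := h.exists_factor
  have : G = φ ∘ hist ξ k := funext hφ
  rw [this]
  have hm := measurable_hist hξ k
  have : IsFiniteMeasure (P.map (hist ξ k)) := inferInstance
  exact (Integrable.of_finite (μ := P.map (hist ξ k)) (f := φ)).comp_measurable hm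

lemma measureReal_hist_inter (hξ : IsDraws P wt ξ) (k : ℕ) (p : ↥(Finset.range k) → A) (a : A) :
    P.real {ω | hist ξ k ω = p ∧ ξ k ω = a} = P.real {ω | hist ξ k ω = p} * wt a := by
  have h1 := hξ.indep.indepFun_finset (Finset.range k) {k} (by simp) hξ.measurable
  have h2 : IndepFun (hist ξ k) (ξ k) P := by
    have := h1.comp (φ := id) (ψ := fun q : ↥({k} : Finset ℕ) → A => q ⟨k, by simp⟩) measurable_id
      Measurable.of_discrete
    exact this
  have h3 := h2.measure_inter_preimage_eq_mul {p} {a} (measurableSet_singleton p)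
    (measurableSet_singleton a)
  rw [← hξ.law k a, measureReal_def, measureReal_def, measureReal_def, ← ENNReal.toReal_mul]
  exact congrArg ENNReal.toReal h3

/-- An inequality between conditional expectations, integrated. -/
lemma integral_le_of_step (hξ : IsDraws P wt ξ) {k : ℕ} {Φ Ψ : Ω → ℝ}
    (hΦ : DependsOnDraws ξ k Φ) (hΨ : DependsOnDraws ξ (k + 1) Ψ)
    (h : ∀ ω (s : A → Ω), (∀ a, wt a ≠ 0 → (∀ j < k, ξ j (s a) = ξ j ω) ∧ ξ k (s a) = a) →
      ∑ a, wt a * Ψ (s a) ≤ Φ ω) : ∫ ω, Ψ ω ∂P ≤ ∫ ω, Φ ω ∂P := by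
  classical
  obtain ⟨φ, hφ⟩ := hΦ.exists_factor
  have hfac : Function.FactorsThrough Ψ (fun ω => (hist ξ k ω, ξ k ω)) := fun ω ω' hω => by
    simp only [Prod.mk.injEq] at hω
    refine hΨ ω ω' fun j hj => ?_
    rcases Nat.lt_succ_iff_lt_or_eq.1 hj with hj | rfl
    · exact hist_eq_iff.1 hω.1 j hj
    · exact hω.2
  obtain ⟨ψ, hψ⟩ := (Function.factorsThrough_iff Ψ).1 hfac
  have hm := measurable_hist hξ k
  have hm2 : Measurable (fun ω => (hist ξ k ω, ξ k ω)) := hm.prodMk (hξ.measurable k)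
  have e1 : ∫ ω, Φ ω ∂P = ∑ p, P.real {ω | hist ξ k ω = p} * φ p := by
    have : Φ = fun ω => φ (hist ξ k ω) := funext hφ
    rw [this, ← integral_map hm.aemeasurable (Measurable.of_discrete.aestronglyMeasurable),
      integral_fintype Integrable.of_finite]
    refine Finset.sum_congr rfl fun p _ => ?_
    rw [map_measureReal_apply hm (measurableSet_singleton p)]; rfl
  have e2 : ∫ ω, Ψ ω ∂P = ∑ p, P.real {ω | hist ξ k ω = p} * ∑ a, wt a * ψ (p, a) := by
    have : Ψ = fun ω => ψ (hist ξ k ω, ξ k ω) := hψ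
    rw [this, ← integral_map (φ := fun ω => (hist ξ k ω, ξ k ω)) hm2.aemeasurable
      (Measurable.of_discrete.aestronglyMeasurable), integral_fintype Integrable.of_finite,
      Fintype.sum_prod_type]
    refine Finset.sum_congr rfl fun p _ => ?_
    rw [Finset.mul_sum]
    refine Finset.sum_congr rfl fun a _ => ?_
    rw [map_measureReal_apply hm2 (measurableSet_singleton _), ← mul_assoc,
      ← measureReal_hist_inter hξ, smul_eq_mul]
    congr 2
    ext ω; simp
  rw [e1, e2]
  refine Finset.sum_le_sum fun p _ => ?_
  -- The hypothesis `h` speaks of sample points, so a history contributes only if it is realized.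
  -- When it has positive probability, independence gives positive probability to every continuation
  -- with nonzero weight, hence a point `s a` realizing it.
  by_cases hp : P.real {ω | hist ξ k ω = p} = 0
  · rw [hp]; simp
  refine mul_le_mul_of_nonneg_left ?_ measureReal_nonneg
  have hne : ∀ S : Set Ω, P.real S ≠ 0 → S.Nonempty := fun S hS => by
    rw [Set.nonempty_iff_ne_empty]; rintro rfl; simp at hS
  obtain ⟨ω, hω⟩ := hne _ hp
  have hex : ∀ a, ∃ ω', wt a ≠ 0 → hist ξ k ω' = p ∧ ξ k ω' = a := fun a => by
    by_cases ha : wt a = 0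
    · exact ⟨ω, fun h => absurd ha h⟩
    · have := measureReal_hist_inter hξ k p a
      obtain ⟨ω', hω'⟩ := hne _ (this ▸ mul_ne_zero hp ha)
      exact ⟨ω', fun _ => hω'⟩
  choose s hs using hex
  have hω' : hist ξ k ω = p := hω
  have := h ω s fun a ha => ⟨hist_eq_iff.1 ((hs a ha).1.trans hω'.symm), (hs a ha).2⟩
  rw [hφ, hω'] at this
  refine le_trans (le_of_eq (Finset.sum_congr rfl fun a _ => ?_)) this
  by_cases ha : wt a = 0
  · rw [ha]; simp
  · rw [hψ, Function.comp_apply, (hs a ha).1, (hs a ha).2]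

end Draws

/-- Tonelli: the sum has a finite integral, hence is finite almost everywhere. -/
lemma ae_summable_of_summable_integral {Ω : Type*} [MeasurableSpace Ω] {P : Measure Ω}
    {G : ℕ → Ω → ℝ} (hm : ∀ k, Integrable (G k) P) (h0 : ∀ k ω, 0 ≤ G k ω)
    (hs : Summable fun k => ∫ ω, G k ω ∂P) : ∀ᵐ ω ∂P, Summable fun k => G k ω := by
  have h1 : ∫⁻ ω, ∑' k, ENNReal.ofReal (G k ω) ∂P ≠ ⊤ := by
    rw [lintegral_tsum fun k => (hm k).aestronglyMeasurable.aemeasurable.ennreal_ofReal]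
    have : ∀ k, ∫⁻ ω, ENNReal.ofReal (G k ω) ∂P = ENNReal.ofReal (∫ ω, G k ω ∂P) := fun k =>
      (ofReal_integral_eq_lintegral_ofReal (hm k) (ae_of_all _ (h0 k))).symm
    simp only [this]
    exact hs.tsum_ofReal_ne_top
  have h2 := ae_lt_top' (AEMeasurable.tsum fun k =>
    (hm k).aestronglyMeasurable.aemeasurable.ennreal_ofReal) h1
  filter_upwards [h2] with ω hω
  have := ENNReal.summable_toReal hω.ne
  simpa [ENNReal.toReal_ofReal (h0 _ ω)] using this

/-! ### Summability from Lyapunov inequalities. -/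

section RealSequences

/-- Telescoping. It starts at index 1 because x^0 may lie outside dom r, whereas all later iterates
lie inside. -/
lemma summable_of_descent {F D : ℕ → ℝ} {c δ : ℝ} (hδ : 0 < δ) (hF : ∀ k, c ≤ F (k + 1))
    (hD : ∀ k, 0 ≤ D k) (h : ∀ k, F (k + 2) + δ * D (k + 1) ≤ F (k + 1)) : Summable D := by
  rw [← summable_nat_add_iff 1]
  refine summable_of_sum_range_le (c := (F 1 - c) / δ) (fun k => hD _) fun N => ?_
  have : ∀ N, δ * ∑ k ∈ Finset.range N, D (k + 1) ≤ F 1 - F (N + 1) := by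
    intro N
    induction N with
    | zero => simp
    | succ N ih => rw [Finset.sum_range_succ]; linarith [h N]
  rw [le_div_iff₀ hδ]
  linarith [this N, hF N]

lemma summable_of_contraction {y D : ℕ → ℝ} {ρ : ℝ} (hρ : 0 < ρ) (hy : ∀ k, 0 ≤ y k)
    (hD : Summable D) (hD0 : ∀ k, 0 ≤ D k) (h : ∀ k, y (k + 1) ≤ (1 - ρ) * y k + D k) :
    Summable y := by
  refine summable_of_sum_range_le (c := (y 0 + ∑' k, D k) / ρ) hy fun N => ?_
  have h1 : ∀ N, ρ * ∑ k ∈ Finset.range N, y k ≤ y 0 - y N + ∑ k ∈ Finset.range N, D k := by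
    intro N
    induction N with
    | zero => simp
    | succ N ih => rw [Finset.sum_range_succ, Finset.sum_range_succ]; linarith [h N]
  rw [le_div_iff₀ hρ]
  have h2 := hD.sum_le_tsum (Finset.range N) fun k _ => hD0 k
  linarith [h1 N, hy N]

/-- A sequence which decreases up to a summable error and is bounded below converges. -/
lemma exists_tendsto_of_almost_decreasing {F s : ℕ → ℝ} {c : ℝ} (hs : Summable s)
    (hF : ∀ k, c ≤ F k) (h : ∀ k, F (k + 1) ≤ F k + s k) : ∃ l, Tendsto F atTop (𝓝 l) := by
  set G : ℕ → ℝ := fun N => F N - ∑ k ∈ Finset.range N, s k with hG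
  have hanti : Antitone G := antitone_nat_of_succ_le fun N => by
    simp only [hG, Finset.sum_range_succ]; linarith [h N]
  have hsum := hs.hasSum.tendsto_sum_nat
  have hbdd : BddBelow (Set.range G) := by
    obtain ⟨B, hB⟩ := hsum.bddAbove_range
    refine ⟨c - B, ?_⟩
    rintro _ ⟨N, rfl⟩
    have := hB ⟨N, rfl⟩
    simp only [hG]; linarith [hF N]
  have hlim := (tendsto_atTop_ciInf hanti hbdd).add hsum
  exact ⟨_, hlim.congr fun N => by simp [hG]⟩

/-- The expected Lyapunov argument for variance-reduced estimators. -/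
lemma summable_of_variance_reduction {F D y ε : ℕ → ℝ} {c s ρ V V₁ V₂ : ℝ} (hs : 0 < s)
    (hρ : 0 < ρ) (hV : 0 ≤ V) (hV₁ : 0 ≤ V₁) (hV₂ : 0 ≤ V₂)
    (hF : ∀ k, c ≤ F (k + 1)) (hD : ∀ k, 0 ≤ D k) (hy : ∀ k, 0 ≤ y k) (hε : ∀ k, 0 ≤ ε k)
    (h1 : ∀ k, F (k + 2) + s / 2 * D (k + 1) ≤ F (k + 1) + ε (k + 1) / (2 * s))
    (h2 : ∀ k, ε (k + 1) ≤ y (k + 1) + V * D k)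
    (h3 : ∀ k, y (k + 2) ≤ (1 - ρ) * y (k + 1) + V₁ * D (k + 1) + V₂ * D k)
    (hcond : V + (V₁ + V₂) / ρ < s ^ 2) : Summable D ∧ Summable ε := by
  -- The Lyapunov sequence is F_k + c₁ y_k + c₂ D_{k-1}. The choice of `c₁` makes the loss ρ c₁ y
  -- absorb the error term y/(2s), and `c₂` absorbs the two delayed terms. What remains of s/2 · D
  -- is (s² - V - (V₁ + V₂)/ρ)/(2s), positive by `hcond`.
  set c₁ := 1 / (2 * s * ρ) with hc₁
  set c₂ := V / (2 * s) + c₁ * V₂ with hc₂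
  have hc₁0 : 0 < c₁ := by positivity
  have hc₂0 : 0 ≤ c₂ := by positivity
  have hδ : 0 < (s ^ 2 - V - (V₁ + V₂) / ρ) / (2 * s) := by
    apply div_pos _ (by positivity); linarith
  have hDs : Summable D := by
    refine summable_of_descent (F := fun k => F k + c₁ * y k + c₂ * D (k - 1)) (c := c) hδ
      (fun k => ?_) hD fun k => ?_
    · have := mul_nonneg hc₁0.le (hy (k + 1)); have := mul_nonneg hc₂0 (hD (k + 1 - 1))
      linarith [hF k]
    · have e1 : k + 2 - 1 = k + 1 := rfl
      have e2 : k + 1 - 1 = k := rfl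
      simp only [e1, e2]
      have a1 := h1 k
      have a2 : ε (k + 1) / (2 * s) ≤ (y (k + 1) + V * D k) / (2 * s) := by
        gcongr; exact h2 k
      have a3 := mul_le_mul_of_nonneg_left (h3 k) hc₁0.le
      have a4 : c₁ * ρ = 1 / (2 * s) := by rw [hc₁]; field_simp
      have a5 : (s ^ 2 - V - (V₁ + V₂) / ρ) / (2 * s)
          = s / 2 - V / (2 * s) - c₁ * V₁ - c₁ * V₂ := by
        rw [hc₁]; field_simp; ring
      have a6 : (y (k + 1) + V * D k) / (2 * s) = c₁ * ρ * y (k + 1) + V / (2 * s) * D k := by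
        rw [a4]; field_simp
      rw [a5, hc₂]
      nlinarith
  refine ⟨hDs, ?_⟩
  have hys : Summable fun k => y (k + 1) := by
    refine summable_of_contraction (D := fun k => V₁ * D (k + 1) + V₂ * D k) hρ (fun k => hy _)
      ((((summable_nat_add_iff 1).2 hDs).mul_left V₁).add (hDs.mul_left V₂)) (fun k => ?_)
      fun k => ?_
    · have := hD (k + 1); have := hD k; positivity
    · linarith [h3 k]
  rw [← summable_nat_add_iff 1]
  exact Summable.of_nonneg_of_le (fun k => hε _) h2 (hys.add (hDs.mul_left V))

end RealSequences

/-! ### Convergence of a single trajectory with summable steps and errors. -/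

section Pathwise

variable {d n : ℕ} {f : Fin n → EuclideanSpace ℝ (Fin d) → ℝ}
  {r : EuclideanSpace ℝ (Fin d) → EReal}
  {u : EuclideanSpace ℝ (Fin d) → EuclideanSpace ℝ (Fin d) → EReal} {L μ : ℝ}
  {x g : ℕ → EuclideanSpace ℝ (Fin d)}

lemma exists_tendsto_objReal (hn : 0 < n) (hb : BasicAssumption f r L) (hs : IsSurrogate r u)
    (hu : SurrogateAssumption r u) (hμ : L / 2 < μ)
    (hx : ∀ k, IsArgmin (proxObj μ (x k) (g k) (fun z => u z (x k))) (x (k + 1)))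
    (he : Summable fun k => ‖g k - avgGrad f (x k)‖ ^ 2) :
    ∃ l : ℝ, Tendsto (fun k => objReal f r (x k)) atTop (𝓝 l) := by
  obtain ⟨c, hc⟩ := hb.exists_le_objReal
  have hr : ∀ k, r (x (k + 1)) ≠ ⊤ := fun k => hs.ne_top (hx k)
  have hL := hb.pos
  obtain ⟨l, hl⟩ := exists_tendsto_of_almost_decreasing (F := fun k => objReal f r (x (k + 1)))
    (s := fun k => ‖g (k + 1) - avgGrad f (x (k + 1))‖ ^ 2 / (2 * (μ - L / 2)))
    (((summable_nat_add_iff 1).2 he).div_const _) (fun k => hc _ (hr k)) fun k => by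
      have h1 := objReal_step_sq hn hb hs hu hμ (hr k) (hx (k + 1))
      have h2 : 0 ≤ (μ - L / 2) / 2 * ‖x (k + 1 + 1) - x (k + 1)‖ ^ 2 := by
        have : 0 < μ - L / 2 := by linarith
        positivity
      linarith
  exact ⟨l, (tendsto_add_atTop_iff_nat 1).1 hl⟩

lemma tendsto_objective (hb : BasicAssumption f r L) (hs : IsSurrogate r u)
    (hx : ∀ k, IsArgmin (proxObj μ (x k) (g k) (fun z => u z (x k))) (x (k + 1)))
    {l : ℝ} (hl : Tendsto (fun k => objReal f r (x k)) atTop (𝓝 l)) :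
    Tendsto (fun k => objective f r (x k)) atTop (𝓝 (l : EReal)) := by
  rw [← tendsto_add_atTop_iff_nat 1]
  have := (continuous_coe_real_ereal.tendsto l).comp ((tendsto_add_atTop_iff_nat 1).2 hl)
  refine this.congr fun k => ?_
  exact (objective_eq_coe hb (hs.ne_top (hx k))).symm

/-- Limit points lie in the domain. -/
lemma ne_top_of_tendsto (hb : BasicAssumption f r L) {y : ℕ → EuclideanSpace ℝ (Fin d)}
    {xs : EuclideanSpace ℝ (Fin d)} {l : ℝ} (hy : Tendsto y atTop (𝓝 xs))
    (hr : ∀ᶠ j in atTop, r (y j) ≠ ⊤)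
    (hl : Tendsto (fun j => objReal f r (y j)) atTop (𝓝 l)) : r xs ≠ ⊤ := by
  intro htop
  have h1 : ∀ᶠ j in atTop, ((l + 2 - avg f xs : ℝ) : EReal) < r (y j) :=
    by
    have h : ((l + 2 - avg f xs : ℝ) : EReal) < r xs := by rw [htop]; exact EReal.coe_lt_top _
    exact hy.eventually (hb.lsc xs _ h)
  have h2 : ∀ᶠ j in atTop, avg f xs - 1 < avg f (y j) :=
    ((hb.continuous_avg.tendsto xs).comp hy).eventually (lt_mem_nhds (by linarith))
  have h3 : ∀ᶠ j in atTop, objReal f r (y j) < l + 1 := hl.eventually (gt_mem_nhds (by linarith))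
  obtain ⟨j, hj1, hj2, hj3, hj4⟩ := (h1.and (h2.and (h3.and hr))).exists
  rw [← EReal.coe_toReal hj4 (hb.ne_bot _), EReal.coe_lt_coe_iff] at hj1
  rw [objReal] at hj3
  linarith

/-- The optimality condition of the subproblems, passed to the limit. -/
lemma limit_optimality (hb : BasicAssumption f r L) (hs : IsSurrogate r u)
    (hu : SurrogateAssumption r u) {y y' γ : ℕ → EuclideanSpace ℝ (Fin d)}
    {xs gs : EuclideanSpace ℝ (Fin d)} (hy : Tendsto y atTop (𝓝 xs))
    (hy' : Tendsto y' atTop (𝓝 xs)) (hγ : Tendsto γ atTop (𝓝 gs))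
    (hopt : ∀ j, IsArgmin (proxObj μ (y j) (γ j) (fun z => u z (y j))) (y' j))
    (hr : r xs ≠ ⊤) {z : EuclideanSpace ℝ (Fin d)} (hz : u z xs ≠ ⊤) :
    inner ℝ gs xs + (r xs).toReal ≤ μ / 2 * ‖z - xs‖ ^ 2 + inner ℝ gs z + (u z xs).toReal := by
  refine le_of_forall_pos_le_add fun ε hε => ?_
  -- Joint semicontinuity of u is not available: continuity in the second variable bounds the right
  -- side from above, and r ≤ u together with lower semicontinuity of r bounds the left side from
  -- below.
  have h1 : ∀ᶠ j in atTop, u z (y j) < (((u z xs).toReal + ε / 2 : ℝ) : EReal) := by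
    refine ((hu.continuous_right z).tendsto xs |>.comp hy).eventually (gt_mem_nhds ?_)
    conv_lhs => rw [← EReal.coe_toReal hz (hs.ne_bot z xs)]
    rw [EReal.coe_lt_coe_iff]; linarith
  have h2 : ∀ᶠ j in atTop, (((r xs).toReal - ε / 2 : ℝ) : EReal) < r (y' j) := by
    have h : (((r xs).toReal - ε / 2 : ℝ) : EReal) < r xs :=
      lt_of_lt_of_eq (EReal.coe_lt_coe_iff.2 (by linarith)) (EReal.coe_toReal hr (hb.ne_bot xs))
    exact hy'.eventually (hb.lsc xs _ h)
  have h3 : ∀ᶠ j in atTop, μ / 2 * ‖y' j - y j‖ ^ 2 + inner ℝ (γ j) (y' j)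
      + ((r xs).toReal - ε / 2)
      ≤ μ / 2 * ‖z - y j‖ ^ 2 + inner ℝ (γ j) z + ((u z xs).toReal + ε / 2) := by
    filter_upwards [h1, h2] with j hj1 hj2
    have h := (hopt j).2 z
    have ht := (hopt j).ne_top
    have htz : u z (y j) ≠ ⊤ := ne_top_of_lt hj1
    have hj3 := hj2.trans_le (hs.le (y' j) (y j))
    rw [proxObj_eq_coe (φ := fun z => u z (y j)) (hs.ne_bot _ _) ht,
      proxObj_eq_coe (φ := fun z => u z (y j)) (hs.ne_bot _ _) htz,
      EReal.coe_le_coe_iff] at h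
    rw [← EReal.coe_toReal ht (hs.ne_bot _ _), EReal.coe_lt_coe_iff] at hj3
    rw [← EReal.coe_toReal htz (hs.ne_bot _ _), EReal.coe_lt_coe_iff] at hj1
    linarith
  have l1 : Tendsto (fun j => μ / 2 * ‖y' j - y j‖ ^ 2 + inner ℝ (γ j) (y' j)
      + ((r xs).toReal - ε / 2)) atTop (𝓝 (μ / 2 * ‖xs - xs‖ ^ 2 + inner ℝ gs xs
      + ((r xs).toReal - ε / 2))) :=
    ((((hy'.sub hy).norm.pow 2).const_mul _).add (hγ.inner hy')).add_const _
  have l2 : Tendsto (fun j => μ / 2 * ‖z - y j‖ ^ 2 + inner ℝ (γ j) z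
      + ((u z xs).toReal + ε / 2)) atTop (𝓝 (μ / 2 * ‖z - xs‖ ^ 2 + inner ℝ gs z
      + ((u z xs).toReal + ε / 2))) :=
    (((((tendsto_const_nhds (x := z)).sub hy).norm.pow 2).const_mul _).add
      (hγ.inner tendsto_const_nhds)).add_const _
  have := le_of_tendsto_of_tendsto l1 l2 h3
  rw [sub_self, norm_zero] at this
  linarith

/-- If the lower limit were below some q < 0, it would be contradicted near `xs`: the remainder of
f, the error bound `hbar` and the quadratic term are all o(‖y - xs‖), and each receives a third of
-q‖y - xs‖. -/
lemma zero_mem_frechetSubdiff (hb : BasicAssumption f r L) (hs : IsSurrogate r u)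
    (hu : SurrogateAssumption r u) {xs : EuclideanSpace ℝ (Fin d)} (hr : r xs ≠ ⊤)
    (hopt : ∀ z, u z xs ≠ ⊤ → inner ℝ (avgGrad f xs) xs + (r xs).toReal
      ≤ μ / 2 * ‖z - xs‖ ^ 2 + inner ℝ (avgGrad f xs) z + (u z xs).toReal) :
    (0 : EuclideanSpace ℝ (Fin d)) ∈ frechetSubdiff (objective f r) xs := by
  refine ⟨by rw [objective_eq_coe hb hr]; exact EReal.coe_ne_top _, ?_⟩
  by_contra hcon
  push Not at hcon
  obtain ⟨q, hq1, hq2⟩ := EReal.lt_iff_exists_real_btwn.1 hcon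
  have hq0 : q < 0 := by exact_mod_cast hq2
  refine absurd hq1 (not_lt.2 (le_liminf_of_le (by isBoundedDefault) ?_))
  obtain ⟨hbar, hbot, hbar_prop⟩ := hu.error_bound
  obtain ⟨h0, hfin, hC, hgrad, hle⟩ := hbar_prop xs
  have hε : 0 < -q / 3 := by linarith
  have hf : ∀ᶠ y in 𝓝 xs, |avg f y - avg f xs - inner ℝ (avgGrad f xs) (y - xs)|
      ≤ -q / 3 * ‖y - xs‖ := by
    have := (hb.hasGradientAt_avg xs).hasFDerivAt.isLittleO.def hε
    rw [← hb.avgGrad_eq] at this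
    simpa [InnerProductSpace.toDual_apply_apply] using this
  have hh : ∀ᶠ y in 𝓝 xs, |(hbar y xs).toReal| ≤ -q / 3 * ‖y - xs‖ := by
    have h1 : HasGradientAt (fun x => (hbar x xs).toReal) 0 xs := by
      rw [← hgrad]
      exact (hC.differentiableAt (by norm_num)).hasGradientAt
    have := h1.hasFDerivAt.isLittleO.def hε
    simpa [h0] using this
  have hq : ∀ᶠ y in 𝓝 xs, μ / 2 * ‖y - xs‖ ≤ -q / 3 := by
    have : Tendsto (fun y => μ / 2 * ‖y - xs‖) (𝓝 xs) (𝓝 (μ / 2 * ‖xs - xs‖)) :=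
      ((continuous_id.sub continuous_const).norm.const_mul (μ / 2)).tendsto xs
    rw [sub_self, norm_zero, mul_zero] at this
    exact (this.eventually (gt_mem_nhds hε)).mono fun _ h => h.le
  have hne : ∀ᶠ y in 𝓝[≠] xs, y ≠ xs := eventually_mem_nhdsWithin
  filter_upwards [nhdsWithin_le_nhds hf, nhdsWithin_le_nhds hh, nhdsWithin_le_nhds hq,
    nhdsWithin_le_nhds hfin, hne] with y hy1 hy2 hy3 hy4 hy5
  have hpos : 0 < ‖y - xs‖ := norm_pos_iff.2 (sub_ne_zero.2 hy5)
  rw [inner_zero_left, objective_eq_coe hb hr]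
  by_cases hry : r y = ⊤
  · have : objective f r y = ⊤ := by rw [objective, hry]; exact EReal.coe_add_top _
    rw [this, EReal.top_sub_coe, EReal.top_sub_coe, EReal.coe_mul_top_of_pos (by positivity)]
    exact le_top
  rw [objective_eq_coe hb hry, ← EReal.coe_sub, ← EReal.coe_sub, ← EReal.coe_mul,
    EReal.coe_le_coe_iff, sub_zero, inv_mul_eq_div, le_div_iff₀ hpos]
  have hule := hle y
  rw [← EReal.coe_toReal hry (hb.ne_bot y), ← EReal.coe_toReal hy4 (hbot y xs),
    ← EReal.coe_add] at hule
  have hut : u y xs ≠ ⊤ := ne_top_of_le_ne_top (EReal.coe_ne_top _) hule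
  have ho := hopt y hut
  rw [← EReal.coe_toReal hut (hs.ne_bot y xs), EReal.coe_le_coe_iff] at hule
  rw [inner_sub_right] at hy1
  have a1 := neg_le_of_abs_le hy1
  have a2 := le_of_abs_le hy2
  have a3 := mul_le_mul_of_nonneg_right hy3 hpos.le
  rw [objReal, objReal]
  nlinarith

/-- Limit points are stationary. -/
lemma isStationary_of_tendsto (hn : 0 < n) (hb : BasicAssumption f r L) (hs : IsSurrogate r u)
    (hu : SurrogateAssumption r u) (hμ : L / 2 < μ)
    (hx : ∀ k, IsArgmin (proxObj μ (x k) (g k) (fun z => u z (x k))) (x (k + 1)))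
    (hD : Summable fun k => ‖x (k + 1) - x k‖ ^ 2)
    (he : Summable fun k => ‖g k - avgGrad f (x k)‖ ^ 2)
    {xs : EuclideanSpace ℝ (Fin d)} {φ : ℕ → ℕ} (hφ : StrictMono φ)
    (hlim : Tendsto (fun j => x (φ j)) atTop (𝓝 xs)) : IsStationary (objective f r) xs := by
  have hL := hb.pos
  have key : ∀ {w : ℕ → EuclideanSpace ℝ (Fin d)}, Summable (fun k => ‖w k‖ ^ 2) →
      Tendsto w atTop (𝓝 0) := fun {w} hw => by
    have h1 := hw.tendsto_atTop_zero.sqrt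
    simp only [Real.sqrt_sq (norm_nonneg _), Real.sqrt_zero] at h1
    exact tendsto_zero_iff_norm_tendsto_zero.2 h1
  have hD' := (key hD).comp hφ.tendsto_atTop
  have he' := (key he).comp hφ.tendsto_atTop
  have hy' : Tendsto (fun j => x (φ j + 1)) atTop (𝓝 xs) := by
    have := hD'.add hlim
    rw [zero_add] at this
    exact this.congr fun j => by simp
  have hγ : Tendsto (fun j => g (φ j)) atTop (𝓝 (avgGrad f xs)) := by
    have := he'.add (((hb.continuous_avgGrad hn).tendsto xs).comp hlim)
    rw [zero_add] at this
    exact this.congr fun j => by simp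
  obtain ⟨l, hl⟩ := exists_tendsto_objReal hn hb hs hu hμ hx he
  have hr : r xs ≠ ⊤ := by
    refine ne_top_of_tendsto hb hy' (Eventually.of_forall fun j => hs.ne_top (hx (φ j)))
      (l := l) ?_
    exact ((tendsto_add_atTop_iff_nat 1).2 hl).comp hφ.tendsto_atTop
  have hfr := zero_mem_frechetSubdiff (μ := μ) hb hs hu hr fun z hz =>
    limit_optimality hb hs hu hlim hy' hγ (fun j => hx (φ j)) hr hz
  -- A Fréchet subgradient is a limiting one, by constant sequences.
  exact ⟨hfr.1, hfr.1, fun _ => xs, fun _ => 0, tendsto_const_nhds, tendsto_const_nhds,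
    fun _ => hfr, tendsto_const_nhds⟩

end Pathwise

/-! ### Unbiasedness of the batch mean. -/

section BatchMean

variable {V : Type*} [NormedAddCommGroup V] [InnerProductSpace ℝ V] {n b : ℕ}

lemma sum_sum_batch_eq_zero (v : Fin n → V) (hv : ∑ i, v i = 0) (b : ℕ) :
    ∑ a : Fin b → Fin n, ∑ j, v (a j) = 0 := by
  induction b with
  | zero => simp
  | succ b ih =>
    rw [← (Fin.consEquiv (fun _ : Fin (b + 1) => Fin n)).sum_comp, Fintype.sum_prod_type]
    simp [Fin.sum_univ_succ, Finset.sum_add_distrib, ih, ← Finset.smul_sum, hv]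

lemma batchMean_sub_mean (hb : 0 < b) (v : Fin n → V) (a : Fin b → Fin n) :
    batchMean v a - mean v = (1 / (b : ℝ)) • ∑ j, (v (a j) - mean v) := by
  have hb' : (b : ℝ) ≠ 0 := by positivity
  rw [Finset.sum_sub_distrib, smul_sub]
  simp [batchMean, ← Nat.cast_smul_eq_nsmul ℝ, smul_smul, hb']

lemma sum_sub_mean (hn : 0 < n) (v : Fin n → V) : ∑ i, (v i - mean v) = 0 := by
  rw [Finset.sum_sub_distrib, sum_eq_smul_mean hn v]
  simp [← Nat.cast_smul_eq_nsmul ℝ]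

lemma sum_batchMean_sub_mean (hn : 0 < n) (hb : 0 < b) (v : Fin n → V) :
    ∑ a : Fin b → Fin n, (batchMean v a - mean v) = 0 := by
  simp only [batchMean_sub_mean hb, ← Finset.smul_sum]
  rw [sum_sum_batch_eq_zero _ (sum_sub_mean hn v), smul_zero]

/-- The batch mean is unbiased, so the cross term with the fixed vector `e` averages to zero. -/
lemma batch_variance_add (hn : 0 < n) (hb : 0 < b) (v : Fin n → V) (e : V) :
    ∑ a : Fin b → Fin n, (1 / (n : ℝ)) ^ b * ‖batchMean v a - mean v + e‖ ^ 2
      = (1 / (b : ℝ)) * spread v + ‖e‖ ^ 2 := by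
  have h0 : ∑ a : Fin b → Fin n, inner ℝ (batchMean v a - mean v) e = 0 := by
    rw [← sum_inner, sum_batchMean_sub_mean hn hb, inner_zero_left]
  simp only [norm_add_sq_real, mul_add, Finset.sum_add_distrib]
  rw [batch_variance hn hb, ← Finset.sum_mul, batch_weights_sum hn, ← Finset.mul_sum,
    ← Finset.mul_sum, h0]
  ring

end BatchMean

/-! ### The estimators depend only on the past. -/

section Congruence

variable {d n b : ℕ} {f : Fin n → EuclideanSpace ℝ (Fin d) → ℝ}
  {x x' : ℕ → EuclideanSpace ℝ (Fin d)} {I I' : ℕ → Fin b → Fin n} {c c' : ℕ → Bool}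

lemma sagaTable_congr {k : ℕ} (hx : ∀ j ≤ k, x j = x' j) (hI : ∀ j < k, I j = I' j) :
    sagaTable x I k = sagaTable x' I' k := by
  induction k with
  | zero => funext i; exact hx 0 le_rfl
  | succ k ih =>
    funext i
    rw [sagaTable, sagaTable, hx k (by omega), hI k (by omega),
      ih (fun j hj => hx j (by omega)) (fun j hj => hI j (by omega))]

lemma svrgAnchor_congr {k : ℕ} (hx : ∀ j ≤ k, x j = x' j) (hc : ∀ j < k, c j = c' j) :
    svrgAnchor x c k = svrgAnchor x' c' k := by
  induction k with
  | zero => exact hx 0 le_rfl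
  | succ k ih =>
    rw [svrgAnchor, svrgAnchor, hx k (by omega), hc k (by omega),
      ih (fun j hj => hx j (by omega)) (fun j hj => hc j (by omega))]

lemma sarahGradPrev_congr {k : ℕ} (hx : ∀ j ≤ k, x j = x' j) (hI : ∀ j < k, I j = I' j)
    (hc : ∀ j < k, c j = c' j) : sarahGradPrev f x I c k = sarahGradPrev f x' I' c' k := by
  induction k with
  | zero => rw [sarahGradPrev, sarahGradPrev, hx 0 le_rfl]
  | succ k ih =>
    have : prev x k = prev x' k := by
      cases k with
      | zero => exact hx 0 (by omega)
      | succ k => exact hx k (by omega)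
    rw [sarahGradPrev, sarahGradPrev, hx k (by omega), hc k (by omega), hI k (by omega), this,
      ih (fun j hj => hx j (by omega)) (fun j hj => hI j (by omega)) (fun j hj => hc j (by omega))]

lemma sagaGrad_congr {k : ℕ} (hx : ∀ j ≤ k, x j = x' j) (hI : ∀ j ≤ k, I j = I' j) :
    sagaGrad f x I k = sagaGrad f x' I' k := by
  rw [sagaGrad, sagaGrad, hx k le_rfl, hI k le_rfl,
    sagaTable_congr hx fun j hj => hI j hj.le]

lemma svrgAnchor_succ_congr {k : ℕ} (hx : ∀ j ≤ k, x j = x' j) (hc : ∀ j ≤ k, c j = c' j) :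
    svrgAnchor x c (k + 1) = svrgAnchor x' c' (k + 1) := by
  rw [svrgAnchor, svrgAnchor, hx k le_rfl, hc k le_rfl,
    svrgAnchor_congr hx fun j hj => hc j hj.le]

lemma svrgGrad_congr {k : ℕ} (hx : ∀ j ≤ k, x j = x' j) (hI : ∀ j ≤ k, I j = I' j)
    (hc : ∀ j ≤ k, c j = c' j) : svrgGrad f x I c k = svrgGrad f x' I' c' k := by
  rw [svrgGrad, svrgGrad, hx k le_rfl, hI k le_rfl, svrgAnchor_succ_congr hx hc]

lemma sarahGradPrev_succ_congr {k : ℕ} (hx : ∀ j ≤ k, x j = x' j) (hI : ∀ j ≤ k, I j = I' j)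
    (hc : ∀ j ≤ k, c j = c' j) :
    sarahGradPrev f x I c (k + 1) = sarahGradPrev f x' I' c' (k + 1) := by
  have : prev x k = prev x' k := by
    cases k with
    | zero => exact hx 0 (by omega)
    | succ k => exact hx k (by omega)
  rw [sarahGradPrev, sarahGradPrev, hx k le_rfl, hI k le_rfl, hc k le_rfl, this,
    sarahGradPrev_congr hx (fun j hj => hI j hj.le) (fun j hj => hc j hj.le)]

end Congruence

/-! ### Random proximal iterations in general. -/

section ProxIteration

variable {Ω A : Type*} [MeasurableSpace Ω] {P : Measure Ω} [IsProbabilityMeasure P] [Fintype A]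
  [MeasurableSpace A] [MeasurableSingletonClass A] {wt : A → ℝ} {ξ : ℕ → Ω → A}
  {d n : ℕ} {f : Fin n → EuclideanSpace ℝ (Fin d) → ℝ}
  {r : EuclideanSpace ℝ (Fin d) → EReal}
  {u : EuclideanSpace ℝ (Fin d) → EuclideanSpace ℝ (Fin d) → EReal} {L μ : ℝ}
  {x g : ℕ → Ω → EuclideanSpace ℝ (Fin d)}

/-- The iterates `x k` of a proximal method with gradient estimates `g k`, driven by the random
draws `ξ k`. -/
structure IsProcess (u : EuclideanSpace ℝ (Fin d) → EuclideanSpace ℝ (Fin d) → EReal) (μ : ℝ)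
    (ξ : ℕ → Ω → A) (x g : ℕ → Ω → EuclideanSpace ℝ (Fin d)) : Prop where
  step : ∀ k ω, IsArgmin (proxObj μ (x k ω) (g k ω) (fun z => u z (x k ω))) (x (k + 1) ω)
  adapted : ∀ k, DependsOnDraws ξ k (x k)
  adapted_grad : ∀ k, DependsOnDraws ξ (k + 1) (g k)

/-- The iterates are only assumed to be minimizers; strong convexity makes the minimizer unique, so
by induction each iterate is a function of the draws before it. -/
lemma isProcess_of_step (hs : IsSurrogate r u) (hu : SurrogateAssumption r u) (hμ : 0 < μ)
    {x0 : EuclideanSpace ℝ (Fin d)} (h0 : ∀ ω, x 0 ω = x0)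
    (hx : ∀ k ω, IsArgmin (proxObj μ (x k ω) (g k ω) (fun z => u z (x k ω))) (x (k + 1) ω))
    (hg : ∀ k ω ω', (∀ j ≤ k, ξ j ω = ξ j ω') → (∀ j ≤ k, x j ω = x j ω') → g k ω = g k ω') :
    IsProcess u μ ξ x g := by
  have hx' : ∀ k, DependsOnDraws ξ k (x k) := by
    intro k
    induction k using Nat.strong_induction_on with
    | _ k ih =>
      cases k with
      | zero => intro ω ω' _; rw [h0, h0]
      | succ k =>
        intro ω ω' hω
        have e : ∀ j ≤ k, x j ω = x j ω' := fun j hj =>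
          ih j (by omega) ω ω' fun i hi => hω i (by omega)
        have e' := hg k ω ω' (fun j hj => hω j (by omega)) e
        have h1 := hx k ω
        rw [e k le_rfl, e'] at h1
        exact h1.unique hμ (hu.convex_left _) (fun z => hs.ne_bot z _) (hx k ω')
  exact ⟨hx, hx', fun k ω ω' hω => hg k ω ω' (fun j hj => hω j (by omega))
    fun j hj => hx' j ω ω' fun i hi => hω i (by omega)⟩

lemma IsProcess.ne_top (h : IsProcess u μ ξ x g) (hs : IsSurrogate r u) (k : ℕ) (ω : Ω) :
    r (x (k + 1) ω) ≠ ⊤ := hs.ne_top (h.step k ω)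

lemma IsProcess.adapted_sub (h : IsProcess u μ ξ x g) (k : ℕ) :
    DependsOnDraws ξ (k + 1) (fun ω => ‖x (k + 1) ω - x k ω‖ ^ 2) :=
  (h.adapted (k + 1)).comp₂ ((h.adapted k).mono k.le_succ) fun y z => ‖y - z‖ ^ 2

lemma IsProcess.adapted_err (h : IsProcess u μ ξ x g) (k : ℕ) :
    DependsOnDraws ξ (k + 1) (fun ω => ‖g k ω - avgGrad f (x k ω)‖ ^ 2) :=
  (h.adapted_grad k).comp₂ ((h.adapted k).mono k.le_succ) fun y z => ‖y - avgGrad f z‖ ^ 2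

lemma IsProcess.adapted_obj (h : IsProcess u μ ξ x g) (k : ℕ) :
    DependsOnDraws ξ k (fun ω => objReal f r (x k ω)) := (h.adapted k).comp _

lemma IsProcess.exists_le_integral (h : IsProcess u μ ξ x g) (hξ : IsDraws P wt ξ)
    (hb : BasicAssumption f r L) (hs : IsSurrogate r u) :
    ∃ c, ∀ k, c ≤ ∫ ω, objReal f r (x (k + 1) ω) ∂P := by
  obtain ⟨c, hc⟩ := hb.exists_le_objReal
  refine ⟨c, fun k => ?_⟩
  have := integral_mono (μ := P) (integrable_const c)
    ((h.adapted_obj (f := f) (r := r) (k + 1)).integrable hξ)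
    fun ω => hc _ (h.ne_top hs k ω)
  simpa using this

lemma IsProcess.integral_step (h : IsProcess u μ ξ x g) (hξ : IsDraws P wt ξ) (hn : 0 < n)
    (hb : BasicAssumption f r L) (hs : IsSurrogate r u) (hu : SurrogateAssumption r u)
    (hμ : L / 2 < μ) (k : ℕ) :
    ∫ ω, objReal f r (x (k + 2) ω) ∂P
      + (μ - L / 2) / 2 * ∫ ω, ‖x (k + 2) ω - x (k + 1) ω‖ ^ 2 ∂P
      ≤ ∫ ω, objReal f r (x (k + 1) ω) ∂P
        + (∫ ω, ‖g (k + 1) ω - avgGrad f (x (k + 1) ω)‖ ^ 2 ∂P) / (2 * (μ - L / 2)) := by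
  have i1 := (h.adapted_obj (f := f) (r := r) (k + 2)).integrable hξ
  have i2 := (h.adapted_sub (k + 1)).integrable hξ
  have i3 := (h.adapted_obj (f := f) (r := r) (k + 1)).integrable hξ
  have i4 := (h.adapted_err (f := f) (k + 1)).integrable hξ
  rw [← integral_const_mul, ← integral_div, ← integral_add i1 (i2.const_mul _),
    ← integral_add i3 (i4.div_const _)]
  exact integral_mono (i1.add (i2.const_mul _)) (i3.add (i4.div_const _)) fun ω =>
    objReal_step_sq hn hb hs hu hμ (h.ne_top hs k ω) (h.step (k + 1) ω)

lemma IsProcess.ae_convergence (h : IsProcess u μ ξ x g) (hξ : IsDraws P wt ξ) (hn : 0 < n)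
    (hb : BasicAssumption f r L) (hs : IsSurrogate r u) (hu : SurrogateAssumption r u)
    (hμ : L / 2 < μ) (hD : Summable fun k => ∫ ω, ‖x (k + 1) ω - x k ω‖ ^ 2 ∂P)
    (he : Summable fun k => ∫ ω, ‖g k ω - avgGrad f (x k ω)‖ ^ 2 ∂P) :
    (∀ᵐ ω ∂P, ∃ l : ℝ, Tendsto (fun k => objective f r (x k ω)) atTop (𝓝 (l : EReal))) ∧
    (∀ᵐ ω ∂P, Summable (fun k => ‖x (k + 1) ω - x k ω‖ ^ 2) ∧
      Tendsto (fun k => ‖x (k + 1) ω - x k ω‖ ^ 2) atTop (𝓝 0)) ∧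
    (∀ᵐ ω ∂P, ∀ xs : EuclideanSpace ℝ (Fin d),
      (∃ φ : ℕ → ℕ, StrictMono φ ∧ Tendsto (fun j => x (φ j) ω) atTop (𝓝 xs)) →
      IsStationary (objective f r) xs) := by
  have h1 := ae_summable_of_summable_integral (fun k => (h.adapted_sub k).integrable hξ)
    (fun k ω => by positivity) hD
  have h2 := ae_summable_of_summable_integral (fun k => (h.adapted_err (f := f) k).integrable hξ)
    (fun k ω => by positivity) he
  refine ⟨?_, ?_, ?_⟩
  · filter_upwards [h2] with ω hω
    obtain ⟨l, hl⟩ := exists_tendsto_objReal hn hb hs hu hμ (fun k => h.step k ω) hω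
    exact ⟨l, tendsto_objective hb hs (fun k => h.step k ω) hl⟩
  · filter_upwards [h1] with ω hω
    exact ⟨hω, hω.tendsto_atTop_zero⟩
  · filter_upwards [h1, h2] with ω hω1 hω2 xs ⟨φ, hφ, hlim⟩
    exact isStationary_of_tendsto hn hb hs hu hμ (fun k => h.step k ω) hω1 hω2 hφ hlim

end ProxIteration

/-! ### Averaging over a batch and a coin. -/

section Coin

variable {Ω : Type*} [MeasurableSpace Ω] {P : Measure Ω} [IsProbabilityMeasure P]
  {d n b m : ℕ} {f : Fin n → EuclideanSpace ℝ (Fin d) → ℝ}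
  {r : EuclideanSpace ℝ (Fin d) → EReal}
  {u : EuclideanSpace ℝ (Fin d) → EuclideanSpace ℝ (Fin d) → EReal} {L μ : ℝ}
  {x : ℕ → Ω → EuclideanSpace ℝ (Fin d)} {x0 : EuclideanSpace ℝ (Fin d)}
  {I : ℕ → Ω → Fin b → Fin n} {c : ℕ → Ω → Bool}

/-- The law of a batch and a coin. -/
def coinWeight (n b m : ℕ) (a : (Fin b → Fin n) × Bool) : ℝ :=
  (1 / (n : ℝ)) ^ b * (if a.2 = true then 1 / (m : ℝ) else 1 - 1 / (m : ℝ))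

lemma IsBatchCoinSampling.isDraws (h : IsBatchCoinSampling P m I c) :
    IsDraws P (coinWeight n b m) (fun k ω => (I k ω, c k ω)) where
  measurable k := (h.measurable_batch k).prodMk (h.measurable_coin k)
  indep := h.indep
  law k a := by
    rw [coinWeight, ← h.law k a.1 a.2]
    congr 1; ext ω; simp [Prod.ext_iff]

lemma one_sub_inv_nonneg (hm : 0 < m) : 0 ≤ 1 - 1 / (m : ℝ) := by
  have : (1 : ℝ) ≤ m := by exact_mod_cast hm
  rw [sub_nonneg, div_le_one (by positivity)]; exact this

/-- Averaging over a batch and a coin. -/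
lemma sum_coinWeight_le (hm : 0 < m) {Ψ : (Fin b → Fin n) × Bool → ℝ}
    {B C : (Fin b → Fin n) → ℝ} (h1 : ∀ a, coinWeight n b m (a, true) ≠ 0 → Ψ (a, true) ≤ B a)
    (h2 : ∀ a, coinWeight n b m (a, false) ≠ 0 → Ψ (a, false) ≤ C a) :
    ∑ a, coinWeight n b m a * Ψ a
      ≤ 1 / (m : ℝ) * ∑ a, (1 / (n : ℝ)) ^ b * B a
        + (1 - 1 / (m : ℝ)) * ∑ a, (1 / (n : ℝ)) ^ b * C a := by
  have hm' := one_sub_inv_nonneg hm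
  rw [Fintype.sum_prod_type, Finset.mul_sum, Finset.mul_sum, ← Finset.sum_add_distrib]
  refine Finset.sum_le_sum fun a _ => ?_
  rw [Fintype.sum_bool]
  have e1 : coinWeight n b m (a, true) = 1 / (m : ℝ) * (1 / (n : ℝ)) ^ b := by
    simp [coinWeight, mul_comm]
  have e2 : coinWeight n b m (a, false) = (1 - 1 / (m : ℝ)) * (1 / (n : ℝ)) ^ b := by
    simp [coinWeight, mul_comm]
  -- Bounds are needed only where the weight is nonzero. For m = 1 the coin never fails, and nothing
  -- is required of that branch.
  have key : ∀ {w X Y : ℝ}, 0 ≤ w → (w ≠ 0 → X ≤ Y) → w * X ≤ w * Y := fun {w X Y} hw h => by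
    rcases eq_or_ne w 0 with h0 | h0
    · simp [h0]
    · exact mul_le_mul_of_nonneg_left (h h0) hw
  rw [← mul_assoc, ← mul_assoc, ← e1, ← e2]
  exact add_le_add (key (by rw [e1]; positivity) (h1 a)) (key (by rw [e2]; positivity) (h2 a))

/-! ### MM-SVRG. -/

section SVRG

lemma svrgGrad_sub (hf : BasicAssumption f r L)
    (x : ℕ → EuclideanSpace ℝ (Fin d))
    (I : ℕ → Fin b → Fin n) (c : ℕ → Bool) (k : ℕ) :
    svrgGrad f x I c k - avgGrad f (x k)
      = batchMean (grads f (x k) - grads f (svrgAnchor x c (k + 1))) (I k)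
        - mean (grads f (x k) - grads f (svrgAnchor x c (k + 1))) := by
  rw [mean_sub, svrgGrad, hf.avgGrad_eq, hf.avgGrad_eq, batchMean]
  simp only [Pi.sub_apply, grads]
  abel

/-- After a success the anchor is the current point and the noise vanishes; after a failure it is
the variance of a batch mean around the old anchor. The failure probability is bounded by 1. -/
lemma svrg_error_le (hn : 0 < n) (hb : 0 < b) (hm : 0 < m) (hf : BasicAssumption f r L)
    (hsamp : IsBatchCoinSampling P m I c)
    (hx : IsProcess u μ (fun k ω => (I k ω, c k ω)) x
      (fun k ω => svrgGrad f (fun j => x j ω) (fun j => I j ω) (fun j => c j ω) k)) (k : ℕ)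
    (hanc : DependsOnDraws (fun k ω => (I k ω, c k ω)) k
      (fun ω => svrgAnchor (fun j => x j ω) (fun j => c j ω) k)) :
    ∫ ω, ‖svrgGrad f (fun j => x j ω) (fun j => I j ω) (fun j => c j ω) k
        - avgGrad f (x k ω)‖ ^ 2 ∂P
      ≤ ∫ ω, 1 / (b : ℝ) * msq (grads f (x k ω)
          - grads f (svrgAnchor (fun j => x j ω) (fun j => c j ω) k)) ∂P := by
  refine integral_le_of_step hsamp.isDraws
    ((hx.adapted k).comp₂ hanc fun y z => 1 / (b : ℝ) * msq (grads f y - grads f z))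
    (hx.adapted_err k) fun ω s hω => ?_
  set w := grads f (x k ω) - grads f (svrgAnchor (fun j => x j ω) (fun j => c j ω) k) with hw
  have hx' : ∀ a, coinWeight n b m a ≠ 0 → x k (s a) = x k ω := fun a ha =>
    hx.adapted k _ _ (hω a ha).1
  have hanc' : ∀ a, coinWeight n b m a ≠ 0 → svrgAnchor (fun j => x j (s a))
      (fun j => c j (s a)) k = svrgAnchor (fun j => x j ω) (fun j => c j ω) k := fun a ha =>
    hanc _ _ (hω a ha).1
  refine (sum_coinWeight_le hm (B := fun _ => 0)
    (C := fun a => ‖batchMean w a - mean w‖ ^ 2) (fun a ha => ?_) fun a ha => ?_).trans ?_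
  · have hc : c k (s (a, true)) = true := congrArg Prod.snd (hω _ ha).2
    simp [svrgGrad_sub hf, svrgAnchor, hc, batchMean, mean]
  · have hc : c k (s (a, false)) = false := congrArg Prod.snd (hω _ ha).2
    have hI : I k (s (a, false)) = a := congrArg Prod.fst (hω _ ha).2
    rw [svrgGrad_sub hf]
    simp only [svrgAnchor, hc, hI, hanc' _ ha, hx' _ ha]
    exact le_rfl
  · rw [batch_variance hn hb]
    have h1 := spread_le_msq hn w
    have h2 := one_sub_inv_nonneg hm
    have h3 : 1 - 1 / (m : ℝ) ≤ 1 := by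
      have : 0 ≤ 1 / (m : ℝ) := by positivity
      linarith
    have h4 := spread_nonneg w
    simp only [mul_zero, Finset.sum_const_zero, zero_add]
    calc _ ≤ 1 * (1 / (b : ℝ) * spread w) := by gcongr
      _ ≤ _ := by rw [one_mul]; gcongr

/-- A success resets the memory to the last gradient increment. A failure enlarges it by Young's
inequality, with the factor 1 + 1/(2(m-1)), and (1 - 1/m) times this factor is 1 - 1/(2m); the
complementary Young factor 2m - 1 gives V_Υ. -/
lemma svrg_memory_le (hn : 0 < n) (hb : 0 < b) (hm : 0 < m) (hf : BasicAssumption f r L)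
    (hsamp : IsBatchCoinSampling P m I c)
    (hx : IsProcess u μ (fun k ω => (I k ω, c k ω)) x
      (fun k ω => svrgGrad f (fun j => x j ω) (fun j => I j ω) (fun j => c j ω) k)) 
    (hanc : ∀ k, DependsOnDraws (fun k ω => (I k ω, c k ω)) k
      (fun ω => svrgAnchor (fun j => x j ω) (fun j => c j ω) k)) (k : ℕ) :
    ∫ ω, 1 / (b : ℝ) * msq (grads f (x (k + 1) ω)
          - grads f (svrgAnchor (fun j => x j ω) (fun j => c j ω) (k + 1))) ∂P
      ≤ (1 - 1 / (2 * (m : ℝ))) * ∫ ω, 1 / (b : ℝ) * msq (grads f (x k ω)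
          - grads f (svrgAnchor (fun j => x j ω) (fun j => c j ω) k)) ∂P
        + (2 * (m : ℝ) - 1) * L ^ 2 / b * ∫ ω, ‖x (k + 1) ω - x k ω‖ ^ 2 ∂P := by
  have hm1 : (1 : ℝ) ≤ m := by exact_mod_cast hm
  have hy := fun k => (hx.adapted k).comp₂ (hanc k) fun y z =>
    1 / (b : ℝ) * msq (grads f y - grads f z)
  have hD := (hx.adapted_sub k).comp fun t => (2 * (m : ℝ) - 1) * L ^ 2 / b * t
  have key := integral_le_of_step hsamp.isDraws (k := k)
    ((hy k).comp fun t => (1 - 1 / (2 * (m : ℝ))) * t) ((hy (k + 1)).comp₂ hD fun s t => s - t)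
    fun ω s hω => ?_
  · rw [integral_sub ((hy (k + 1)).integrable hsamp.isDraws) (hD.integrable hsamp.isDraws)] at key
    simp only [integral_const_mul] at key ⊢
    linarith
  set w := grads f (x k ω) - grads f (svrgAnchor (fun j => x j ω) (fun j => c j ω) k) with hw
  have hx' : ∀ a, coinWeight n b m a ≠ 0 → x k (s a) = x k ω := fun a ha =>
    hx.adapted k _ _ (hω a ha).1
  have hanc' : ∀ a, coinWeight n b m a ≠ 0 → svrgAnchor (fun j => x j (s a))
      (fun j => c j (s a)) k = svrgAnchor (fun j => x j ω) (fun j => c j ω) k := fun a ha =>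
    hanc k _ _ (hω a ha).1
  -- For m = 1 the denominator in `C` is zero, which is harmless since failure then has weight zero.
  refine (sum_coinWeight_le hm (B := fun _ => 0)
    (C := fun a => (2 * (m : ℝ) - 1) / (2 * (m - 1)) * (1 / (b : ℝ) * msq w))
    (fun a ha => ?_) fun a ha => ?_).trans ?_
  · have hc : c k (s (a, true)) = true := congrArg Prod.snd (hω _ ha).2
    simp only [svrgAnchor, hc, if_true]
    have h1 := hf.msq_grads_sub_le (x (k + 1) (s (a, true))) (x k (s (a, true)))
    have h2 : L ^ 2 ≤ (2 * (m : ℝ) - 1) * L ^ 2 := by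
      nlinarith [sq_nonneg L]
    rw [sub_nonpos]
    calc _ ≤ 1 / (b : ℝ) * ((2 * (m : ℝ) - 1) * L ^ 2
        * ‖x (k + 1) (s (a, true)) - x k (s (a, true))‖ ^ 2) := by
          gcongr
          exact h1.trans (by gcongr)
      _ = _ := by ring
  · have hc : c k (s (a, false)) = false := congrArg Prod.snd (hω _ ha).2
    have hm2 : (1 : ℝ) < m := by
      rcases hm1.lt_or_eq with h | h
      · exact h
      · exact absurd (by simp [coinWeight, ← h]) ha
    simp only [svrgAnchor, hc, Bool.false_eq_true, if_false, hanc' _ ha]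
    have h1 := hf.msq_grads_sub_le (x (k + 1) (s (a, false))) (x k (s (a, false)))
    have h2 := mul_msq_add_le (k := 2 * ((m : ℝ) - 1)) (al := 2 * m - 1)
      (a := 2 * ((m : ℝ) - 1) * (2 * m - 1)) (by linarith) (by nlinarith)
      (le_of_eq (by ring)) w (grads f (x (k + 1) (s (a, false))) - grads f (x k (s (a, false))))
    have e : grads f (x (k + 1) (s (a, false)))
        - grads f (svrgAnchor (fun j => x j ω) (fun j => c j ω) k)
        = w + (grads f (x (k + 1) (s (a, false))) - grads f (x k (s (a, false)))) := by
      rw [hw, hx' _ ha]; abel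
    rw [e]
    have h3 : 0 < 2 * ((m : ℝ) - 1) := by linarith
    have hb' : (0 : ℝ) < b := by positivity
    rw [sub_le_iff_le_add]
    have h4 : msq (w + (grads f (x (k + 1) (s (a, false))) - grads f (x k (s (a, false)))))
        ≤ (2 * (m : ℝ) - 1) / (2 * (m - 1)) * msq w
          + (2 * (m : ℝ) - 1) * (L ^ 2 * ‖x (k + 1) (s (a, false)) - x k (s (a, false))‖ ^ 2) := by
      have h5 : 2 * ((m : ℝ) - 1) * (2 * m - 1) * msq
          (grads f (x (k + 1) (s (a, false))) - grads f (x k (s (a, false))))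
          ≤ 2 * ((m : ℝ) - 1) * (2 * m - 1) *
            (L ^ 2 * ‖x (k + 1) (s (a, false)) - x k (s (a, false))‖ ^ 2) :=
        mul_le_mul_of_nonneg_left h1 (mul_nonneg h3.le (by linarith))
      rw [← mul_le_mul_iff_right₀ h3]
      have h6 : 2 * ((m : ℝ) - 1) * ((2 * (m : ℝ) - 1) / (2 * (m - 1)) * msq w)
          = (2 * m - 1) * msq w := by
        rw [← mul_assoc, mul_div_cancel₀ _ h3.ne']
      linarith
    calc _ ≤ 1 / (b : ℝ) * _ := mul_le_mul_of_nonneg_left h4 (by positivity)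
      _ = _ := by ring
  · have e0 : ∀ K : ℝ, ∑ _a : Fin b → Fin n, (1 / (n : ℝ)) ^ b * K = K := fun K => by
      rw [← Finset.sum_mul, batch_weights_sum hn, one_mul]
    simp only [mul_zero, Finset.sum_const_zero, zero_add]
    rw [e0]
    have h4 := msq_nonneg w
    rcases hm1.lt_or_eq with h | h
    · have h3 : (m : ℝ) - 1 ≠ 0 := by linarith
      have h5 : (m : ℝ) ≠ 0 := by linarith
      have : (1 - 1 / (m : ℝ)) * ((2 * (m : ℝ) - 1) / (2 * (m - 1)))
          = 1 - 1 / (2 * (m : ℝ)) := by field_simp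
      rw [← mul_assoc, this]
    · rw [← h]; norm_num; positivity

lemma svrg_ae_convergence (hn : 0 < n) (hb : 0 < b) (hm : 0 < m) (hf : BasicAssumption f r L)
    (hs : IsSurrogate r u) (hu : SurrogateAssumption r u) (hμ : L / 2 < μ)
    (hcond : 0 < (2 * μ - L) ^ 2 - 4 * ((2 * (m : ℝ) - 1) * L ^ 2 / b / (1 / (2 * (m : ℝ)))))
    (hsamp : IsBatchCoinSampling P m I c)
    (hrun : ∀ ω, IsRun .svrg f u μ x0 (fun k => I k ω) (fun k => c k ω) (fun k => x k ω)) :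
    (∀ᵐ ω ∂P, ∃ l : ℝ, Tendsto (fun k => objective f r (x k ω)) atTop (𝓝 (l : EReal))) ∧
    (∀ᵐ ω ∂P, Summable (fun k => ‖x (k + 1) ω - x k ω‖ ^ 2) ∧
      Tendsto (fun k => ‖x (k + 1) ω - x k ω‖ ^ 2) atTop (𝓝 0)) ∧
    (∀ᵐ ω ∂P, ∀ xs : EuclideanSpace ℝ (Fin d),
      (∃ φ : ℕ → ℕ, StrictMono φ ∧ Tendsto (fun j => x (φ j) ω) atTop (𝓝 xs)) →
      IsStationary (objective f r) xs) := by
  have hL := hf.pos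
  have hm1 : (1 : ℝ) ≤ m := by exact_mod_cast hm
  have hx : IsProcess u μ (fun k ω => (I k ω, c k ω)) x
      (fun k ω => svrgGrad f (fun j => x j ω) (fun j => I j ω) (fun j => c j ω) k) :=
    isProcess_of_step hs hu (by linarith) (fun ω => (hrun ω).1) (fun k ω => (hrun ω).2 k)
      fun k ω ω' hω hxω => svrgGrad_congr hxω (fun j hj => congrArg Prod.fst (hω j hj))
        (fun j hj => congrArg Prod.snd (hω j hj))
  have hanc : ∀ k, DependsOnDraws (fun k ω => (I k ω, c k ω)) k
      (fun ω => svrgAnchor (fun j => x j ω) (fun j => c j ω) k) := fun k ω ω' hω =>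
    svrgAnchor_congr (fun j hj => hx.adapted j ω ω' fun i hi => hω i (by omega))
      (fun j hj => congrArg Prod.snd (hω j hj))
  obtain ⟨c₀, hc₀⟩ := hx.exists_le_integral hsamp.isDraws hf hs
  obtain ⟨h1, h2⟩ := summable_of_variance_reduction (s := μ - L / 2) (ρ := 1 / (2 * (m : ℝ)))
    (V := 0) (V₁ := (2 * (m : ℝ) - 1) * L ^ 2 / b) (V₂ := 0) (by linarith) (by positivity) le_rfl
    (by have : 0 ≤ 2 * (m : ℝ) - 1 := by linarith
        positivity) le_rfl
    (F := fun k => ∫ ω, objReal f r (x k ω) ∂P) (D := fun k => ∫ ω, ‖x (k + 1) ω - x k ω‖ ^ 2 ∂P)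
    (ε := fun k => ∫ ω, ‖svrgGrad f (fun j => x j ω) (fun j => I j ω) (fun j => c j ω) k
        - avgGrad f (x k ω)‖ ^ 2 ∂P)
    hc₀ (fun k => integral_nonneg fun ω => by positivity)
    (y := fun k => ∫ ω, 1 / (b : ℝ) * msq (grads f (x k ω)
      - grads f (svrgAnchor (fun j => x j ω) (fun j => c j ω) k)) ∂P)
    (fun k => integral_nonneg fun ω => mul_nonneg (by positivity) (msq_nonneg _))
    (fun k => integral_nonneg fun ω => by positivity)
    (fun k => hx.integral_step hsamp.isDraws hn hf hs hu hμ k)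
    (fun k => by
      have := svrg_error_le hn hb hm hf hsamp hx (k + 1) (hanc (k + 1))
      rw [zero_mul, add_zero]; exact this)
    (fun k => by
      have := svrg_memory_le hn hb hm hf hsamp hx hanc (k + 1)
      rw [zero_mul, add_zero]; exact this)
    (by rw [zero_add, add_zero]; nlinarith)
  exact hx.ae_convergence hsamp.isDraws hn hf hs hu hμ h1 h2

end SVRG

/-! ### MM-SARAH. -/

section SARAH

lemma sarahGradPrev_sub (hf : BasicAssumption f r L) (x : ℕ → EuclideanSpace ℝ (Fin d))
    (I : ℕ → Fin b → Fin n) (c : ℕ → Bool) (k : ℕ) (hc : c k = false) :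
    sarahGradPrev f x I c (k + 1) - avgGrad f (x k)
      = batchMean (grads f (x k) - grads f (prev x k)) (I k)
        - mean (grads f (x k) - grads f (prev x k))
        + (sarahGradPrev f x I c k - avgGrad f (prev x k)) := by
  rw [mean_sub, sarahGradPrev, hf.avgGrad_eq, hf.avgGrad_eq, batchMean, hc]
  simp only [Pi.sub_apply, grads, Bool.false_eq_true, if_false]
  abel

/-- A success erases the error. A failure adds to the old error an independent centred batch error,
so their squared norms add up in expectation. -/
lemma sarah_error_le (hn : 0 < n) (hb : 0 < b) (hm : 0 < m) (hf : BasicAssumption f r L)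
    (hsamp : IsBatchCoinSampling P m I c)
    (hx : IsProcess u μ (fun k ω => (I k ω, c k ω)) x
      (fun k ω => sarahGradPrev f (fun j => x j ω) (fun j => I j ω) (fun j => c j ω) (k + 1)))
    (k : ℕ) :
    ∫ ω, ‖sarahGradPrev f (fun j => x j ω) (fun j => I j ω) (fun j => c j ω) (k + 2)
        - avgGrad f (x (k + 1) ω)‖ ^ 2 ∂P
      ≤ (1 - 1 / (m : ℝ)) * ∫ ω, ‖sarahGradPrev f (fun j => x j ω) (fun j => I j ω)
          (fun j => c j ω) (k + 1) - avgGrad f (x k ω)‖ ^ 2 ∂P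
        + (1 - 1 / (m : ℝ)) * (L ^ 2 / b) * ∫ ω, ‖x (k + 1) ω - x k ω‖ ^ 2 ∂P := by
  have hm' := one_sub_inv_nonneg hm
  have d1 := (hx.adapted_err (f := f) k).comp fun t => (1 - 1 / (m : ℝ)) * t
  have d2 := (hx.adapted_sub k).comp fun t => (1 - 1 / (m : ℝ)) * (L ^ 2 / b) * t
  rw [← integral_const_mul, ← integral_const_mul,
    ← integral_add (d1.integrable hsamp.isDraws) (d2.integrable hsamp.isDraws)]
  refine integral_le_of_step hsamp.isDraws (d1.comp₂ d2 fun s t => s + t)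
    (hx.adapted_err (k + 1)) fun ω s hω => ?_
  set w := grads f (x (k + 1) ω) - grads f (x k ω) with hw
  set e := sarahGradPrev f (fun j => x j ω) (fun j => I j ω) (fun j => c j ω) (k + 1)
    - avgGrad f (x k ω) with he
  refine (sum_coinWeight_le hm (B := fun _ => 0)
    (C := fun a => ‖batchMean w a - mean w + e‖ ^ 2) (fun a ha => ?_) fun a ha => ?_).trans ?_
  · have hc : c (k + 1) (s (a, true)) = true := congrArg Prod.snd (hω _ ha).2
    simp [sarahGradPrev, hc]
  · have hc : c (k + 1) (s (a, false)) = false := congrArg Prod.snd (hω _ ha).2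
    have hI : I (k + 1) (s (a, false)) = a := congrArg Prod.fst (hω _ ha).2
    have e1 := hx.adapted (k + 1) _ _ (hω _ ha).1
    have e2 := ((hx.adapted k).mono k.le_succ) _ _ (hω _ ha).1
    have e3 := hx.adapted_grad k _ _ (hω _ ha).1
    simp only at e3
    rw [sarahGradPrev_sub hf _ _ _ (k + 1) hc]
    simp only [prev, hI, e1, e2, e3]
    exact le_rfl
  · rw [batch_variance_add hn hb]
    simp only [mul_zero, Finset.sum_const_zero, zero_add]
    have h1 := (spread_le_msq hn w).trans (hf.msq_grads_sub_le (x (k + 1) ω) (x k ω))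
    calc _ ≤ (1 - 1 / (m : ℝ)) * (1 / (b : ℝ) * (L ^ 2 * ‖x (k + 1) ω - x k ω‖ ^ 2) + ‖e‖ ^ 2) := by
          gcongr
      _ = _ := by ring

lemma sarah_ae_convergence (hn : 0 < n) (hb : 0 < b) (hm : 0 < m) (hf : BasicAssumption f r L)
    (hs : IsSurrogate r u) (hu : SurrogateAssumption r u) (hμ : L / 2 < μ)
    (hcond : 0 < (2 * μ - L) ^ 2
      - 4 * (L ^ 2 / b + ((m : ℝ) - 1) * L ^ 2 / (m * b) / (1 / (m : ℝ))))
    (hsamp : IsBatchCoinSampling P m I c)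
    (hrun : ∀ ω, IsRun .sarah f u μ x0 (fun k => I k ω) (fun k => c k ω) (fun k => x k ω)) :
    (∀ᵐ ω ∂P, ∃ l : ℝ, Tendsto (fun k => objective f r (x k ω)) atTop (𝓝 (l : EReal))) ∧
    (∀ᵐ ω ∂P, Summable (fun k => ‖x (k + 1) ω - x k ω‖ ^ 2) ∧
      Tendsto (fun k => ‖x (k + 1) ω - x k ω‖ ^ 2) atTop (𝓝 0)) ∧
    (∀ᵐ ω ∂P, ∀ xs : EuclideanSpace ℝ (Fin d),
      (∃ φ : ℕ → ℕ, StrictMono φ ∧ Tendsto (fun j => x (φ j) ω) atTop (𝓝 xs)) →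
      IsStationary (objective f r) xs) := by
  have hL := hf.pos
  have hm1 : (1 : ℝ) ≤ m := by exact_mod_cast hm
  have hm' := one_sub_inv_nonneg hm
  have hm2 : 1 - 1 / (m : ℝ) ≤ 1 := by
    have : 0 ≤ 1 / (m : ℝ) := by positivity
    linarith
  have hx : IsProcess u μ (fun k ω => (I k ω, c k ω)) x
      (fun k ω => sarahGradPrev f (fun j => x j ω) (fun j => I j ω) (fun j => c j ω) (k + 1)) :=
    isProcess_of_step hs hu (by linarith) (fun ω => (hrun ω).1) (fun k ω => (hrun ω).2 k)
      fun k ω ω' hω hxω => sarahGradPrev_succ_congr hxω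
        (fun j hj => congrArg Prod.fst (hω j hj)) (fun j hj => congrArg Prod.snd (hω j hj))
  obtain ⟨c₀, hc₀⟩ := hx.exists_le_integral hsamp.isDraws hf hs
  set ε : ℕ → ℝ := fun k => ∫ ω, ‖sarahGradPrev f (fun j => x j ω) (fun j => I j ω)
    (fun j => c j ω) (k + 1) - avgGrad f (x k ω)‖ ^ 2 ∂P with hε
  set D : ℕ → ℝ := fun k => ∫ ω, ‖x (k + 1) ω - x k ω‖ ^ 2 ∂P with hD
  have hε0 : ∀ k, 0 ≤ ε k := fun k => integral_nonneg fun ω => by positivity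
  have hD0 : ∀ k, 0 ≤ D k := fun k => integral_nonneg fun ω => by positivity
  have herr : ∀ k, ε (k + 1) ≤ (1 - 1 / (m : ℝ)) * ε k + (1 - 1 / (m : ℝ)) * (L ^ 2 / b) * D k :=
    fun k => sarah_error_le hn hb hm hf hsamp hx k
  have herr' : ∀ k, ε (k + 1) ≤ (1 - 1 / (m : ℝ)) * ε k + L ^ 2 / b * D k := fun k => by
    have h1 : (1 - 1 / (m : ℝ)) * (L ^ 2 / b) * D k ≤ 1 * (L ^ 2 / b) * D k := by
      have := hD0 k
      gcongr
    linarith [herr k]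
  obtain ⟨h1, h2⟩ := summable_of_variance_reduction (s := μ - L / 2) (ρ := 1 / (m : ℝ))
    (V := L ^ 2 / b) (V₁ := 0) (V₂ := ((m : ℝ) - 1) * L ^ 2 / (m * b)) (by linarith)
    (by positivity) (by positivity) le_rfl
    (by have : 0 ≤ (m : ℝ) - 1 := by linarith
        positivity)
    (F := fun k => ∫ ω, objReal f r (x k ω) ∂P) hc₀ hD0
    -- The memory is the part of the previous error that survives the coin. The truncated index at k
    -- = 0 is harmless: the recursions begin at index 1.
    (y := fun k => (1 - 1 / (m : ℝ)) * ε (k - 1))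
    (fun k => mul_nonneg hm' (hε0 _)) hε0
    (fun k => hx.integral_step hsamp.isDraws hn hf hs hu hμ k)
    herr'
    (fun k => by
      have h := mul_le_mul_of_nonneg_left (herr' k) hm'
      have e : (1 - 1 / (m : ℝ)) * (L ^ 2 / b) = ((m : ℝ) - 1) * L ^ 2 / (m * b) := by
        have : (m : ℝ) ≠ 0 := by positivity
        have : (b : ℝ) ≠ 0 := by positivity
        field_simp
      have h2 : (1 - 1 / (m : ℝ)) * ((1 - 1 / (m : ℝ)) * ε k + L ^ 2 / b * D k)
          = (1 - 1 / (m : ℝ)) * ((1 - 1 / (m : ℝ)) * ε k)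
            + ((m : ℝ) - 1) * L ^ 2 / (m * b) * D k := by rw [← e]; ring
      simp only [Nat.add_sub_cancel, show k + 2 - 1 = k + 1 from rfl]
      linarith)
    (by rw [zero_add]; nlinarith)
  exact hx.ae_convergence hsamp.isDraws hn hf hs hu hμ h1 h2

end SARAH

end Coin

/-! ### Symmetrization over pairs of batches. -/

section Pairs

variable {V A : Type*} [NormedAddCommGroup V] [InnerProductSpace ℝ V] [Fintype A]

/-- The mixed terms vanish because `e` sums to zero, leaving two equal diagonal contributions. -/
lemma sum_sum_inner_sub (e y : A → V) (he : ∑ a, e a = 0) :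
    ∑ a, ∑ a', inner ℝ (e a - e a') (y a - y a')
      = 2 * (Fintype.card A : ℝ) * ∑ a, inner ℝ (e a) (y a) := by
  have h1 : ∑ a, ∑ a', inner ℝ (e a) (y a') = 0 := by
    rw [Finset.sum_comm]
    simp [← sum_inner, he]
  have h2 : ∑ a, ∑ a', inner ℝ (e a') (y a) = 0 := by
    simp [← sum_inner, he]
  simp only [inner_sub_left, inner_sub_right, Finset.sum_sub_distrib, h1, h2, Finset.sum_const,
    Finset.card_univ, nsmul_eq_mul, ← Finset.mul_sum]
  ring

/-- A symmetrization argument. -/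
lemma neg_sum_inner_le [Nonempty A] {μ : ℝ} (e y : A → V) (he : ∑ a, e a = 0)
    (h : ∀ a a', - inner ℝ (e a - e a') (y a - y a') ≤ ‖e a - e a'‖ ^ 2 / μ) :
    - ∑ a, inner ℝ (e a) (y a) ≤ (∑ a, ‖e a‖ ^ 2) / μ := by
  have h1 : ∑ a, ∑ a', - inner ℝ (e a - e a') (y a - y a')
      ≤ ∑ a, ∑ a', ‖e a - e a'‖ ^ 2 / μ :=
    Finset.sum_le_sum fun a _ => Finset.sum_le_sum fun a' _ => h a a'
  have h2 := sum_sum_inner_sub e y he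
  have h3 := sum_sum_inner_sub e e he
  simp only [real_inner_self_eq_norm_sq] at h3
  simp only [Finset.sum_neg_distrib, ← Finset.sum_div, h2, h3] at h1
  have hc : (0 : ℝ) < 2 * Fintype.card A := by
    have : 0 < Fintype.card A := Fintype.card_pos
    positivity
  rw [mul_div_assoc, ← mul_neg] at h1
  exact le_of_mul_le_mul_left h1 hc

end Pairs

/-- Parameters of a Lyapunov function for SAGA. The numbers `q` and `g` describe how much of the
memory survives one step, `b` is the size of the batches, and `ν` bounds the proximal parameter. -/
def HasLyapunov (q g b ν : ℝ) : Prop :=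
  ∃ θ h κ₁ κ₂ α β a m : ℝ, 0 ≤ θ ∧ θ ≤ 1 ∧ 0 < h ∧ a = m + θ / (2 * h) ∧
    m + (1 - θ) / 2 + θ * (h / 6 + 1 / (2 * h)) ≤ ν ∧
    0 < κ₁ ∧ κ₁ < a ∧ κ₁ * a ≤ α * (a - κ₁) ∧
    0 < κ₂ ∧ κ₂ < m ∧ κ₂ * m ≤ β * (m - κ₂) ∧ β ≤ α ∧
    α * q - (α - β) * g + 1 / (b * ν) ≤ κ₁ ∧ α * q - (α - β) * g ≤ κ₂

/-! ### The Lyapunov function of MM-SAGA. -/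

section Saga

variable {d n b : ℕ} {f : Fin n → EuclideanSpace ℝ (Fin d) → ℝ}
  {r : EuclideanSpace ℝ (Fin d) → EReal}
  {u : EuclideanSpace ℝ (Fin d) → EuclideanSpace ℝ (Fin d) → EReal} {L μ : ℝ}

/-- All `X a` solve the same subproblem up to the linear term, so monotonicity applies to every pair
of batches; symmetrization then leaves the batch variance divided by μ. -/
lemma batch_neg_inner_le (hn : 0 < n) (hb : 0 < b) (hs : IsSurrogate r u)
    (hu : SurrogateAssumption r u) (hμ : 0 < μ) {x p : EuclideanSpace ℝ (Fin d)}
    {w : Fin n → EuclideanSpace ℝ (Fin d)} {X : (Fin b → Fin n) → EuclideanSpace ℝ (Fin d)}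
    (hX : ∀ a, IsArgmin (proxObj μ x (batchMean w a - mean w + p) (fun z => u z x)) (X a)) :
    - ∑ a, (1 / (n : ℝ)) ^ b * inner ℝ (batchMean w a - mean w) (X a - x)
      ≤ 1 / (b * μ) * spread w := by
  have : Nonempty (Fin b → Fin n) := ⟨fun _ => ⟨0, hn⟩⟩
  have h1 := neg_sum_inner_le (μ := μ) (fun a : Fin b → Fin n => batchMean w a - mean w)
    (fun a => X a - x) (sum_batchMean_sub_mean hn hb w) fun a a' => by
      have := IsArgmin.neg_inner_le hμ (hu.convex_left x) (fun z => hs.ne_bot z x) (hX a) (hX a')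
      simpa using this
  have h2 := batch_variance hn hb w
  rw [← Finset.mul_sum] at h2 ⊢
  have hp : (0 : ℝ) < (1 / (n : ℝ)) ^ b := by positivity
  calc _ = (1 / (n : ℝ)) ^ b * - ∑ a, inner ℝ (batchMean w a - mean w) (X a - x) := by ring
    _ ≤ (1 / (n : ℝ)) ^ b * ((∑ a, ‖batchMean w a - mean w‖ ^ 2) / μ) := by gcongr
    _ = ((1 / (n : ℝ)) ^ b * ∑ a, ‖batchMean w a - mean w‖ ^ 2) / μ := by ring
    _ = _ := by rw [h2]; field_simp

/-- A descent lemma which interpolates between the two available ones. -/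
lemma BasicAssumption.descent_mixed (hn : 0 < n) (hf : BasicAssumption f r L) {θ h : ℝ}
    (h0 : 0 ≤ θ) (h1 : θ ≤ 1) (hh : 0 < h) (x v : EuclideanSpace ℝ (Fin d)) :
    avg f (x + v) ≤ avg f x + inner ℝ (avgGrad f x) v
      + L * ((1 - θ) / 2 + θ * (h / 6 + 1 / (2 * h))) * ‖v‖ ^ 2
      - θ / (2 * h) / L * spread (grads f (x + v) - grads f x) := by
  have hL := hf.pos
  have a1 := mul_le_mul_of_nonneg_left (hf.descent hn x v) (sub_nonneg.2 h1)
  have a2 := mul_le_mul_of_nonneg_left (hf.descent_spread hn hh x v) h0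
  have e : θ * (avg f x + inner ℝ (avgGrad f x) v + L * (h / 6) * ‖v‖ ^ 2
      + (L ^ 2 * ‖v‖ ^ 2 - spread (grads f (x + v) - grads f x)) / (2 * h * L))
      = θ * (avg f x + inner ℝ (avgGrad f x) v) + L * (θ * (h / 6 + 1 / (2 * h))) * ‖v‖ ^ 2
        - θ / (2 * h) / L * spread (grads f (x + v) - grads f x) := by
    field_simp; ring
  rw [e] at a2
  linarith

/-- The Lyapunov function of SAGA. -/
def sagaLyapunov (f : Fin n → EuclideanSpace ℝ (Fin d) → ℝ)
    (r : EuclideanSpace ℝ (Fin d) → EReal) (L κ₁ κ₂ : ℝ) (x : EuclideanSpace ℝ (Fin d))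
    (w : Fin n → EuclideanSpace ℝ (Fin d)) : ℝ :=
  objReal f r x + κ₁ / L * spread w + κ₂ / L * ‖mean w‖ ^ 2

/-- This explains the conditions in `HasLyapunov`. Young's inequality splits z + δ in its spread
(weights α, a) and in its mean (weights β, m). The increment δ then costs m · msq δ plus θ/(2h) ·
spread δ: the second part is exactly the gain in `BasicAssumption.descent_mixed`, the first is at
most m L²‖p - x‖². The noise term is kept for averaging. -/
lemma sagaLyapunov_pathwise (hn : 0 < n) (hf : BasicAssumption f r L) (hs : IsSurrogate r u)
    (hu : SurrogateAssumption r u) (hμ : 0 ≤ μ) {θ h κ₁ κ₂ α β a m ν : ℝ}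
    (hθ0 : 0 ≤ θ) (hθ1 : θ ≤ 1) (hh : 0 < h) (ha : a = m + θ / (2 * h))
    (hν : m + (1 - θ) / 2 + θ * (h / 6 + 1 / (2 * h)) ≤ ν)
    (hκ₁ : 0 < κ₁) (hκ₁a : κ₁ < a) (hα : κ₁ * a ≤ α * (a - κ₁))
    (hκ₂ : 0 < κ₂) (hκ₂m : κ₂ < m) (hβ : κ₂ * m ≤ β * (m - κ₂))
    {x e p : EuclideanSpace ℝ (Fin d)} (hx : r x ≠ ⊤)
    (hp : IsArgmin (proxObj μ x (e + avgGrad f x) (fun z => u z x)) p)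
    (z : Fin n → EuclideanSpace ℝ (Fin d)) :
    sagaLyapunov f r L κ₁ κ₂ p (z + (grads f p - grads f x)) + (μ - L * ν) * ‖p - x‖ ^ 2
      ≤ objReal f r x - inner ℝ e (p - x)
        + (α / L * msq z - (α - β) / L * ‖mean z‖ ^ 2) := by
  have hL := hf.pos
  have h1 := prox_step hf hs hu hμ hx hp
  have h2 := hf.descent_mixed hn hθ0 hθ1 hh x (p - x)
  rw [add_sub_cancel] at h2
  set δ := grads f p - grads f x with hδ
  have h3 := mul_spread_add_le hκ₁ hκ₁a hα z δ
  have h4 := mul_norm_add_sq_le hκ₂ hκ₂m hβ (mean z) (mean δ)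
  rw [← mean_add] at h4
  have h5 := hf.msq_grads_sub_le p x
  have h6 := msq_eq_spread_add hn δ
  have h7 := msq_eq_spread_add hn z
  have hm : 0 ≤ m := by linarith
  have h8 : κ₁ * spread (z + δ) + κ₂ * ‖mean (z + δ)‖ ^ 2
      ≤ α * msq z - (α - β) * ‖mean z‖ ^ 2 + θ / (2 * h) * spread δ
        + m * (L ^ 2 * ‖p - x‖ ^ 2) := by
    have := mul_le_mul_of_nonneg_left h5 hm
    rw [← hδ, h6] at this
    rw [h7]
    rw [ha] at h3
    linarith
  have h9 := div_le_div_of_nonneg_right h8 hL.le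
  have e1 : (κ₁ * spread (z + δ) + κ₂ * ‖mean (z + δ)‖ ^ 2) / L
      = κ₁ / L * spread (z + δ) + κ₂ / L * ‖mean (z + δ)‖ ^ 2 := by ring
  have e2 : (α * msq z - (α - β) * ‖mean z‖ ^ 2 + θ / (2 * h) * spread δ
        + m * (L ^ 2 * ‖p - x‖ ^ 2)) / L
      = α / L * msq z - (α - β) / L * ‖mean z‖ ^ 2 + θ / (2 * h) / L * spread δ
        + L * m * ‖p - x‖ ^ 2 := by
    field_simp
  rw [e1, e2] at h9
  have h10 : L * (m + (1 - θ) / 2 + θ * (h / 6 + 1 / (2 * h))) * ‖p - x‖ ^ 2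
      ≤ L * ν * ‖p - x‖ ^ 2 := by gcongr
  rw [inner_add_left] at h1
  rw [sagaLyapunov, objReal, objReal]
  linarith

/-- On average `unseen` multiplies msq by q and leaves at least g · msq for the squared mean, while
the noise costs at most 1/(bν) on the spread alone. Comparing coefficients of spread and squared
mean gives the last two conditions in `HasLyapunov`. -/
lemma sagaLyapunov_step (hn : 0 < n) (hb : 0 < b) (hf : BasicAssumption f r L)
    (hs : IsSurrogate r u) (hu : SurrogateAssumption r u) {θ h κ₁ κ₂ α β a m ν q g : ℝ}
    (hν0 : 0 < ν) (hμν : L * ν ≤ μ)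
    (hθ0 : 0 ≤ θ) (hθ1 : θ ≤ 1) (hh : 0 < h) (ha : a = m + θ / (2 * h))
    (hν : m + (1 - θ) / 2 + θ * (h / 6 + 1 / (2 * h)) ≤ ν)
    (hκ₁ : 0 < κ₁) (hκ₁a : κ₁ < a) (hα : κ₁ * a ≤ α * (a - κ₁))
    (hκ₂ : 0 < κ₂) (hκ₂m : κ₂ < m) (hβ : κ₂ * m ≤ β * (m - κ₂)) (hαβ : β ≤ α)
    (h1 : α * q - (α - β) * g + 1 / (b * ν) ≤ κ₁) (h2 : α * q - (α - β) * g ≤ κ₂)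
    (hq : q = (1 - 1 / (n : ℝ)) ^ b)
    (hg : ∀ w : Fin n → EuclideanSpace ℝ (Fin d),
      g * msq w ≤ ∑ a : Fin b → Fin n, (1 / (n : ℝ)) ^ b * ‖mean (unseen w a)‖ ^ 2)
    {x : EuclideanSpace ℝ (Fin d)} {w : Fin n → EuclideanSpace ℝ (Fin d)}
    {X : (Fin b → Fin n) → EuclideanSpace ℝ (Fin d)} (hx : r x ≠ ⊤)
    (hX : ∀ a, IsArgmin (proxObj μ x (batchMean w a - mean w + avgGrad f x) (fun z => u z x))
      (X a)) :
    ∑ a, (1 / (n : ℝ)) ^ b * (sagaLyapunov f r L κ₁ κ₂ (X a)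
        (unseen w a + (grads f (X a) - grads f x)) + (μ - L * ν) * ‖X a - x‖ ^ 2)
      ≤ sagaLyapunov f r L κ₁ κ₂ x w := by
  have hL := hf.pos
  have hμ : 0 < μ := lt_of_lt_of_le (mul_pos hL hν0) hμν
  have s1 : ∑ a, (1 / (n : ℝ)) ^ b * (sagaLyapunov f r L κ₁ κ₂ (X a)
        (unseen w a + (grads f (X a) - grads f x)) + (μ - L * ν) * ‖X a - x‖ ^ 2)
      ≤ ∑ a, (1 / (n : ℝ)) ^ b * (objReal f r x - inner ℝ (batchMean w a - mean w) (X a - x)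
        + (α / L * msq (unseen w a) - (α - β) / L * ‖mean (unseen w a)‖ ^ 2)) :=
    Finset.sum_le_sum fun a _ => mul_le_mul_of_nonneg_left
      (sagaLyapunov_pathwise hn hf hs hu hμ.le hθ0 hθ1 hh ha hν hκ₁ hκ₁a hα hκ₂ hκ₂m hβ hx (hX a)
        (unseen w a)) (by positivity)
  have s2 : ∑ a, (1 / (n : ℝ)) ^ b * (objReal f r x - inner ℝ (batchMean w a - mean w) (X a - x)
        + (α / L * msq (unseen w a) - (α - β) / L * ‖mean (unseen w a)‖ ^ 2))
      = objReal f r x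
        + - ∑ a, (1 / (n : ℝ)) ^ b * inner ℝ (batchMean w a - mean w) (X a - x)
        + α / L * ∑ a : Fin b → Fin n, (1 / (n : ℝ)) ^ b * msq (unseen w a)
        - (α - β) / L * ∑ a : Fin b → Fin n, (1 / (n : ℝ)) ^ b * ‖mean (unseen w a)‖ ^ 2 := by
    have e0 : objReal f r x = ∑ _a : Fin b → Fin n, (1 / (n : ℝ)) ^ b * objReal f r x := by
      rw [← Finset.sum_mul, batch_weights_sum hn, one_mul]
    conv_rhs => rw [e0]
    rw [Finset.mul_sum, Finset.mul_sum, ← Finset.sum_neg_distrib, ← Finset.sum_add_distrib,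
      ← Finset.sum_add_distrib, ← Finset.sum_sub_distrib]
    exact Finset.sum_congr rfl fun a _ => by ring
  have s3 := batch_neg_inner_le hn hb hs hu hμ hX
  have s4 := batch_msq_unseen (b := b) hn w
  rw [s2, s4, ← hq] at s1
  have s5 := mul_le_mul_of_nonneg_left (hg w) (div_nonneg (sub_nonneg.2 hαβ) hL.le)
  have s6 : 1 / (b * μ) * spread w ≤ 1 / (b * ν) / L * spread w := by
    have hb' : (0 : ℝ) < b := by positivity
    have : 1 / (b * μ) ≤ 1 / (b * ν) / L := by
      rw [div_div]
      exact one_div_le_one_div_of_le (by positivity) (by nlinarith)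
    exact mul_le_mul_of_nonneg_right this (spread_nonneg w)
  have s7 := msq_eq_spread_add hn w
  have s8 := mul_le_mul_of_nonneg_right (div_le_div_of_nonneg_right h1 hL.le) (spread_nonneg w)
  have s9 := mul_le_mul_of_nonneg_right (div_le_div_of_nonneg_right h2 hL.le)
    (sq_nonneg ‖mean w‖)
  have s10 : α / L * (q * msq w) - (α - β) / L * (g * msq w)
      = (α * q - (α - β) * g) / L * spread w + (α * q - (α - β) * g) / L * ‖mean w‖ ^ 2 := by
    rw [s7]; ring
  have s11 : (α * q - (α - β) * g + 1 / (b * ν)) / L * spread w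
      = (α * q - (α - β) * g) / L * spread w + 1 / (b * ν) / L * spread w := by ring
  rw [sagaLyapunov]
  linarith

end Saga

/-! ### MM-SAGA as a random process. -/

section SagaProcess

variable {Ω : Type*} [MeasurableSpace Ω] {P : Measure Ω} [IsProbabilityMeasure P]
  {d n b : ℕ} {f : Fin n → EuclideanSpace ℝ (Fin d) → ℝ}
  {r : EuclideanSpace ℝ (Fin d) → EReal}
  {u : EuclideanSpace ℝ (Fin d) → EuclideanSpace ℝ (Fin d) → EReal} {L μ : ℝ}
  {x : ℕ → Ω → EuclideanSpace ℝ (Fin d)} {x0 : EuclideanSpace ℝ (Fin d)}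
  {I : ℕ → Ω → Fin b → Fin n} {c : ℕ → Ω → Bool}

lemma IsBatchSampling.isDraws (h : IsBatchSampling P I) :
    IsDraws P (fun _ : Fin b → Fin n => (1 / (n : ℝ)) ^ b) I :=
  ⟨h.measurable, h.indep, h.law⟩

/-- The deviation of the table of gradients from the current gradients. -/
def sagaDev (f : Fin n → EuclideanSpace ℝ (Fin d) → ℝ) (x : ℕ → EuclideanSpace ℝ (Fin d))
    (I : ℕ → Fin b → Fin n) (k : ℕ) (i : Fin n) : EuclideanSpace ℝ (Fin d) :=
  gradient (f i) (x k) - gradient (f i) (sagaTable x I k i)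

/-- Replacing a table entry by the current gradient sets its deviation to zero; then every deviation
moves by the gradient increment. -/
lemma sagaDev_succ (x : ℕ → EuclideanSpace ℝ (Fin d)) (I : ℕ → Fin b → Fin n) (k : ℕ) :
    sagaDev f x I (k + 1) = unseen (sagaDev f x I k) (I k)
      + (grads f (x (k + 1)) - grads f (x k)) := by
  funext i
  simp only [sagaDev, sagaTable, unseen, Pi.add_apply, Pi.sub_apply, grads]
  split_ifs <;> abel

lemma sagaGrad_eq (hf : BasicAssumption f r L) (x : ℕ → EuclideanSpace ℝ (Fin d))
    (I : ℕ → Fin b → Fin n) (k : ℕ) :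
    sagaGrad f x I k = batchMean (sagaDev f x I k) (I k) - mean (sagaDev f x I k)
      + avgGrad f (x k) := by
  have : sagaDev f x I k
      = grads f (x k) - fun i => gradient (f i) (sagaTable x I k i) := rfl
  have h2 : mean (sagaDev f x I k) = avgGrad f (x k)
      - (1 / (n : ℝ)) • ∑ i, gradient (f i) (sagaTable x I k i) := by
    rw [this, mean_sub, hf.avgGrad_eq]; rfl
  rw [h2, sagaGrad, batchMean]
  simp only [sagaDev]
  abel

lemma adapted_sagaDev
    (hx : IsProcess u μ I x (fun k ω => sagaGrad f (fun j => x j ω) (fun j => I j ω) k)) (k : ℕ) :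
    DependsOnDraws I k (fun ω => sagaDev f (fun j => x j ω) (fun j => I j ω) k) := by
  intro ω ω' hω
  have h1 := sagaTable_congr (x := fun j => x j ω) (x' := fun j => x j ω') (k := k)
    (I := fun j => I j ω) (I' := fun j => I j ω')
    (fun j hj => hx.adapted j ω ω' fun i hi => hω i (by omega)) hω
  funext i
  simp only [sagaDev, h1, hx.adapted k ω ω' hω]

end SagaProcess

/-! ### Convergence of MM-SAGA, given admissible Lyapunov parameters. -/

section SagaConvergence

variable {Ω : Type*} [MeasurableSpace Ω] {P : Measure Ω} [IsProbabilityMeasure P]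
  {d n b : ℕ} {f : Fin n → EuclideanSpace ℝ (Fin d) → ℝ}
  {r : EuclideanSpace ℝ (Fin d) → EReal}
  {u : EuclideanSpace ℝ (Fin d) → EuclideanSpace ℝ (Fin d) → EReal} {L μ : ℝ}
  {x : ℕ → Ω → EuclideanSpace ℝ (Fin d)} {x0 : EuclideanSpace ℝ (Fin d)}
  {I : ℕ → Ω → Fin b → Fin n} {c : ℕ → Ω → Bool}

lemma saga_summable_steps (hn : 0 < n) (hb : 0 < b) (hf : BasicAssumption f r L)
    (hs : IsSurrogate r u) (hu : SurrogateAssumption r u) {ν g : ℝ} (hν0 : 0 < ν)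
    (hμν : L * ν < μ) (hlyap : HasLyapunov ((1 - 1 / (n : ℝ)) ^ b) g b ν)
    (hg : ∀ w : Fin n → EuclideanSpace ℝ (Fin d),
      g * msq w ≤ ∑ a : Fin b → Fin n, (1 / (n : ℝ)) ^ b * ‖mean (unseen w a)‖ ^ 2)
    (hsamp : IsBatchSampling P I)
    (hx : IsProcess u μ I x (fun k ω => sagaGrad f (fun j => x j ω) (fun j => I j ω) k)) :
    Summable fun k => ∫ ω, ‖x (k + 1) ω - x k ω‖ ^ 2 ∂P := by
  obtain ⟨θ, h, κ₁, κ₂, α, β, a, m, hθ0, hθ1, hh, ha, hν, hκ₁, hκ₁a, hα, hκ₂, hκ₂m, hβ, hαβ, h1,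
    h2⟩ := hlyap
  have hL := hf.pos
  obtain ⟨c₀, hc₀⟩ := hx.exists_le_integral hsamp.isDraws hf hs
  have dF : ∀ k, DependsOnDraws I k (fun ω => sagaLyapunov f r L κ₁ κ₂ (x k ω)
      (sagaDev f (fun j => x j ω) (fun j => I j ω) k)) := fun k =>
    (hx.adapted k).comp₂ (adapted_sagaDev hx k) fun y w => sagaLyapunov f r L κ₁ κ₂ y w
  have dD := fun k => (hx.adapted_sub k).comp fun t => (μ - L * ν) * t
  refine summable_of_descent (F := fun k => ∫ ω, sagaLyapunov f r L κ₁ κ₂ (x k ω)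
      (sagaDev f (fun j => x j ω) (fun j => I j ω) k) ∂P) (c := c₀) (sub_pos.2 hμν)
    (fun k => (hc₀ k).trans ?_) (fun k => integral_nonneg fun ω => by positivity) fun k => ?_
  · refine integral_mono ((hx.adapted_obj (k + 1)).integrable hsamp.isDraws)
      ((dF (k + 1)).integrable hsamp.isDraws) fun ω => ?_
    have := spread_nonneg (sagaDev f (fun j => x j ω) (fun j => I j ω) (k + 1))
    simp only [sagaLyapunov]
    have e1 : 0 ≤ κ₁ / L * spread (sagaDev f (fun j => x j ω) (fun j => I j ω) (k + 1)) := by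
      positivity
    have e2 : 0 ≤ κ₂ / L * ‖mean (sagaDev f (fun j => x j ω) (fun j => I j ω) (k + 1))‖ ^ 2 := by
      positivity
    linarith
  · show _ + (μ - L * ν) * _ ≤ _
    rw [← integral_const_mul, ← integral_add ((dF (k + 2)).integrable hsamp.isDraws)
      ((dD (k + 1)).integrable hsamp.isDraws)]
    refine integral_le_of_step hsamp.isDraws (dF (k + 1)) ((dF (k + 2)).comp₂ (dD (k + 1))
      fun s t => s + t) fun ω s hω => ?_
    have hω' : ∀ a, (∀ j < k + 1, I j (s a) = I j ω) ∧ I (k + 1) (s a) = a := fun a =>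
      hω a (by positivity)
    have e1 : ∀ a, x (k + 1) (s a) = x (k + 1) ω := fun a => hx.adapted _ _ _ (hω' a).1
    have e2 : ∀ a, sagaDev f (fun j => x j (s a)) (fun j => I j (s a)) (k + 1)
        = sagaDev f (fun j => x j ω) (fun j => I j ω) (k + 1) := fun a =>
      adapted_sagaDev hx _ _ _ (hω' a).1
    have key := sagaLyapunov_step hn hb hf hs hu hν0 hμν.le hθ0 hθ1 hh ha hν hκ₁ hκ₁a hα hκ₂ hκ₂m hβ
      hαβ h1 h2 rfl hg (hx.ne_top hs k ω) (X := fun a => x (k + 2) (s a))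
      (w := sagaDev f (fun j => x j ω) (fun j => I j ω) (k + 1)) fun a => by
        have := hx.step (k + 1) (s a)
        rw [sagaGrad_eq hf] at this
        simp only [e1, e2, (hω' a).2] at this
        exact this
    refine le_trans (le_of_eq (Finset.sum_congr rfl fun a _ => ?_)) key
    rw [sagaDev_succ]
    simp only [e1, e2, (hω' a).2]

lemma saga_error_le (hn : 0 < n) (hb : 0 < b) (hf : BasicAssumption f r L)
    (hsamp : IsBatchSampling P I)
    (hx : IsProcess u μ I x (fun k ω => sagaGrad f (fun j => x j ω) (fun j => I j ω) k)) (k : ℕ) :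
    ∫ ω, ‖sagaGrad f (fun j => x j ω) (fun j => I j ω) k - avgGrad f (x k ω)‖ ^ 2 ∂P
      ≤ 1 / (b : ℝ) * ∫ ω, msq (sagaDev f (fun j => x j ω) (fun j => I j ω) k) ∂P := by
  rw [← integral_const_mul]
  refine integral_le_of_step hsamp.isDraws
    ((adapted_sagaDev hx k).comp fun w => 1 / (b : ℝ) * msq w) (hx.adapted_err k) fun ω s hω => ?_
  have hω' : ∀ a, (∀ j < k, I j (s a) = I j ω) ∧ I k (s a) = a := fun a => hω a (by positivity)
  set w := sagaDev f (fun j => x j ω) (fun j => I j ω) k with hw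
  have h1 : ∀ a, ‖sagaGrad f (fun j => x j (s a)) (fun j => I j (s a)) k
      - avgGrad f (x k (s a))‖ ^ 2 = ‖batchMean w a - mean w‖ ^ 2 := fun a => by
    rw [sagaGrad_eq hf, add_sub_cancel_right]
    simp only [(hω' a).2, adapted_sagaDev hx _ _ _ (hω' a).1, ← hw]
  simp only [h1]
  rw [batch_variance hn hb]
  have := spread_le_msq hn w
  gcongr

lemma saga_memory_le (hn : 0 < n) (hf : BasicAssumption f r L)
    (hsamp : IsBatchSampling P I)
    (hx : IsProcess u μ I x (fun k ω => sagaGrad f (fun j => x j ω) (fun j => I j ω) k))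
    {t : ℝ} (ht : 0 < t) (k : ℕ) :
    ∫ ω, msq (sagaDev f (fun j => x j ω) (fun j => I j ω) (k + 1)) ∂P
      ≤ (1 + t) * (1 - 1 / (n : ℝ)) ^ b
          * ∫ ω, msq (sagaDev f (fun j => x j ω) (fun j => I j ω) k) ∂P
        + (1 + 1 / t) * L ^ 2 * ∫ ω, ‖x (k + 1) ω - x k ω‖ ^ 2 ∂P := by
  have dw := fun k => (adapted_sagaDev hx k).comp fun w => msq w
  have dD := (hx.adapted_sub k).comp fun s => (1 + 1 / t) * L ^ 2 * s
  have key := integral_le_of_step hsamp.isDraws (k := k)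
    ((dw k).comp fun s => (1 + t) * (1 - 1 / (n : ℝ)) ^ b * s) ((dw (k + 1)).comp₂ dD
      fun p q => p - q) fun ω s hω => ?_
  · rw [integral_sub ((dw (k + 1)).integrable hsamp.isDraws) (dD.integrable hsamp.isDraws),
      integral_const_mul, integral_const_mul] at key
    linarith
  have hω' : ∀ a, (∀ j < k, I j (s a) = I j ω) ∧ I k (s a) = a := fun a => hω a (by positivity)
  set w := sagaDev f (fun j => x j ω) (fun j => I j ω) k with hw
  have h1 : ∀ a, msq (sagaDev f (fun j => x j (s a)) (fun j => I j (s a)) (k + 1))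
      - (1 + 1 / t) * L ^ 2 * ‖x (k + 1) (s a) - x k (s a)‖ ^ 2 ≤ (1 + t) * msq (unseen w a) := by
    intro a
    rw [sagaDev_succ]
    simp only [(hω' a).2, adapted_sagaDev hx _ _ _ (hω' a).1, ← hw]
    have h2 := mul_msq_add_le (k := 1) (al := 1 + t) (a := 1 + 1 / t) one_pos
      (by have : 0 < 1 / t := by positivity
          linarith)
      (le_of_eq (by field_simp; ring)) (unseen w a)
      (grads f (x (k + 1) (s a)) - grads f (x k (s a)))
    have h3 := mul_le_mul_of_nonneg_left (hf.msq_grads_sub_le (x (k + 1) (s a)) (x k (s a)))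
      (by positivity : 0 ≤ 1 + 1 / t)
    linarith
  calc _ ≤ ∑ a : Fin b → Fin n, (1 / (n : ℝ)) ^ b * ((1 + t) * msq (unseen w a)) :=
        Finset.sum_le_sum fun a _ => mul_le_mul_of_nonneg_left (h1 a) (by positivity)
    _ = (1 + t) * ∑ a : Fin b → Fin n, (1 / (n : ℝ)) ^ b * msq (unseen w a) := by
        rw [Finset.mul_sum]; exact Finset.sum_congr rfl fun a _ => by ring
    _ = _ := by rw [batch_msq_unseen hn, mul_assoc]

lemma one_sub_inv_pow_mem (hn : 0 < n) (hb : 0 < b) :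
    0 ≤ (1 - 1 / (n : ℝ)) ^ b ∧ (1 - 1 / (n : ℝ)) ^ b < 1 := by
  have h1 := one_sub_inv_nonneg hn
  have h2 : 0 < 1 / (n : ℝ) := by positivity
  exact ⟨pow_nonneg h1 _, pow_lt_one₀ h1 (by linarith) hb.ne'⟩

/-- Once the steps are summable, sharp constants no longer matter: any Young parameter that keeps
the memory contracting will do, here (1 - q)/2. -/
lemma saga_summable_error (hn : 0 < n) (hb : 0 < b) (hf : BasicAssumption f r L)
    (hsamp : IsBatchSampling P I)
    (hx : IsProcess u μ I x (fun k ω => sagaGrad f (fun j => x j ω) (fun j => I j ω) k))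
    (hD : Summable fun k => ∫ ω, ‖x (k + 1) ω - x k ω‖ ^ 2 ∂P) :
    Summable fun k =>
      ∫ ω, ‖sagaGrad f (fun j => x j ω) (fun j => I j ω) k - avgGrad f (x k ω)‖ ^ 2 ∂P := by
  obtain ⟨hq0, hq1⟩ := one_sub_inv_pow_mem hn hb
  set q := (1 - 1 / (n : ℝ)) ^ b with hq
  have ht : 0 < (1 - q) / 2 := by linarith
  have hy0 : ∀ k, 0 ≤ ∫ ω, msq (sagaDev f (fun j => x j ω) (fun j => I j ω) k) ∂P := fun k =>
    integral_nonneg fun ω => msq_nonneg _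
  have hy := summable_of_contraction (ρ := (1 - q) / 2) ht hy0
    (hD.mul_left ((1 + 1 / ((1 - q) / 2)) * L ^ 2))
    (fun k => mul_nonneg (by positivity) (integral_nonneg fun ω => by positivity)) fun k => by
      refine (saga_memory_le hn hf hsamp hx ht k).trans ?_
      rw [← hq]
      have : (1 + (1 - q) / 2) * q ≤ 1 - (1 - q) / 2 := by nlinarith
      have := mul_le_mul_of_nonneg_right this (hy0 k)
      linarith
  exact Summable.of_nonneg_of_le (fun k => integral_nonneg fun ω => by positivity)
    (saga_error_le hn hb hf hsamp hx) (hy.mul_left _)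

lemma saga_ae_convergence (hn : 0 < n) (hb : 0 < b) (hf : BasicAssumption f r L)
    (hs : IsSurrogate r u) (hu : SurrogateAssumption r u) (hμ : L / 2 < μ) {ν g : ℝ} (hν0 : 0 < ν)
    (hμν : L * ν < μ) (hlyap : HasLyapunov ((1 - 1 / (n : ℝ)) ^ b) g b ν)
    (hg : ∀ w : Fin n → EuclideanSpace ℝ (Fin d),
      g * msq w ≤ ∑ a : Fin b → Fin n, (1 / (n : ℝ)) ^ b * ‖mean (unseen w a)‖ ^ 2)
    (hsamp : IsBatchSampling P I)
    (hrun : ∀ ω, IsRun .saga f u μ x0 (fun k => I k ω) (fun k => c k ω) (fun k => x k ω)) :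
    (∀ᵐ ω ∂P, ∃ l : ℝ, Tendsto (fun k => objective f r (x k ω)) atTop (𝓝 (l : EReal))) ∧
    (∀ᵐ ω ∂P, Summable (fun k => ‖x (k + 1) ω - x k ω‖ ^ 2) ∧
      Tendsto (fun k => ‖x (k + 1) ω - x k ω‖ ^ 2) atTop (𝓝 0)) ∧
    (∀ᵐ ω ∂P, ∀ xs : EuclideanSpace ℝ (Fin d),
      (∃ φ : ℕ → ℕ, StrictMono φ ∧ Tendsto (fun j => x (φ j) ω) atTop (𝓝 xs)) →
      IsStationary (objective f r) xs) := by
  have hL := hf.pos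
  have hx : IsProcess u μ I x (fun k ω => sagaGrad f (fun j => x j ω) (fun j => I j ω) k) :=
    isProcess_of_step hs hu (by linarith) (fun ω => (hrun ω).1) (fun k ω => (hrun ω).2 k)
      fun k ω ω' hω hxω => sagaGrad_congr hxω hω
  have hD := saga_summable_steps hn hb hf hs hu hν0 hμν hlyap hg hsamp hx
  exact hx.ae_convergence hsamp.isDraws hn hf hs hu hμ hD
    (saga_summable_error hn hb hf hsamp hx hD)

end SagaConvergence

/-! ### Choice of the Lyapunov parameters. -/

section Parameters

lemma hasLyapunov_of_le {q g b ν H N w : ℝ} (hb : 0 < b) (hw0 : 0 < w) (hw1 : w < 1)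
    (hq : q ≤ w ^ 2) (hH : 0 < H) (hHb : 4 * H ^ 2 ≤ b) (hN : 0 < N)
    (hν : N - H ≤ (ν - 1 / 2) * √b)
    (hcond : 1 + H ^ 2 * (1 + w) * N ^ 2 * (1 - w) ^ 4 / 3 ≤ N ^ 2 * (1 - w) ^ 2) :
    HasLyapunov q g b ν := by
  set B := √b with hB
  have hB0 : 0 < B := Real.sqrt_pos.2 hb
  have hB2 : B * B = b := Real.mul_self_sqrt hb.le
  have hHB : 2 * H ≤ B := Real.le_sqrt_of_sq_le (by linarith)
  set Y := 1 - w with hY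
  have hY0 : 0 < Y := by linarith
  set A := 1 / (N * Y ^ 2) with hA
  have hA0 : 0 < A := by positivity
  have hAN : A + H ^ 2 * (1 + w) / (3 * A) ≤ N := by
    have e : A + H ^ 2 * (1 + w) / (3 * A)
        = (1 + H ^ 2 * (1 + w) * N ^ 2 * Y ^ 4 / 3) / (N * Y ^ 2) := by
      rw [hA]; field_simp
    rw [e, div_le_iff₀ (by positivity)]
    linarith
  have hνB : N ≤ ν * B := by linarith
  have hν0 : 0 < ν := pos_of_mul_pos_left (hN.trans_le hνB) hB0.le
  have hα0 : 0 ≤ A * Y / (w * B) := by positivity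
  have hX : A * Y / (w * B) * q ≤ A * w * Y / B := by
    calc _ ≤ A * Y / (w * B) * w ^ 2 := by gcongr
      _ = _ := by field_simp
  -- Here α = β, so `g` plays no role. Both Young conditions hold with equality; κ₁ - κ₂ = A(1 -
  -- w)²/B = 1/(N B) pays for the noise, and θ ≤ 1 is the condition 4H² ≤ b. The requirement on ν
  -- becomes A + H²(1 + w)/(3A) ≤ N, which is `hcond` after multiplication by N(1 - w)².
  refine ⟨2 * H / B, H * (1 + w) / A, A * Y / B, A * w * Y / B, A * Y / (w * B), A * Y / (w * B),
    A / B, A * w / ((1 + w) * B), by positivity, by rw [div_le_one hB0]; exact hHB, by positivity,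
    by field_simp; ring, ?_, by positivity, ?_, le_of_eq ?_, by positivity, ?_, le_of_eq ?_, le_rfl,
    ?_, ?_⟩
  · have e : A * w / ((1 + w) * B) + (1 - 2 * H / B) / 2
        + 2 * H / B * (H * (1 + w) / A / 6 + 1 / (2 * (H * (1 + w) / A)))
        = 1 / 2 + (A + H ^ 2 * (1 + w) / (3 * A) - H) / B := by
      field_simp; ring
    rw [e]
    have : (A + H ^ 2 * (1 + w) / (3 * A) - H) / B ≤ ν - 1 / 2 := by
      rw [div_le_iff₀ hB0]; linarith
    linarith
  · rw [div_lt_div_iff_of_pos_right hB0]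
    nlinarith
  · have : A / B - A * Y / B = A * w / B := by rw [hY]; ring
    rw [this]; field_simp
  · rw [div_lt_div_iff₀ hB0 (by positivity)]
    have : Y * (1 + w) < 1 := by rw [hY]; nlinarith
    nlinarith [mul_pos (mul_pos hA0 hw0) hB0]
  · have : A * w / ((1 + w) * B) - A * w * Y / B = A * w ^ 3 / ((1 + w) * B) := by
      rw [hY]; field_simp; ring
    rw [this]; field_simp
  · have e1 : A * Y / B - A * w * Y / B = 1 / (N * B) := by
      have : A * Y / B - A * w * Y / B = A * Y ^ 2 / B := by rw [hY]; ring
      rw [this, hA]; field_simp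
    have e2 : 1 / (b * ν) ≤ 1 / (N * B) :=
      one_div_le_one_div_of_le (by positivity) (by rw [← hB2]; nlinarith)
    rw [sub_self, zero_mul, sub_zero]
    linarith
  · rw [sub_self, zero_mul, sub_zero]; exact hX

/-- The parameter `w = 1 - t η`, expressed through the proportion `2 t` of sampled indices. -/
lemma hasLyapunov_of_ratio {q g b t η H : ℝ} (hb : 0 < b) (ht0 : 0 < t) (ht1 : t ≤ 1 / 2)
    (hη : 0 < η) (htη : t * η < 1) (hq : q ≤ (1 - t * η) ^ 2) (hH : 0 < H) (hHb : 4 * H ^ 2 ≤ b)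
    (hcond : 1 ≤ ((1 - t / 2 - 172 / 1000 * t ^ 2 + H * t) * η) ^ 2
      * (1 - H ^ 2 * (2 - t * η) * (t * η) ^ 2 / 3)) :
    HasLyapunov q g b (1 / 2 + √((1 - t) / (t ^ 2 * b))) := by
  have hp : 0 < 1 - t / 2 - 172 / 1000 * t ^ 2 := by nlinarith
  -- Here (ν - 1/2)√b = √(1 - t)/t, and 1 - t/2 - 0.172 t² is a lower bound of √(1 - t) on [0, 1/2],
  -- nearly attained at t = 1/2.
  refine hasLyapunov_of_le (w := 1 - t * η) (H := H)
    (N := (1 - t / 2 - 172 / 1000 * t ^ 2) / t + H) hb (by linarith)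
    (by have := mul_pos ht0 hη; linarith) hq hH hHb (by positivity) ?_ ?_
  · rw [add_sub_cancel_right, add_sub_cancel_left, ← Real.sqrt_mul (by
      have : 0 ≤ 1 - t := by linarith
      positivity)]
    refine Real.le_sqrt_of_sq_le ?_
    rw [div_pow]
    have e : (1 - t) / (t ^ 2 * b) * b = (1 - t) / t ^ 2 := by field_simp
    rw [e]
    gcongr
    nlinarith [mul_nonneg (mul_nonneg ht0.le ht0.le) (sub_nonneg.2 ht1), pow_pos ht0 3,
      mul_nonneg (pow_nonneg ht0.le 3) (sub_nonneg.2 ht1)]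
  · have e : ((1 - t / 2 - 172 / 1000 * t ^ 2) / t + H)
        = (1 - t / 2 - 172 / 1000 * t ^ 2 + H * t) / t := by field_simp
    rw [e, sub_sub_cancel]
    have e2 : ((1 - t / 2 - 172 / 1000 * t ^ 2 + H * t) / t) ^ 2 * (t * η) ^ 2
        = ((1 - t / 2 - 172 / 1000 * t ^ 2 + H * t) * η) ^ 2 := by field_simp
    have e3 : H ^ 2 * (1 + (1 - t * η)) * ((1 - t / 2 - 172 / 1000 * t ^ 2 + H * t) / t) ^ 2
        * (t * η) ^ 4 / 3 = ((1 - t / 2 - 172 / 1000 * t ^ 2 + H * t) * η) ^ 2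
          * (H ^ 2 * (2 - t * η) * (t * η) ^ 2 / 3) := by
      rw [← e2]; ring
    rw [e2, e3]
    linarith

end Parameters

/-! ### Verification for each batch size. -/

section BatchSizes

/-- Bernoulli's inequality with exponent b/k ≤ 1. It permits replacing b by a larger even k, whose
square root is a polynomial. -/
lemma one_sub_div_pow_le_pow {x : ℝ} {b k : ℕ} (hb : 0 < b) (hbk : b ≤ k) (hx : x ≤ b) :
    (1 - x / b) ^ b ≤ (1 - x / k) ^ k := by
  have hb' : (0 : ℝ) < b := by positivity
  have hk : 0 < k := hb.trans_le hbk
  have hk' : (0 : ℝ) < k := by positivity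
  have h0 : 0 ≤ 1 - x / b := by rw [sub_nonneg, div_le_one hb']; exact hx
  have hp : (b : ℝ) / k ≤ 1 := by rw [div_le_one hk']; exact_mod_cast hbk
  have h1 := rpow_one_add_le_one_add_mul_self (s := -(x / b)) (p := b / k) (by linarith)
    (by positivity) hp
  have h2 : 1 + (b : ℝ) / k * -(x / b) = 1 - x / k := by field_simp; ring
  rw [h2, ← sub_eq_add_neg] at h1
  calc (1 - x / b) ^ b = ((1 - x / b) ^ ((b : ℝ) / k)) ^ k := by
        rw [← Real.rpow_natCast _ k, ← Real.rpow_mul h0, div_mul_cancel₀ _ hk'.ne',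
          Real.rpow_natCast]
    _ ≤ _ := pow_le_pow_left₀ (Real.rpow_nonneg h0 _) h1 _

variable {t q g : ℝ}

/-- In the following lemmas the condition on t ∈ [0, T] is a polynomial inequality, certified as a
nonnegative combination of these Bernstein polynomials. Throughout, 1 - tη bounds √q from above to
low order, and `H` is √b/2 (for the smallest b allowed) rounded down. -/
lemma bernstein_nonneg {T : ℝ} (ht0 : 0 ≤ t) (ht1 : t ≤ T) (i j : ℕ) :
    0 ≤ t ^ i * (T - t) ^ j :=
  mul_nonneg (pow_nonneg ht0 _) (pow_nonneg (by linarith) _)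

lemma hasLyapunov_one (ht0 : 0 < t) (ht1 : t ≤ 1 / 2) (hq : q ≤ 1 - 2 * t) :
    HasLyapunov q g 1 (1 / 2 + √((1 - t) / (t ^ 2 * 1))) := by
  have h := bernstein_nonneg ht0.le ht1
  refine hasLyapunov_of_ratio (η := 1 + t / 2) (H := 1 / 2) one_pos ht0 ht1 (by linarith)
    (by nlinarith) ?_ (by norm_num) (by norm_num) ?_
  · nlinarith [h 3 0, h 4 0]
  · linarith [h 1 11, h 2 10, h 3 9, h 4 8, h 5 7, h 6 6, h 7 5, h 8 4, h 9 3, h 10 2, h 11 1,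
      h 12 0]

lemma hasLyapunov_two (ht0 : 0 < t) (ht1 : t ≤ 1 / 2) (hq : q ≤ (1 - 2 * t / 2) ^ 2) :
    HasLyapunov q g 2 (1 / 2 + √((1 - t) / (t ^ 2 * 2))) := by
  have h := bernstein_nonneg ht0.le ht1
  refine hasLyapunov_of_ratio (η := 1) (H := 7 / 10) two_pos ht0 ht1 one_pos
    (by linarith) (hq.trans_eq (by ring)) (by norm_num) (by norm_num) ?_
  linarith [h 1 6, h 2 5, h 3 4, h 4 3, h 5 2, h 6 1, h 7 0]

/-- With b = 3 the bound on t says n ≥ 4; the choice made here fails at t = 1/2, that is, for n = 3.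
-/
lemma hasLyapunov_three (ht0 : 0 < t) (ht1 : t ≤ 3 / 8) (hq : q ≤ (1 - 2 * t / 3) ^ 3) :
    HasLyapunov q g 3 (1 / 2 + √((1 - t) / (t ^ 2 * 3))) := by
  have h := bernstein_nonneg ht0.le ht1
  refine hasLyapunov_of_ratio (η := 1 - t / 6 - 3 / 100 * t ^ 2) (H := 866 / 1000) three_pos ht0
    (by linarith) (by nlinarith) (by nlinarith [h 2 0, h 3 0]) (hq.trans ?_) (by norm_num)
    (by norm_num) ?_
  · linarith [h 1 5, h 2 4, h 3 3, h 4 2, h 5 1, h 6 0]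
  · linarith [h 1 16, h 2 15, h 3 14, h 4 13, h 5 12, h 6 11, h 7 10, h 8 9, h 9 8, h 10 7, h 11 6,
      h 12 5, h 13 4, h 14 3, h 15 2, h 16 1, h 17 0]

lemma hasLyapunov_four (ht0 : 0 < t) (ht1 : t ≤ 1 / 2) (hq : q ≤ (1 - 2 * t / 4) ^ 4) :
    HasLyapunov q g 4 (1 / 2 + √((1 - t) / (t ^ 2 * 4))) := by
  have h := bernstein_nonneg ht0.le ht1
  refine hasLyapunov_of_ratio (η := 1 - t / 4) (H := 1) four_pos ht0 ht1 (by linarith)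
    (by nlinarith) (hq.trans_eq (by ring)) (by norm_num) (by norm_num) ?_
  linarith [h 1 11, h 2 10, h 3 9, h 4 8, h 5 7, h 6 6, h 7 5, h 8 4, h 9 3, h 10 2, h 11 1,
      h 12 0]

lemma hasLyapunov_five (ht0 : 0 < t) (ht1 : t ≤ 1 / 2) (hq : q ≤ (1 - 2 * t / 6) ^ 6) :
    HasLyapunov q g 5 (1 / 2 + √((1 - t) / (t ^ 2 * 5))) := by
  have h := bernstein_nonneg ht0.le ht1
  refine hasLyapunov_of_ratio (η := 1 - t / 3 + t ^ 2 / 27) (H := 1118 / 1000) (by norm_num) ht0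
    ht1 (by nlinarith) (by nlinarith [h 2 1, h 2 0]) (hq.trans_eq (by ring)) (by norm_num)
    (by norm_num) ?_
  linarith [h 1 16, h 2 15, h 3 14, h 4 13, h 5 12, h 6 11, h 7 10, h 8 9, h 9 8, h 10 7, h 11 6,
    h 12 5, h 13 4, h 14 3, h 15 2, h 16 1, h 17 0]

lemma hasLyapunov_six {b : ℝ} (hb : 6 ≤ b) (ht0 : 0 < t) (ht1 : t ≤ 1 / 2)
    (hq : q ≤ (1 - 2 * t / 8) ^ 8) :
    HasLyapunov q g b (1 / 2 + √((1 - t) / (t ^ 2 * b))) := by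
  have h := bernstein_nonneg ht0.le ht1
  -- The square root of the bound (1 - t/4)^8 on q.
  have h2 : (1 - t / 4) ^ 4 ≤ 1 - t * (1 - 3 / 8 * t + 6 / 100 * t ^ 2) := by
    nlinarith [h 3 1, h 3 0]
  refine hasLyapunov_of_ratio (η := 1 - 3 / 8 * t + 6 / 100 * t ^ 2) (H := 122 / 100)
    (by linarith) ht0 ht1 (by nlinarith) (by nlinarith [h 2 1, h 2 0])
    (hq.trans ?_) (by norm_num) (by linarith) ?_
  · calc (1 - 2 * t / 8) ^ 8 = ((1 - t / 4) ^ 4) ^ 2 := by ring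
      _ ≤ _ := by
        have : 0 ≤ (1 - t / 4) ^ 4 := by positivity
        gcongr
  linarith [h 1 16, h 2 15, h 3 14, h 4 13, h 5 12, h 6 11, h 7 10, h 8 9, h 9 8, h 10 7, h 11 6,
    h 12 5, h 13 4, h 14 3, h 15 2, h 16 1, h 17 0]

lemma hasLyapunov_eight {b : ℝ} (hb : 8 ≤ b) (ht0 : 0 < t) (ht1 : t ≤ 1 / 2)
    (hq : q ≤ Real.exp (-(2 * t))) :
    HasLyapunov q g b (1 / 2 + √((1 - t) / (t ^ 2 * b))) := by
  have h := bernstein_nonneg ht0.le ht1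
  have h2 : Real.exp (-t) ≤ 1 - t * (1 - t / 2 + 14 / 100 * t ^ 2) := by
    have h3 := Real.exp_bound (x := -t) (n := 4) (by rw [abs_neg, abs_of_pos ht0]; linarith)
      (by norm_num)
    have h4 := le_of_abs_le h3
    rw [abs_neg, abs_of_pos ht0] at h4
    norm_num [Finset.sum_range_succ, Nat.factorial] at h4
    nlinarith [h 3 1, h 3 0]
  refine hasLyapunov_of_ratio (η := 1 - t / 2 + 14 / 100 * t ^ 2) (H := 141 / 100)
    (by linarith) ht0 ht1 (by nlinarith) (by nlinarith [h 2 1, h 2 0])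
    (hq.trans ?_) (by norm_num) (by linarith) ?_
  · calc Real.exp (-(2 * t)) = Real.exp (-t) ^ 2 := by rw [← Real.exp_nat_mul]; ring_nf
      _ ≤ _ := by
        have := Real.exp_pos (-t)
        gcongr
  linarith [h 1 16, h 2 15, h 3 14, h 4 13, h 5 12, h 6 11, h 7 10, h 8 9, h 9 8, h 10 7, h 11 6,
    h 12 5, h 13 4, h 14 3, h 15 2, h 16 1, h 17 0]

/-- The exceptional case n = b = 3, where q = 8/27. Here α > β: the guaranteed size of the squared
mean, g = 7/81, is used. Since θ = 1 and h = 9/10, a - m = 5/9. -/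
lemma hasLyapunov_three_three {ν : ℝ} (hν : 13 / 10 ≤ ν) :
    HasLyapunov (8 / 27) (7 / 81) 3 ν := by
  have h : 1 / (3 * ν) ≤ 1 / (3 * (13 / 10)) :=
    one_div_le_one_div_of_le (by norm_num) (by linarith)
  refine ⟨1, 9 / 10, 51 / 100, 1 / 4, 917 / 1000, 4315 / 10000, 115 / 100, 115 / 100 - 5 / 9,
    ?_, ?_, ?_, ?_, ?_, ?_, ?_, ?_, ?_, ?_, ?_, ?_, ?_, ?_⟩
  all_goals linarith

/-- With `t = b / (2 n)`, the proximal parameter which SAGA tolerates. -/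
def sagaBound (n b : ℕ) : ℝ :=
  1 / 2 + √((1 - (b : ℝ) / (2 * n)) / (((b : ℝ) / (2 * n)) ^ 2 * b))

lemma hasLyapunov_saga {n b : ℕ} (hb : 0 < b) (hbn : b ≤ n) :
    HasLyapunov ((1 - 1 / (n : ℝ)) ^ b) 0 b (sagaBound n b) ∨ (n = 3 ∧ b = 3) := by
  have hn : 0 < n := hb.trans_le hbn
  have hn' : (0 : ℝ) < n := by positivity
  have hb' : (0 : ℝ) < b := by positivity
  have hbn' : (b : ℝ) ≤ n := by exact_mod_cast hbn
  have ht0 : 0 < (b : ℝ) / (2 * n) := by positivity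
  have ht1 : (b : ℝ) / (2 * n) ≤ 1 / 2 := by rw [div_le_iff₀ (by positivity)]; linarith
  have hq : (1 - 1 / (n : ℝ)) ^ b = (1 - 2 * ((b : ℝ) / (2 * n)) / b) ^ b := by
    congr 2; field_simp
  have hmono : ∀ {k : ℕ}, b ≤ k →
      (1 - 1 / (n : ℝ)) ^ b ≤ (1 - 2 * ((b : ℝ) / (2 * n)) / k) ^ k := fun {k} hk => by
    rw [hq]
    exact one_sub_div_pow_le_pow hb hk (by
      have : (1 : ℝ) ≤ b := by exact_mod_cast hb
      linarith)
  rw [sagaBound]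
  set t := (b : ℝ) / (2 * n) with ht
  by_cases h8 : 8 ≤ b
  · left
    refine hasLyapunov_eight (by exact_mod_cast h8) ht0 ht1 ?_
    rw [hq]
    exact Real.one_sub_div_pow_le_exp_neg (by linarith [(by exact_mod_cast hb : (1 : ℝ) ≤ b)])
  by_cases h33 : n = 3 ∧ b = 3
  · exact Or.inr h33
  left
  clear_value t
  interval_cases b
  · have := hmono (k := 1) le_rfl
    norm_num at this ⊢
    simpa using hasLyapunov_one ht0 ht1 (by simpa using this)
  · have := hmono (k := 2) le_rfl
    exact_mod_cast hasLyapunov_two ht0 ht1 (by exact_mod_cast this)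
  · have := hmono (k := 3) le_rfl
    have hn4 : (4 : ℝ) ≤ n := by
      have : 4 ≤ n := by omega
      exact_mod_cast this
    have ht2 : t ≤ 3 / 8 := by
      rw [ht, div_le_iff₀ (by positivity)]; push_cast; linarith
    exact_mod_cast hasLyapunov_three ht0 ht2 (by exact_mod_cast this)
  · have := hmono (k := 4) le_rfl
    exact_mod_cast hasLyapunov_four ht0 ht1 (by exact_mod_cast this)
  · have := hmono (k := 6) (by norm_num)
    exact_mod_cast hasLyapunov_five ht0 ht1 (by exact_mod_cast this)
  · have := hmono (k := 8) (by norm_num)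
    exact hasLyapunov_six (by norm_num) ht0 ht1 (by exact_mod_cast this)
  · have := hmono (k := 8) (by norm_num)
    exact hasLyapunov_six (by norm_num) ht0 ht1 (by exact_mod_cast this)

end BatchSizes

/-! ### The constants of MM-SAGA in the hypothesis of the theorem. -/

section SagaConstants

variable {V : Type*} [NormedAddCommGroup V] [InnerProductSpace ℝ V]

lemma mean_unseen_three (w : Fin 3 → V) :
    7 / 81 * msq w
      ≤ ∑ a : Fin 3 → Fin 3, (1 / ((3 : ℕ) : ℝ)) ^ 3 * ‖mean (unseen w a)‖ ^ 2 := by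
  rw [batch_norm_mean_unseen_sq (by norm_num)]
  have := msq_nonneg w
  have : 0 ≤ ‖mean w‖ ^ 2 := by positivity
  norm_num

lemma sagaBound_pos (n b : ℕ) : 0 < sagaBound n b := by rw [sagaBound]; positivity

lemma sagaBound_three : 13 / 10 ≤ sagaBound 3 3 := by
  have : (8 / 10 : ℝ) ≤ √((1 - ((3 : ℕ) : ℝ) / (2 * ((3 : ℕ) : ℝ)))
      / ((((3 : ℕ) : ℝ) / (2 * ((3 : ℕ) : ℝ))) ^ 2 * ((3 : ℕ) : ℝ))) :=
    Real.le_sqrt_of_sq_le (by norm_num)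
  rw [sagaBound]; linarith

/-- With V = 0 and t = b/(2n), V_Υ/ρ = L²(1 - t)/(t²b); taking square roots turns the hypothesis
into this bound. -/
lemma mul_sagaBound_lt {n b m : ℕ} (hb : 0 < b) (hbn : b ≤ n) {L μ : ℝ} (hL : 0 < L)
    (hμ : L / 2 < μ) (hcond : (2 * μ - L) ^ 2
      - 4 * (VConst .saga b L + VUpsilon .saga n b m L / rho .saga n b m) > 0) :
    L * sagaBound n b < μ := by
  have hn : (0 : ℝ) < n := by exact_mod_cast hb.trans_le hbn
  have hb' : (0 : ℝ) < b := by positivity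
  have hbn' : (b : ℝ) ≤ n := by exact_mod_cast hbn
  set s := (1 - (b : ℝ) / (2 * n)) / (((b : ℝ) / (2 * n)) ^ 2 * b) with hs
  have e : VConst .saga b L + VUpsilon .saga n b m L / rho .saga n b m = L ^ 2 * s := by
    simp only [VConst, VUpsilon, rho, hs]; field_simp; ring
  have hs0 : 0 ≤ s := by
    have : (b : ℝ) / (2 * n) ≤ 1 := by rw [div_le_one (by positivity)]; linarith
    exact div_nonneg (by linarith) (by positivity)
  rw [e] at hcond
  have h1 : √s < (μ - L / 2) / L := by
    rw [Real.sqrt_lt' (div_pos (by linarith) hL), div_pow, lt_div_iff₀ (by positivity)]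
    linarith
  rw [lt_div_iff₀ hL] at h1
  rw [sagaBound, ← hs]
  linarith

end SagaConstants

end SVRMM

end

theorem theoremt {Ω : Type*} [MeasurableSpace Ω] (P : Measure Ω) [IsProbabilityMeasure P]
    (M : SVRMM.Method) {d n b m : ℕ} (hn : 0 < n) (hb : 0 < b) (hm : 0 < m)
    (hbn : M = SVRMM.Method.saga → b ≤ n)
    (f : Fin n → EuclideanSpace ℝ (Fin d) → ℝ) (r : EuclideanSpace ℝ (Fin d) → EReal)
    (u : EuclideanSpace ℝ (Fin d) → EuclideanSpace ℝ (Fin d) → EReal) (L μ : ℝ)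
    (hbasic : SVRMM.BasicAssumption f r L)
    (hsurr : SVRMM.IsSurrogate r u) (hu : SVRMM.SurrogateAssumption r u)
    (hμ : L / 2 < μ)
    (hcond : (2 * μ - L) ^ 2
      - 4 * (SVRMM.VConst M b L + SVRMM.VUpsilon M n b m L / SVRMM.rho M n b m) > 0)
    (I : ℕ → Ω → Fin b → Fin n) (c : ℕ → Ω → Bool) (hsamp : SVRMM.IsSampling M P m I c)
    (x0 : EuclideanSpace ℝ (Fin d)) (x : ℕ → Ω → EuclideanSpace ℝ (Fin d))
    (hrun : ∀ ω, SVRMM.IsRun M f u μ x0 (fun k => I k ω) (fun k => c k ω) (fun k => x k ω)) :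
    (∀ᵐ ω ∂P, ∃ l : ℝ,
      Tendsto (fun k => SVRMM.objective f r (x k ω)) atTop (𝓝 (l : EReal))) ∧
    (∀ᵐ ω ∂P, Summable (fun k => ‖x (k + 1) ω - x k ω‖ ^ 2) ∧
      Tendsto (fun k => ‖x (k + 1) ω - x k ω‖ ^ 2) atTop (𝓝 0)) ∧
    (∀ᵐ ω ∂P, ∀ xstar : EuclideanSpace ℝ (Fin d),
      (∃ φ : ℕ → ℕ, StrictMono φ ∧ Tendsto (fun j => x (φ j) ω) atTop (𝓝 xstar)) →
      SVRMM.IsStationary (SVRMM.objective f r) xstar) := by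
  rcases M with _ | _ | _
  · have hbn := hbn rfl
    have hlt := SVRMM.mul_sagaBound_lt hb hbn hbasic.pos hμ hcond
    rcases SVRMM.hasLyapunov_saga hb hbn with h | ⟨rfl, rfl⟩
    · refine SVRMM.saga_ae_convergence hn hb hbasic hsurr hu hμ (SVRMM.sagaBound_pos n b) hlt h
        (fun w => ?_) hsamp hrun
      -- Outside the exceptional case g = 0, so the bound on the mean is trivial.
      rw [zero_mul]
      positivity
    · refine SVRMM.saga_ae_convergence hn hb hbasic hsurr hu hμ (SVRMM.sagaBound_pos 3 3) hlt
        (g := 7 / 81) ?_ SVRMM.mean_unseen_three hsamp hrun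
      have h := SVRMM.hasLyapunov_three_three SVRMM.sagaBound_three
      convert h using 1
      all_goals norm_num
  · refine SVRMM.svrg_ae_convergence hn hb hm hbasic hsurr hu hμ ?_ hsamp hrun
    simpa only [SVRMM.VConst, SVRMM.VUpsilon, SVRMM.rho, zero_add] using hcond
  · exact SVRMM.sarah_ae_convergence hn hb hm hbasic hsurr hu hμ hcond hsamp hrun
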